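/- Let $x_1,\dots,x_n$ be variables with nonempty finite domains $D_1,\dots,D_n$, and let $m=\sum_i|D_i|$. For a tuple $(d_1,\dots,d_n)$ with $d_i\in D_i$ let $\mathrm{violation}(d_1,\dots,d_n)=|\{(i,j): i<j,\ d_i=d_j\}|$. For a nonempty finite set $D_z$ of integers, the constraint $\mathrm{softalldiff}(x_1,\dots,x_n,z)$ is the set of all $(d_1,\dots,d_n,\tilde d)$ with $d_i\in D_i$, $\tilde d\in D_z$ and $\mathrm{violation}(d_1,\dots,d_n)\le\tilde d$; it is consistent if this set is nonempty. Let $G$ be the directed multigraph with vertices $s,t,x_1,\dots,x_n$ and the elements of $D_X=\bigcup_i D_i$, and with arcs $(s,x_i)$ for every $i$, $(x_i,d)$ for every $i$ and $d\in D_i$, and, for each $d\in D_X$ that lies in exactly $k$ of the domains, $k$ parallel arcs $(d,t)_0,\dots,(d,t)_{k-1}$. All capacities are $1$, the arc $(d,t)_j$ has cost $j$, and all other arcs have cost $0$. A minimum-cost flow is a feasible $s$-$t$ flow of maximum value and, among those, of minimum cost. For a feasible flow $f$, the residual graph $G_f$ contains the arcs $a$ with $f(a)<1$, and the reversals $a^{-1}$,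 of cost $-w(a)$, of the arcs $a$ with $f(a)>0$. The successive-shortest-path algorithm starts with $f=0$; while $G_f$ has an $s$-$t$ path (with distinct vertices), it takes any such path $P$ of minimum cost and replaces $f$ by $f+\varepsilon\chi^P$, with $\varepsilon$ maximal such that $0\le f+\varepsilon\chi^P\le 1$; here $\chi^P$ is $1$ on the arcs $a$ that $P$ traverses, $-1$ on the arcs $a$ whose reversal $P$ traverses, and $0$ elsewhere. Then, whatever minimum-cost paths are chosen, the algorithm makes exactly $n$ augmentations, each with $\varepsilon=1$. Of the arcs $(s,x_i)$, the arcs $(d,t)_j$ and their reversals, each augmenting path uses exactly one arc $(s,x_i)$ and exactly one arc $(d,t)_j$, both in the forward direction. After the $n$-th augmentation no $s$-$t$ path exists in $G_f$, and $f$ is a minimum-cost flow. Moreover, for $n\ge 1$, on a unit-cost random access machine with addition, subtraction, comparison and indexed memory access, whose input consists of $n$ and the lists of the values in the domains, there are fixed programs and an absolute constant $C$ such that: (a) for every flow $f$ that occurs in the algorithm, a minimum-cost $s$-$t$ path in $G_f$ is found, or it is reported that no $s$-$t$ path exists, in at most $Cm$ steps; also setting $f=0$ and performing one augmentation take at most $Cm$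 steps each; (b) the successive-shortest-path algorithm, composed of the programs in (a), computes a minimum-cost flow in $G$ in at most $Cnm$ steps in total; (c) given in addition the increasing list of the elements of $D_z$, it is decided in at most $Cnm$ steps whether $\mathrm{softalldiff}(x_1,\dots,x_n,z)$ is consistent. -/

import Mathlib

open scoped NNReal

namespace SoftAlldiff

/-! ## Flows in directed multigraphs -/

/-- A directed graph with vertices `V` and a family of arcs indexed by `A` (parallel arcs allowed),
with a source, a sink, and nonnegative capacities and costs. -/
structure Network (V A : Type*) where
  tail : A → V
  head : A → V
  source : V
  sink : V
  cap : A → ℝ≥0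
  cost : A → ℝ≥0

/-- A residual arc: an arc `a` or its reversal `a⁻¹`. -/
inductive ResArc (A : Type*) where
  | fwd (a : A) : ResArc A
  | bwd (a : A) : ResArc A

namespace ResArc

variable {A : Type*}

/-- The arc of the original graph underlying `a` or `a⁻¹`. -/
def arc : ResArc A → A
  | fwd a => a
  | bwd a => a

/-- `1` for `a` and `-1` for `a⁻¹`. -/
def dir : ResArc A → ℤ
  | fwd _ => 1
  | bwd _ => -1

end ResArc

namespace Network

variable {V A : Type*} [Fintype A] (N : Network V A)

open Classical in
/-- `f(δ^out(v))` -/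
noncomputable def outflow (f : A → ℝ) (v : V) : ℝ := ∑ a with N.tail a = v, f a

open Classical in
/-- `f(δ^in(v))` -/
noncomputable def inflow (f : A → ℝ) (v : V) : ℝ := ∑ a with N.head a = v, f a

/-- `f` is a flow from the source to the sink. -/
def IsFlow (f : A → ℝ) : Prop :=
  (∀ a, 0 ≤ f a) ∧ ∀ v, v ≠ N.source → v ≠ N.sink → N.outflow f v = N.inflow f v

/-- `f` is a flow under the capacities. -/
def IsFeasible (f : A → ℝ) : Prop :=
  N.IsFlow f ∧ ∀ a, f a ≤ N.cap a

noncomputable def value (f : A → ℝ) : ℝ := N.outflow f N.source - N.inflow f N.source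

noncomputable def flowCost (f : A → ℝ) : ℝ := ∑ a, (N.cost a : ℝ) * f a

/-- A feasible flow of maximum value, and of minimum cost among those. -/
def IsMinCostFlow (f : A → ℝ) : Prop :=
  N.IsFeasible f ∧ (∀ g, N.IsFeasible g → N.value g ≤ N.value f) ∧
    ∀ g, N.IsFeasible g → N.value g = N.value f → N.flowCost f ≤ N.flowCost g

end Network

namespace Network

variable {V A : Type*} (N : Network V A)

def resTail : ResArc A → V
  | .fwd a => N.tail a
  | .bwd a => N.head a

def resHead : ResArc A → V
  | .fwd a => N.head a
  | .bwd a => N.tail a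

/-- The cost, extended by `w(a⁻¹) = - w(a)`. -/
def resCost : ResArc A → ℝ
  | .fwd a => N.cost a
  | .bwd a => -(N.cost a : ℝ)

/-- The residual arc belongs to the residual graph of `f`. -/
def InResidual (f : A → ℝ) : ResArc A → Prop
  | .fwd a => f a < N.cap a
  | .bwd a => 0 < f a

/-- The sequence of residual arcs is a directed walk from `u` to `v`. -/
def IsWalk : V → List (ResArc A) → V → Prop
  | u, [], v => u = v
  | u, r :: p, v => N.resTail r = u ∧ IsWalk (N.resHead r) p v

/-- `p` is a directed path (all vertices distinct) from the source to the sink in the residual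
graph of `f`. -/
def IsResPath (f : A → ℝ) (p : List (ResArc A)) : Prop :=
  N.IsWalk N.source p N.sink ∧ (∀ r ∈ p, N.InResidual f r) ∧
    (N.source :: p.map N.resHead).Nodup

def pathCost (p : List (ResArc A)) : ℝ := (p.map N.resCost).sum

def IsMinCostResPath (f : A → ℝ) (p : List (ResArc A)) : Prop :=
  N.IsResPath f p ∧ ∀ q, N.IsResPath f q → N.pathCost p ≤ N.pathCost q

end Network

open Classical in
/-- The incidence vector `χ^P` of a path in the residual graph. -/
noncomputable def chi {A : Type*} (p : List (ResArc A)) (a : A) : ℝ :=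
  if ResArc.fwd a ∈ p then 1 else if ResArc.bwd a ∈ p then -1 else 0

namespace Network

variable {V A : Type*} (N : Network V A)

/-- `ε` is maximal such that `0 ≤ f + ε χ^P ≤ c`. -/
def IsMaxStep (f : A → ℝ) (p : List (ResArc A)) (ε : ℝ) : Prop :=
  IsGreatest {δ : ℝ | ∀ a, 0 ≤ f a + δ * chi p a ∧ f a + δ * chi p a ≤ N.cap a} ε

/-- `N.SSPRun l f`: the successive-shortest-path algorithm, started with the zero flow, can perform
the augmentations listed in `l` (path and amount, in this order), and its flow is then `f`. -/
inductive SSPRun : List (List (ResArc A) × ℝ) → (A → ℝ) → Prop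
  | init : SSPRun [] 0
  | step {l : List (List (ResArc A) × ℝ)} {f : A → ℝ} {p : List (ResArc A)} {ε : ℝ} :
      SSPRun l f → N.IsMinCostResPath f p → N.IsMaxStep f p ε →
      SSPRun (l ++ [(p, ε)]) (f + ε • chi p)

end Network

/-! ## The soft alldifferent constraint and its graph -/

section Constraint

variable {α : Type*} [DecidableEq α] {n : ℕ}

/-- The number of pairs `i < j` with `x i = x j`. -/
def violation (x : Fin n → α) : ℕ :=
  (Finset.univ.filter fun p : Fin n × Fin n => p.1 < p.2 ∧ x p.1 = x p.2).card

def softAlldiff (D : Fin n → Finset α) (Dz : Finset ℤ) : Set ((Fin n → α) × ℤ) :=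
  {p | (∀ i, p.1 i ∈ D i) ∧ p.2 ∈ Dz ∧ (violation p.1 : ℤ) ≤ p.2}

/-- The constraint has a solution. -/
def Consistent (D : Fin n → Finset α) (Dz : Finset ℤ) : Prop :=
  (softAlldiff D Dz).Nonempty

/-- `m`, the sum of the cardinalities of the domains. -/
def domSum (D : Fin n → Finset α) : ℕ := ∑ i, (D i).card

/-- `D_X`, the union of the domains. -/
def DX (D : Fin n → Finset α) : Finset α := Finset.univ.biUnion D

/-- The variables that have the value `d` in their domain. -/
def owners (D : Fin n → Finset α) (d : α) : Finset (Fin n) :=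
  Finset.univ.filter fun i => d ∈ D i

inductive Vertex (D : Fin n → Finset α) where
  | s : Vertex D
  | t : Vertex D
  | var (i : Fin n) : Vertex D
  | val (d : DX D) : Vertex D

/-- The arcs: `(s, x_i)` for each `i`, then `(x_i, d)` for `d ∈ D_i`, then the parallel arcs
`(d, t)_0, (d, t)_1, …`, as many as there are variables with `d` in their domain. -/
abbrev Arc (D : Fin n → Finset α) : Type _ :=
  Fin n ⊕ (Σ i : Fin n, D i) ⊕ (Σ d : DX D, Fin (owners D d).card)

abbrev srcArc {D : Fin n → Finset α} (i : Fin n) : Arc D := Sum.inl i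

abbrev domArc {D : Fin n → Finset α} (i : Fin n) (d : D i) : Arc D := Sum.inr (Sum.inl ⟨i, d⟩)

abbrev snkArc {D : Fin n → Finset α} (d : DX D) (k : Fin (owners D d).card) : Arc D :=
  Sum.inr (Sum.inr ⟨d, k⟩)

/-- A value of one domain as a member of the union of the domains. -/
def toDX {D : Fin n → Finset α} (i : Fin n) (d : D i) : DX D :=
  ⟨d.1, Finset.mem_biUnion.2 ⟨i, Finset.mem_univ i, d.2⟩⟩

/-- The graph `G`, with all capacities `1`, cost `k` on `(d, t)_k` and cost `0` on other arcs. -/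
def graph (D : Fin n → Finset α) : Network (Vertex D) (Arc D) where
  tail
    | .inl _ => .s
    | .inr (.inl q) => .var q.1
    | .inr (.inr q) => .val q.1
  head
    | .inl i => .var i
    | .inr (.inl q) => .val (toDX q.1 q.2)
    | .inr (.inr _) => .t
  source := .s
  sink := .t
  cap _ := 1
  cost
    | .inl _ => 0
    | .inr (.inl _) => 0
    | .inr (.inr q) => (q.2 : ℕ)

/-- `0`, `1`, `2` for arcs leaving `s`, arcs `(x_i, d)`, and arcs entering `t`. -/
def kind {D : Fin n → Finset α} : Arc D → ℕ
  | .inl _ => 0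
  | .inr (.inl _) => 1
  | .inr (.inr _) => 2

end Constraint

/-! ## A random access machine with a step count

Memory cells hold integers; there are scalar registers and arrays that are accessed by a computed
index. The only arithmetic is addition and subtraction. A program mentions finitely many registers
and arrays, so this is a unit-cost random access machine with structured control flow. -/

structure Store where
  var : ℕ → ℤ
  arr : ℕ → ℤ → ℤ

inductive Exp where
  | const (z : ℤ) : Exp
  | var (x : ℕ) : Exp
  | arr (a : ℕ) (i : Exp) : Exp
  | add (e₁ e₂ : Exp) : Exp
  | sub (e₁ e₂ : Exp) : Exp

namespace Exp

def eval (s : Store) : Exp → ℤ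
  | const z => z
  | var x => s.var x
  | arr a i => s.arr a (i.eval s)
  | add e₁ e₂ => e₁.eval s + e₂.eval s
  | sub e₁ e₂ => e₁.eval s - e₂.eval s

/-- The number of steps of an evaluation: one for each operation. -/
def time : Exp → ℕ
  | const _ => 1
  | var _ => 1
  | arr _ i => i.time + 1
  | add e₁ e₂ => e₁.time + e₂.time + 1
  | sub e₁ e₂ => e₁.time + e₂.time + 1

end Exp

inductive Test where
  | le (e₁ e₂ : Exp) : Test
  | eq (e₁ e₂ : Exp) : Test
  | not (b : Test) : Test
  | and (b₁ b₂ : Test) : Test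

namespace Test

def eval (s : Store) : Test → Prop
  | le e₁ e₂ => e₁.eval s ≤ e₂.eval s
  | eq e₁ e₂ => e₁.eval s = e₂.eval s
  | not b => ¬ b.eval s
  | and b₁ b₂ => b₁.eval s ∧ b₂.eval s

def time : Test → ℕ
  | le e₁ e₂ => e₁.time + e₂.time + 1
  | eq e₁ e₂ => e₁.time + e₂.time + 1
  | not b => b.time + 1
  | and b₁ b₂ => b₁.time + b₂.time + 1

end Test

inductive Program where
  | skip : Program
  | assign (x : ℕ) (e : Exp) : Program
  | store (a : ℕ) (i e : Exp) : Program
  | seq (c₁ c₂ : Program) : Program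
  | ite (b : Test) (c₁ c₂ : Program) : Program
  | loop (b : Test) (c : Program) : Program

namespace Store

def setVar (s : Store) (x : ℕ) (z : ℤ) : Store :=
  { s with var := Function.update s.var x z }

def setArr (s : Store) (a : ℕ) (i z : ℤ) : Store :=
  { s with arr := Function.update s.arr a (Function.update (s.arr a) i z) }

end Store

/-- `Exec c s s' T`: the program `c`, started in `s`, halts in `s'` after `T` steps. -/
inductive Exec : Program → Store → Store → ℕ → Prop
  | skip (s : Store) : Exec .skip s s 1
  | assign (s : Store) (x : ℕ) (e : Exp) :
      Exec (.assign x e) s (s.setVar x (e.eval s)) (e.time + 1)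
  | store (s : Store) (a : ℕ) (i e : Exp) :
      Exec (.store a i e) s (s.setArr a (i.eval s) (e.eval s)) (i.time + e.time + 1)
  | seq {c₁ c₂ : Program} {s s' s'' : Store} {T₁ T₂ : ℕ} :
      Exec c₁ s s' T₁ → Exec c₂ s' s'' T₂ → Exec (.seq c₁ c₂) s s'' (T₁ + T₂)
  | iteTrue {b : Test} {c₁ c₂ : Program} {s s' : Store} {T : ℕ} :
      b.eval s → Exec c₁ s s' T → Exec (.ite b c₁ c₂) s s' (b.time + T + 1)
  | iteFalse {b : Test} {c₁ c₂ : Program} {s s' : Store} {T : ℕ} :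
      ¬ b.eval s → Exec c₂ s s' T → Exec (.ite b c₁ c₂) s s' (b.time + T + 1)
  | loopTrue {b : Test} {c : Program} {s s' s'' : Store} {T₁ T₂ : ℕ} :
      b.eval s → Exec c s s' T₁ → Exec (.loop b c) s' s'' T₂ →
      Exec (.loop b c) s s'' (b.time + T₁ + T₂ + 1)
  | loopFalse {b : Test} {c : Program} {s : Store} :
      ¬ b.eval s → Exec (.loop b c) s s (b.time + 1)

/-! ## Inputs, flows and paths in memory -/

section Encoding

variable {α : Type*} [DecidableEq α] {n : ℕ} {D : Fin n → Finset α}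

/-- The position at which the list of the domain with index `i` starts, when the lists of all
domains are stored one after the other. -/
def start (D : Fin n → Finset α) (i : ℕ) : ℕ :=
  ∑ j ∈ Finset.univ.filter (fun j : Fin n => (j : ℕ) < i), (D j).card

/-- The position of `d ∈ D_i`, when each domain is listed in the order given by `e`. -/
def pos (e : ∀ i, Fin (D i).card ≃ D i) (i : Fin n) (d : D i) : ℕ :=
  start D i + ((e i).symm d : ℕ)

/-- The `k`-th variable with `d` in its domain. -/
def owner (d : DX D) (k : Fin (owners D d).card) : Fin n :=
  (owners D d).orderEmbOfFin rfl k

theorem mem_owner (d : DX D) (k : Fin (owners D d).card) : d.1 ∈ D (owner d k) :=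
  (Finset.mem_filter.1 ((owners D d).orderEmbOfFin_mem rfl k)).2

/-- The cell that belongs to an arc: `i` for `(s, x_i)`, the position of `d ∈ D_i` for `(x_i, d)`,
and for `(d, t)_k` the position of the value `d` in the domain of the `k`-th variable having it. -/
def cell (e : ∀ i, Fin (D i).card ≃ D i) : Arc D → ℕ
  | .inl i => i
  | .inr (.inl q) => pos e q.1 q.2
  | .inr (.inr q) => pos e (owner q.1 q.2) ⟨q.1.1, mem_owner q.1 q.2⟩

/-- The domains in memory: `n` in register `0`, the starting positions in array `0`, and the
concatenated lists of values, named by integers, in array `1`. -/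
def EncodesDomains (code : DX D ↪ ℤ) (e : ∀ i, Fin (D i).card ≃ D i) (s : Store) : Prop :=
  s.var 0 = n ∧ (∀ i : ℕ, i ≤ n → s.arr 0 i = start D i) ∧
    ∀ (i : Fin n) (d : D i), s.arr 1 (pos e i d) = code (toDX i d)

/-- The domain of the cost variable in memory: its size in register `1`, and its increasing list
in array `2`. -/
def EncodesCostDomain (Dz : Finset ℤ) (s : Store) : Prop :=
  s.var 1 = Dz.card ∧ ∀ k : Fin Dz.card, s.arr 2 (k : ℕ) = Dz.orderEmbOfFin rfl k

/-- A flow in memory: its values on the three kinds of arcs in the arrays `3`, `4`, `5`. -/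
def EncodesFlow (e : ∀ i, Fin (D i).card ≃ D i) (f : Arc D → ℝ) (s : Store) : Prop :=
  ∀ a, (s.arr (3 + kind a) (cell e a) : ℝ) = f a

/-- A path in memory: its length in register `3`, and for each of its residual arcs the kind, the
cell and the direction in the arrays `6`, `7`, `8`. -/
def EncodesPath (e : ∀ i, Fin (D i).card ≃ D i) (p : List (ResArc (Arc D))) (s : Store) : Prop :=
  s.var 3 = p.length ∧ ∀ j : Fin p.length,
    s.arr 6 (j : ℕ) = kind (p.get j).arc ∧ s.arr 7 (j : ℕ) = cell e (p.get j).arc ∧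
      s.arr 8 (j : ℕ) = (p.get j).dir

end Encoding

/-- The successive-shortest-path algorithm, assembled from programs for its three steps: set
`f = 0`; find a minimum-cost path in the residual graph (register `2` tells whether there is one);
as long as there is one, augment `f` along it and find the next path. -/
def sspProgram (init findPath augment : Program) : Program :=
  .seq init (.seq findPath
    (.loop (.eq (.var 2) (.const 1)) (.seq augment findPath)))

end SoftAlldiff

open SoftAlldiff

/-! Only the arcs into `t` have a cost. A residual path meets `s` and `t` only at its ends, so it
consists of one arc `(s, x_i)`, of inner residual arcs (arcs `(x_i, d)` and their reversals, of cost
0) and of one arc `(d, t)_k`; its cost is `k` (`resPath_form`, `pathCost_form`).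

The flows of the algorithm satisfy the invariant `Balanced`: they are 0-1 flows, the arcs `(d, t)_k`
are used exactly for `k < L d`, and `L d ≤ L d' + 1` whenever inner residual arcs lead from `d` to
`d'`. The last condition says that moving the dearest unit at `d`, of cost `L d - 1`, to the next
arc at `d'`, of cost `L d'`, does not pay. A cheapest path ends with `(d, t)_{L d}`, where `d` has
the least level among all values reachable from unassigned variables. Augmentation preserves the
invariant (`Balanced.augment`): a connection that is new after the augmentation runs through
reversed arcs of the path, so its start reached `d` before and its end was reachable from `x_i`
before, and minimality bounds the level at that end.

All steps are 1, and each fills one more arc `(s, x_i)`. As long as some `x_i` is unassigned, its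
domain gives a path; after `n` steps nothing leaves `s`. Optimality then follows by duality: with
the potential of `d` defined as the least level reachable from `d`, the cost splits into terms each
of which the flow minimizes (`Balanced.isMinCostFlow`). A saturated balanced flow comes from a
tuple, and the cost of the flow of a tuple is its violation, because `q` equal entries contribute `0
+ 1 + ... + (q - 1)`; hence `Balanced.consistent_iff`.

For the running time, all tables are filled by sweeps over the `m` cells of the concatenated
domains. Each `(d, t)_k` shares the cell of the `k`-th variable having `d`, so a sweep meets the
parallel arcs of each value in order of cost and a counter per value yields `k`. The search enqueues
each variable at most once and marks each value at most once; linked lists give the variables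
assigned to a value. Every marked value records a parent cell and a depth, and following the parents
backwards writes a path whose vertices are distinct because the depths strictly decrease.
Correctness combines loop invariants (`Runs.loop`, `Runs.forLoop`), direct evaluation of loop-free
bodies (`Program.sem`), and the fact that a program changes only what it mentions as a target
(`Exec.unchanged`). -/

namespace SoftAlldiff

/-! ## Walks in residual graphs -/

namespace Network

variable {V A : Type*} {N : Network V A}

theorem IsWalk.append {p q : List (ResArc A)} {u v w : V} (hp : N.IsWalk u p v)
    (hq : N.IsWalk v q w) : N.IsWalk u (p ++ q) w := by
  induction p generalizing u with
  | nil => cases hp; exact hq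
  | cons r p ih => exact ⟨hp.1, ih hp.2⟩

theorem IsWalk.end_mem {p : List (ResArc A)} {u v : V} (h : N.IsWalk u p v) (hp : p ≠ []) :
    v ∈ p.map N.resHead := by
  induction p generalizing u with
  | nil => exact absurd rfl hp
  | cons r p ih =>
    rcases eq_or_ne p [] with rfl | hp'
    · have : N.resHead r = v := h.2
      simp [this]
    · exact List.mem_cons_of_mem _ (ih h.2 hp')

/-- A second use of the same arc would end at the head of the first use (same direction) or at its
tail (opposite direction), and both vertices have been met already. -/
theorem IsWalk.arcs_nodup {p : List (ResArc A)} {u v : V} (h : N.IsWalk u p v)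
    (hn : (u :: p.map N.resHead).Nodup) : (p.map ResArc.arc).Nodup := by
  induction p generalizing u with
  | nil => simp
  | cons r p ih =>
    rw [List.map_cons, List.nodup_cons] at hn
    rw [List.map_cons, List.nodup_cons]
    refine ⟨fun hr => ?_, ih h.2 hn.2⟩
    obtain ⟨r', hr', he⟩ := List.mem_map.1 hr
    have hm : N.resHead r' ∈ p.map N.resHead := List.mem_map_of_mem hr'
    have h1 : N.resHead r' ≠ u := fun h' => hn.1 (List.mem_cons_of_mem _ (h' ▸ hm))
    have h2 : N.resHead r' ≠ N.resHead r := fun h' => (List.nodup_cons.1 hn.2).1 (h' ▸ hm)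
    rw [← h.1] at h1
    cases r <;> cases r' <;> simp_all [ResArc.arc, resHead, resTail]

theorem IsResPath.arcs_nodup {f : A → ℝ} {p : List (ResArc A)} (h : N.IsResPath f p) :
    (p.map ResArc.arc).Nodup :=
  h.1.arcs_nodup h.2.2

/-! ### The effect of a path on flow balance and cost -/

variable [Fintype A]

open Classical in
theorem outflow_single (a : A) (c : ℝ) (v : V) :
    N.outflow (Pi.single a c) v = if N.tail a = v then c else 0 := by
  simp [outflow, Pi.single_apply]

open Classical in
theorem inflow_single (a : A) (c : ℝ) (v : V) :
    N.inflow (Pi.single a c) v = if N.head a = v then c else 0 := by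
  simp [inflow, Pi.single_apply]

theorem outflow_add (f g : A → ℝ) (v : V) :
    N.outflow (f + g) v = N.outflow f v + N.outflow g v := by
  simp [outflow, Finset.sum_add_distrib]

theorem inflow_add (f g : A → ℝ) (v : V) :
    N.inflow (f + g) v = N.inflow f v + N.inflow g v := by
  simp [inflow, Finset.sum_add_distrib]

theorem outflow_zero (v : V) : N.outflow (0 : A → ℝ) v = 0 := by simp [outflow]

theorem inflow_zero (v : V) : N.inflow (0 : A → ℝ) v = 0 := by simp [inflow]

end Network

open Classical in
/-- The unit change of a flow along one residual arc. -/
noncomputable def ResArc.unit {A : Type*} (r : ResArc A) : A → ℝ := Pi.single r.arc (r.dir : ℝ)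

-- `chi` favours the forward arc if an arc and its reversal both occur in the list, so it is
-- additive only for lists that do not repeat an arc.
open Classical in
theorem chi_cons {A : Type*} {r : ResArc A} {p : List (ResArc A)}
    (h : r.arc ∉ p.map ResArc.arc) : chi (r :: p) = r.unit + chi p := by
  have key : ∀ r' ∈ p, r'.arc ≠ r.arc := fun r' hr' he => h (List.mem_map.2 ⟨r', hr', he⟩)
  funext a
  have h1 : r.arc = a → ResArc.fwd a ∉ p := fun he hm => key _ hm he.symm
  have h2 : r.arc = a → ResArc.bwd a ∉ p := fun he hm => key _ hm he.symm
  rcases eq_or_ne r.arc a with he | he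
  · cases r <;> simp [chi, ResArc.unit, he, h1 he, h2 he, ResArc.dir] <;> simp_all [ResArc.arc]
  · have e1 : ResArc.fwd a ≠ r := by rintro rfl; exact he rfl
    have e2 : ResArc.bwd a ≠ r := by rintro rfl; exact he rfl
    simp [chi, ResArc.unit, he.symm, e1, e2]

theorem chi_nil {A : Type*} : chi ([] : List (ResArc A)) = 0 := by
  funext a; simp [chi]

theorem chi_eq_sum {A : Type*} {p : List (ResArc A)} (h : (p.map ResArc.arc).Nodup) :
    chi p = (p.map ResArc.unit).sum := by
  induction p with
  | nil => simp [chi_nil]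
  | cons r p ih =>
    rw [List.map_cons, List.nodup_cons] at h
    rw [chi_cons h.1, ih h.2, List.map_cons, List.sum_cons]

namespace Network

variable {V A : Type*} {N : Network V A} [Fintype A]

-- Telescoping: in either direction, a residual arc raises outflow minus inflow by 1 at its residual
-- tail and lowers it by 1 at its residual head.
open Classical in
theorem IsWalk.net_sum {p : List (ResArc A)} {u w : V} (h : N.IsWalk u p w) (v : V) :
    N.outflow (p.map ResArc.unit).sum v - N.inflow (p.map ResArc.unit).sum v =
      (if u = v then 1 else 0) - (if w = v then 1 else 0) := by
  induction p generalizing u with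
  | nil =>
    cases h
    simp [outflow_zero, inflow_zero]
  | cons r p ih =>
    have := ih h.2
    have h1 := h.1
    simp only [List.map_cons, List.sum_cons, outflow_add, inflow_add, ResArc.unit, outflow_single,
      inflow_single] at this ⊢
    subst h1
    obtain a | a := r <;> simp only [ResArc.arc, ResArc.dir, resHead, resTail] at this ⊢ <;>
      by_cases ht : N.tail a = v <;> by_cases hh : N.head a = v <;>
      simp only [ht, hh, if_true, if_false] at this ⊢ <;> push_cast <;> linarith

theorem IsResPath.conservation {f : A → ℝ} {p : List (ResArc A)} (h : N.IsResPath f p) {v : V}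
    (hs : v ≠ N.source) (ht : v ≠ N.sink) (hf : N.outflow f v = N.inflow f v) :
    N.outflow (f + chi p) v = N.inflow (f + chi p) v := by
  have := h.1.net_sum v
  rw [← chi_eq_sum h.arcs_nodup, if_neg hs.symm, if_neg ht.symm] at this
  rw [outflow_add, inflow_add]
  linarith

theorem flowCost_add (f g : A → ℝ) : N.flowCost (f + g) = N.flowCost f + N.flowCost g := by
  simp [flowCost, mul_add, Finset.sum_add_distrib]

theorem IsResPath.flowCost {f : A → ℝ} {p : List (ResArc A)} (h : N.IsResPath f p) :
    N.flowCost (f + chi p) = N.flowCost f + N.pathCost p := by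
  classical
  rw [flowCost_add, chi_eq_sum h.arcs_nodup]
  congr 1
  clear h
  induction p with
  | nil => simp [Network.flowCost, pathCost]
  | cons r p ih =>
    rw [List.map_cons, List.sum_cons, flowCost_add, ih]
    simp only [pathCost, List.map_cons, List.sum_cons]
    congr 1
    cases r <;> simp [Network.flowCost, ResArc.unit, ResArc.arc, ResArc.dir, resCost,
      Pi.single_apply]

end Network

section Graph

variable {α : Type*} [DecidableEq α] {n : ℕ} {D : Fin n → Finset α}

/-! ## Residual paths in the graph of the constraint -/

theorem outflow_source (f : Arc D → ℝ) :
    (graph D).outflow f .s = ∑ i : Fin n, f (srcArc i) := by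
  simp only [Network.outflow, Finset.sum_filter, Fintype.sum_sum_type]
  simp [graph]

theorem inflow_source (f : Arc D → ℝ) : (graph D).inflow f .s = 0 := by
  simp only [Network.inflow, Finset.sum_filter, Fintype.sum_sum_type]
  simp [graph]

theorem outflow_var (f : Arc D → ℝ) (i : Fin n) :
    (graph D).outflow f (.var i) = ∑ d : D i, f (domArc i d) := by
  simp only [Network.outflow, Finset.sum_filter, Fintype.sum_sum_type, Fintype.sum_sigma]
  simp [graph, Finset.sum_ite_irrel]

theorem inflow_var (f : Arc D → ℝ) (i : Fin n) :
    (graph D).inflow f (.var i) = f (srcArc i) := by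
  simp only [Network.inflow, Finset.sum_filter, Fintype.sum_sum_type]
  simp [graph]

theorem outflow_val (f : Arc D → ℝ) (d : DX D) :
    (graph D).outflow f (.val d) = ∑ k, f (snkArc d k) := by
  simp only [Network.outflow, Finset.sum_filter, Fintype.sum_sum_type, Fintype.sum_sigma]
  simp only [graph, reduceCtorEq, if_false, Finset.sum_const_zero, zero_add, Vertex.val.injEq]
  rw [Finset.sum_eq_single d (fun b _ hb => by simp [hb]) (by simp)]
  simp

/-- The sum runs over all variables, with 0 for those that lack `d`; this is the form in which sums
over values and over variables can be exchanged. -/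
theorem inflow_val (f : Arc D → ℝ) (d : DX D) :
    (graph D).inflow f (.val d) =
      ∑ i : Fin n, if h : d.1 ∈ D i then f (domArc i ⟨d.1, h⟩) else 0 := by
  simp only [Network.inflow, Finset.sum_filter, Fintype.sum_sum_type, Fintype.sum_sigma]
  simp only [graph, reduceCtorEq, if_false, Finset.sum_const_zero, zero_add, add_zero,
    Vertex.val.injEq, toDX]
  refine Finset.sum_congr rfl fun i _ => ?_
  split_ifs with h
  · rw [Finset.sum_eq_single (⟨d.1, h⟩ : D i)]
    · simp
    · intro b _ hb
      rw [if_neg]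
      rintro rfl
      exact hb rfl
    · simp
  · refine Finset.sum_eq_zero fun b _ => if_neg ?_
    rintro rfl
    exact h b.2

/-- Reversals of source arcs are excluded because they return to `s`. The first arc that enters `t`
is the last of all, since the walk ends in `t` and visits it once. -/
theorem tail_walk_form {p : List (ResArc (Arc D))} {v : Vertex D} (hv : v ≠ .s) (hv' : v ≠ .t)
    (h : (graph D).IsWalk v p .t) (hn : (p.map (graph D).resHead).Nodup)
    (hs : Vertex.s ∉ p.map (graph D).resHead) :
    ∃ mid d k, p = mid ++ [ResArc.fwd (snkArc d k)] ∧ (∀ r ∈ mid, kind r.arc = 1) ∧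
      (graph D).IsWalk v mid (.val d) := by
  induction p generalizing v with
  | nil => exact absurd h hv'
  | cons r p ih =>
    rw [List.map_cons, List.nodup_cons] at hn
    rw [List.map_cons, List.mem_cons, not_or] at hs
    obtain ⟨h1, h2⟩ := h
    have step : kind r.arc = 1 → (graph D).resHead r ≠ .t →
        ∃ mid d k, r :: p = mid ++ [ResArc.fwd (snkArc d k)] ∧ (∀ r ∈ mid, kind r.arc = 1) ∧
          (graph D).IsWalk v mid (.val d) := by
      intro hk ht
      obtain ⟨mid, d, k, hp, hm, hw⟩ := ih (fun h => hs.1 h.symm) ht h2 hn.2 hs.2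
      refine ⟨r :: mid, d, k, by rw [hp]; rfl, ?_, h1, hw⟩
      simpa using ⟨hk, hm⟩
    obtain (i | q | q) | (i | q | q) := r
    · exact absurd h1.symm hv
    · exact step rfl (by simp [Network.resHead, graph])
    · have : p = [] := by
        by_contra hp
        exact hn.1 (h2.end_mem hp)
      subst this
      exact ⟨[], q.1, q.2, rfl, by simp, h1.symm⟩
    · exact absurd rfl hs.1
    · exact step rfl (by simp [Network.resHead, graph])
    · exact absurd h1.symm hv'

theorem resPath_form {f : Arc D → ℝ} {p : List (ResArc (Arc D))} (h : (graph D).IsResPath f p) :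
    ∃ i mid d k, p = ResArc.fwd (srcArc i) :: (mid ++ [ResArc.fwd (snkArc d k)]) ∧
      (∀ r ∈ mid, kind r.arc = 1) ∧ (graph D).IsWalk (.var i) mid (.val d) := by
  obtain ⟨hw, -, hn⟩ := h
  cases p with
  | nil => cases hw
  | cons r p =>
    obtain ⟨h1, h2⟩ := hw
    rw [List.nodup_cons, List.map_cons, List.mem_cons, not_or, List.nodup_cons] at hn
    obtain (i | q | q) | (i | q | q) := r
    · obtain ⟨mid, d, k, hp, hm, hw⟩ := tail_walk_form (v := .var i) (by simp) (by simp) h2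
        hn.2.2 hn.1.2
      exact ⟨i, mid, d, k, by rw [hp], hm, hw⟩
    · cases h1
    · cases h1
    · exact absurd rfl hn.1.1
    · cases h1
    · cases h1

theorem kind_eq_one_cost {r : ResArc (Arc D)} (h : kind r.arc = 1) : (graph D).resCost r = 0 := by
  obtain (i | q | q) | (i | q | q) := r <;> simp_all [kind, ResArc.arc, Network.resCost, graph]

theorem pathCost_form {i : Fin n} {mid : List (ResArc (Arc D))} {d : DX D}
    {k : Fin (owners D d.1).card} (hm : ∀ r ∈ mid, kind r.arc = 1) :
    (graph D).pathCost (ResArc.fwd (srcArc i) :: (mid ++ [ResArc.fwd (snkArc d k)])) = (k : ℕ) := by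
  have : (mid.map (graph D).resCost).sum = 0 := by
    refine List.sum_eq_zero fun x hx => ?_
    obtain ⟨r, hr, rfl⟩ := List.mem_map.1 hx
    exact kind_eq_one_cost (hm r hr)
  rw [Network.pathCost, List.map_cons, List.map_append, List.sum_cons, List.sum_append, this]
  simp [Network.resCost, graph]

/-- A step of the residual graph along an arc `(x_i, d)` or its reversal. -/
def InnerStep (f : Arc D → ℝ) (u v : Vertex D) : Prop :=
  ∃ r, kind r.arc = 1 ∧ (graph D).InResidual f r ∧ (graph D).resTail r = u ∧
    (graph D).resHead r = v

abbrev InnerReach (f : Arc D → ℝ) : Vertex D → Vertex D → Prop :=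
  Relation.ReflTransGen (InnerStep f)

theorem innerReach_of_walk {f : Arc D → ℝ} {p : List (ResArc (Arc D))} {u v : Vertex D}
    (h : (graph D).IsWalk u p v) (hk : ∀ r ∈ p, kind r.arc = 1)
    (hr : ∀ r ∈ p, (graph D).InResidual f r) : InnerReach f u v := by
  induction p generalizing u with
  | nil => cases h; exact .refl
  | cons r p ih =>
    rw [List.forall_mem_cons] at hk hr
    exact .head ⟨r, hk.1, hr.1, h.1, rfl⟩ (ih h.2 hk.2 hr.2)

theorem innerReach_of_mem_walk {f : Arc D → ℝ} {p : List (ResArc (Arc D))} {u v : Vertex D}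
    (h : (graph D).IsWalk u p v) (hk : ∀ r ∈ p, kind r.arc = 1)
    (hr : ∀ r ∈ p, (graph D).InResidual f r) {r : ResArc (Arc D)} (hm : r ∈ p) :
    InnerReach f u ((graph D).resTail r) ∧ InnerReach f ((graph D).resHead r) v := by
  obtain ⟨p₁, p₂, rfl⟩ := List.append_of_mem hm
  clear hm
  induction p₁ generalizing u with
  | nil =>
    rw [List.nil_append, List.forall_mem_cons] at hk hr
    exact ⟨h.1 ▸ .refl, innerReach_of_walk h.2 hk.2 hr.2⟩
  | cons r' p ih =>
    rw [List.cons_append, List.forall_mem_cons] at hk hr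
    have := ih h.2 hk.2 hr.2
    exact ⟨.head ⟨r', hk.1, hr.1, h.1, rfl⟩ this.1, this.2⟩

theorem exists_suffix_walk {p : List (ResArc (Arc D))} {u v w : Vertex D}
    (h : (graph D).IsWalk v p w) (hn : (v :: p.map (graph D).resHead).Nodup)
    (hu : u ∈ v :: p.map (graph D).resHead) :
    ∃ p', p' <:+ p ∧ (graph D).IsWalk u p' w ∧ (u :: p'.map (graph D).resHead).Nodup := by
  induction p generalizing v with
  | nil =>
    simp only [List.map_nil, List.mem_singleton] at hu
    subst hu
    exact ⟨[], List.suffix_rfl, h, hn⟩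
  | cons r p ih =>
    rcases List.mem_cons.1 hu with rfl | hu
    · exact ⟨_, List.suffix_rfl, h, hn⟩
    · obtain ⟨p', hs, h1, h2⟩ := ih h.2 (List.nodup_cons.1 hn).2 hu
      exact ⟨p', hs.trans (List.suffix_cons _ _), h1, h2⟩

/-- Loop erasure: if the new first vertex lies on the path found so far, the suffix that starts
there replaces the whole path. -/
theorem exists_walk_of_innerReach {f : Arc D → ℝ} {u v : Vertex D} (h : InnerReach f u v) :
    ∃ p, (graph D).IsWalk u p v ∧ (∀ r ∈ p, kind r.arc = 1) ∧
      (∀ r ∈ p, (graph D).InResidual f r) ∧ (u :: p.map (graph D).resHead).Nodup := by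
  induction h using Relation.ReflTransGen.head_induction_on with
  | refl => exact ⟨[], rfl, by simp, by simp, by simp⟩
  | head hs _ ih =>
    obtain ⟨r, hk, hr, rfl, rfl⟩ := hs
    obtain ⟨p, hw, hkp, hrp, hn⟩ := ih
    by_cases hm : (graph D).resTail r ∈ (graph D).resHead r :: p.map (graph D).resHead
    · obtain ⟨p', hs, h1, h2⟩ := exists_suffix_walk hw hn hm
      exact ⟨p', h1, fun r hr => hkp r (hs.subset hr), fun r hr => hrp r (hs.subset hr), h2⟩
    · refine ⟨r :: p, ⟨rfl, hw⟩, ?_, ?_, ?_⟩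
      · simpa using ⟨hk, hkp⟩
      · simpa using ⟨hr, hrp⟩
      · exact List.nodup_cons.2 ⟨hm, hn⟩

theorem kind_eq_one_ends {r : ResArc (Arc D)} (h : kind r.arc = 1) :
    (graph D).resHead r ≠ .s ∧ (graph D).resHead r ≠ .t := by
  obtain (i | q | q) | (i | q | q) := r <;>
    simp_all [kind, ResArc.arc, Network.resHead, graph]

/-- Inner arcs and their reversals never end in `s` or `t`, so adding the two outer arcs repeats no
vertex. -/
theorem isResPath_of_form {f : Arc D → ℝ} {i : Fin n} {mid : List (ResArc (Arc D))} {d : DX D}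
    {k : Fin (owners D d.1).card} (hi : f (srcArc i) < 1) (hk : f (snkArc d k) < 1)
    (hw : (graph D).IsWalk (.var i) mid (.val d)) (hm : ∀ r ∈ mid, kind r.arc = 1)
    (hr : ∀ r ∈ mid, (graph D).InResidual f r)
    (hn : (Vertex.var i :: mid.map (graph D).resHead).Nodup) :
    (graph D).IsResPath f (ResArc.fwd (srcArc i) :: (mid ++ [ResArc.fwd (snkArc d k)])) := by
  refine ⟨⟨rfl, hw.append ⟨rfl, rfl⟩⟩, ?_, ?_⟩
  · intro r h
    simp only [List.mem_cons, List.mem_append, List.not_mem_nil, or_false] at h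
    rcases h with rfl | h | rfl
    · simpa [Network.InResidual, graph] using hi
    · exact hr r h
    · simpa [Network.InResidual, graph] using hk
  · have e1 : (graph D).resHead (ResArc.fwd (srcArc i)) = .var i := rfl
    have e2 : (graph D).resHead (ResArc.fwd (snkArc d k)) = .t := rfl
    have e3 : (graph D).source = .s := rfl
    rw [List.map_cons, List.map_append, List.map_cons, List.map_nil, e1, e2, e3,
      ← List.cons_append, ← List.cons_append, List.nodup_append, List.nodup_cons]
    have hs : ∀ x ∈ Vertex.var i :: mid.map (graph D).resHead, x ≠ .s ∧ x ≠ .t := by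
      intro x hx
      rcases List.mem_cons.1 hx with rfl | hx
      · simp
      · obtain ⟨r, h, rfl⟩ := List.mem_map.1 hx
        exact kind_eq_one_ends (hm r h)
    refine ⟨⟨fun h => (hs _ h).1 rfl, hn⟩, by simp, ?_⟩
    intro a ha b hb
    rw [List.mem_singleton] at hb
    subst hb
    rcases List.mem_cons.1 ha with rfl | ha
    · simp
    · exact (hs _ ha).2

theorem exists_resPath_of_innerReach {f : Arc D → ℝ} {i : Fin n} {d : DX D}
    (hi : f (srcArc i) < 1) (k : Fin (owners D d.1).card) (hk : f (snkArc d k) < 1)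
    (h : InnerReach f (.var i) (.val d)) :
    ∃ p, (graph D).IsResPath f p ∧ (graph D).pathCost p = (k : ℕ) := by
  obtain ⟨mid, hw, hm, hr, hn⟩ := exists_walk_of_innerReach h
  exact ⟨_, isResPath_of_form hi hk hw hm hr hn, pathCost_form hm⟩

theorem chi_srcArc {i j : Fin n} {mid : List (ResArc (Arc D))} {d : DX D}
    {k : Fin (owners D d.1).card} (hm : ∀ r ∈ mid, kind r.arc = 1) :
    chi (ResArc.fwd (srcArc i) :: (mid ++ [ResArc.fwd (snkArc d k)])) (srcArc j) =
      if j = i then 1 else 0 := by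
  have h1 : ResArc.fwd (srcArc j) ∉ mid := fun h => by simpa [kind, ResArc.arc] using hm _ h
  have h2 : ResArc.bwd (srcArc j) ∉ mid := fun h => by simpa [kind, ResArc.arc] using hm _ h
  simp [chi, h1, h2]

theorem chi_snkArc {i : Fin n} {mid : List (ResArc (Arc D))} {d d' : DX D}
    {k : Fin (owners D d.1).card} {k' : Fin (owners D d'.1).card}
    (hm : ∀ r ∈ mid, kind r.arc = 1) :
    chi (ResArc.fwd (srcArc i) :: (mid ++ [ResArc.fwd (snkArc d k)])) (snkArc d' k') =
      if d' = d ∧ (k' : ℕ) = k then 1 else 0 := by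
  have h1 : ResArc.fwd (snkArc d' k') ∉ mid := fun h => by simpa [kind, ResArc.arc] using hm _ h
  have h2 : ResArc.bwd (snkArc d' k') ∉ mid := fun h => by simpa [kind, ResArc.arc] using hm _ h
  have h3 : (⟨d', k'⟩ : Σ d : DX D, Fin (owners D d.1).card) = ⟨d, k⟩ ↔
      d' = d ∧ (k' : ℕ) = k := by
    constructor
    · rintro h; cases h; simp
    · rintro ⟨rfl, h⟩; simp [Fin.ext_iff, h]
  simp [chi, h1, h2, h3]

/-! ## The flows of the algorithm -/

/-- An integral flow that fills the arcs `(d, t)_0, (d, t)_1, …` in this order, up to the level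
`L d`, and whose levels cannot be improved by moving one unit. -/
structure Balanced (f : Arc D → ℝ) (L : DX D → ℕ) : Prop where
  integral : ∀ a, f a = 0 ∨ f a = 1
  flow : (graph D).IsFlow f
  le_card : ∀ d, L d ≤ (owners D d.1).card
  sink : ∀ d k, f (snkArc d k) = if (k : ℕ) < L d then 1 else 0
  level : ∀ d d', InnerReach f (.val d) (.val d') → L d ≤ L d' + 1

namespace Balanced

variable {f : Arc D → ℝ} {L : DX D → ℕ}

theorem feasible (h : Balanced f L) : (graph D).IsFeasible f :=
  ⟨h.flow, fun a => by rcases h.integral a with e | e <;> simp [e, graph]⟩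

theorem sum_var (h : Balanced f L) (i : Fin n) : ∑ d : D i, f (domArc i d) = f (srcArc i) := by
  rw [← outflow_var, ← inflow_var f i]
  exact h.flow.2 _ (by simp [graph]) (by simp [graph])

theorem sum_snk (h : Balanced f L) (d : DX D) : ∑ k, f (snkArc d k) = L d := by
  simp only [h.sink]
  rw [Finset.sum_boole, Fin.card_filter_val_lt, min_eq_right (h.le_card d)]

theorem sum_val (h : Balanced f L) (d : DX D) :
    (∑ i : Fin n, if h : d.1 ∈ D i then f (domArc i ⟨d.1, h⟩) else 0) = L d := by
  rw [← inflow_val, ← h.sum_snk, ← outflow_val]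
  exact (h.flow.2 _ (by simp [graph]) (by simp [graph])).symm

/-- The level is the inflow of `d`, to which each variable having `d` contributes at most 1 and
`x_i` contributes nothing. So the next arc `(d, t)_{L d}` exists. -/
theorem lt_card (h : Balanced f L) {i : Fin n} {d : D i} (hd : f (domArc i d) = 0) :
    L (toDX i d) < (owners D d.1).card := by
  have h1 := h.sum_val (toDX i d)
  have h2 : (∑ j : Fin n, if hj : d.1 ∈ D j then f (domArc j ⟨d.1, hj⟩) else 0) <
      ∑ j : Fin n, if d.1 ∈ D j then (1 : ℝ) else 0 := by
    refine Finset.sum_lt_sum (fun j _ => ?_) ⟨i, Finset.mem_univ _, ?_⟩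
    · split_ifs with hj
      · rcases h.integral (domArc j ⟨d.1, hj⟩) with e | e <;> simp [e]
      · rfl
    · simp [hd]
  rw [Finset.sum_boole] at h2
  have h3 : (toDX i d).1 = d.1 := rfl
  simp only [h3] at h1
  rw [h1] at h2
  exact_mod_cast h2

theorem residual_iff (h : Balanced f L) (a : Arc D) :
    ((graph D).InResidual f (.fwd a) ↔ f a = 0) ∧ ((graph D).InResidual f (.bwd a) ↔ f a = 1) := by
  rcases h.integral a with e | e <;> simp [Network.InResidual, graph, e]

/-- The last inner arc into `d` must be an unused forward arc `(x_j, d)`, because reversals of such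
arcs end in variables. -/
theorem lt_card_of_innerReach (h : Balanced f L) {i : Fin n} {d : DX D}
    (hr : InnerReach f (.var i) (.val d)) : L d < (owners D d.1).card := by
  rcases Relation.ReflTransGen.cases_tail hr with e | ⟨v, -, r, hk, hrr, -, he⟩
  · cases e
  · obtain (j | q | q) | (j | q | q) := r <;> cases he
    · exact h.lt_card ((h.residual_iff _).1.1 hrr)
    · simp [kind, ResArc.arc] at hk

theorem innerReach_of_unassigned (h : Balanced f L) {i : Fin n} (hi : f (srcArc i) = 0) (d : D i) :
    f (domArc i d) = 0 ∧ InnerReach f (.var i) (.val (toDX i d)) := by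
  have h1 := h.sum_var i
  rw [hi, Finset.sum_eq_zero_iff_of_nonneg fun d _ => h.flow.1 _] at h1
  have h2 := h1 d (Finset.mem_univ _)
  refine ⟨h2, .single ⟨.fwd (domArc i d), rfl, ?_, rfl, rfl⟩⟩
  simp [Network.InResidual, graph, h2]

theorem exists_resPath (h : Balanced f L) {i : Fin n} {d : DX D} (hi : f (srcArc i) = 0)
    (hr : InnerReach f (.var i) (.val d)) :
    ∃ p, (graph D).IsResPath f p ∧ (graph D).pathCost p = L d :=
  exists_resPath_of_innerReach (by simp [hi]) ⟨L d, h.lt_card_of_innerReach hr⟩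
    (by rw [h.sink]; simp) hr

theorem form_of_isResPath (h : Balanced f L) {p : List (ResArc (Arc D))}
    (hp : (graph D).IsResPath f p) :
    ∃ i mid d, ∃ k : Fin (owners D d.1).card,
      p = ResArc.fwd (srcArc i) :: (mid ++ [ResArc.fwd (snkArc d k)]) ∧
      (∀ r ∈ mid, kind r.arc = 1) ∧ (∀ r ∈ mid, (graph D).InResidual f r) ∧
      (graph D).IsWalk (.var i) mid (.val d) ∧ f (srcArc i) = 0 ∧ L d ≤ k ∧
      InnerReach f (.var i) (.val d) ∧ (graph D).pathCost p = (k : ℕ) := by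
  obtain ⟨i, mid, d, k, rfl, hm, hw⟩ := resPath_form hp
  have hr : ∀ r ∈ mid, (graph D).InResidual f r := fun r hr => hp.2.1 r (by simp [hr])
  refine ⟨i, mid, d, k, rfl, hm, hr, hw, ?_, ?_, innerReach_of_walk hw hm hr, pathCost_form hm⟩
  · refine (h.integral _).resolve_right fun e => ?_
    have := hp.2.1 (.fwd (srcArc i)) (by simp)
    simp [Network.InResidual, graph, e] at this
  · have := hp.2.1 (.fwd (snkArc d k)) (by simp)
    rw [Network.InResidual, h.sink] at this
    by_contra hk
    rw [if_pos (not_le.1 hk)] at this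
    simp [graph] at this

theorem form_of_isMinCostResPath (h : Balanced f L) {p : List (ResArc (Arc D))}
    (hp : (graph D).IsMinCostResPath f p) :
    ∃ i mid d, ∃ k : Fin (owners D d.1).card,
      p = ResArc.fwd (srcArc i) :: (mid ++ [ResArc.fwd (snkArc d k)]) ∧
      (∀ r ∈ mid, kind r.arc = 1) ∧ (∀ r ∈ mid, (graph D).InResidual f r) ∧
      (graph D).IsWalk (.var i) mid (.val d) ∧ f (srcArc i) = 0 ∧ (k : ℕ) = L d ∧
      ∀ j d', f (srcArc j) = 0 → InnerReach f (.var j) (.val d') → L d ≤ L d' := by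
  obtain ⟨i, mid, d, k, rfl, hm, hr, hw, hi, hk, hreach, hc⟩ := h.form_of_isResPath hp.1
  have key : ∀ j d', f (srcArc j) = 0 → InnerReach f (.var j) (.val d') → (k : ℕ) ≤ L d' := by
    intro j d' hj hd'
    obtain ⟨q, hq, hqc⟩ := h.exists_resPath hj hd'
    have := hp.2 q hq
    rw [hc, hqc] at this
    exact_mod_cast this
  -- The arc is unused, so its index is at least the level; the path that ends with `(d, t)_{L d}`
  -- instead gives the other inequality.
  have hkd : (k : ℕ) = L d := le_antisymm (key i d hi hreach) hk
  exact ⟨i, mid, d, k, rfl, hm, hr, hw, hi, hkd, hkd ▸ key⟩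

/-- The costs of residual paths are natural numbers, so the least one is attained. -/
theorem exists_isMinCostResPath (h : Balanced f L) {p : List (ResArc (Arc D))}
    (hp : (graph D).IsResPath f p) : ∃ q, (graph D).IsMinCostResPath f q := by
  classical
  have hex : ∃ k : ℕ, ∃ q, (graph D).IsResPath f q ∧ (graph D).pathCost q = k := by
    obtain ⟨i, mid, d, k, -, -, -, -, -, -, -, hc⟩ := h.form_of_isResPath hp
    exact ⟨k, p, hp, hc⟩
  obtain ⟨q, hq, hqc⟩ := Nat.find_spec hex
  refine ⟨q, hq, fun q' hq' => ?_⟩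
  obtain ⟨i, mid, d, k, -, -, -, -, -, -, -, hc⟩ := h.form_of_isResPath hq'
  rw [hqc, hc]
  exact_mod_cast Nat.find_min' hex ⟨q', hq', hc⟩

theorem add_chi_apply (h : Balanced f L) {p : List (ResArc (Arc D))}
    (hp : ∀ r ∈ p, (graph D).InResidual f r) (a : Arc D) :
    (ResArc.fwd a ∈ p ∧ f a = 0 ∧ chi p a = 1) ∨ (ResArc.bwd a ∈ p ∧ f a = 1 ∧ chi p a = -1) ∨
      chi p a = 0 := by
  by_cases h1 : ResArc.fwd a ∈ p
  · exact Or.inl ⟨h1, (h.residual_iff a).1.1 (hp _ h1), by simp [chi, h1]⟩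
  · by_cases h2 : ResArc.bwd a ∈ p
    · exact Or.inr (Or.inl ⟨h2, (h.residual_iff a).2.1 (hp _ h2), by simp [chi, h1, h2]⟩)
    · exact Or.inr (Or.inr (by simp [chi, h1, h2]))

/-- The path runs forwards through arcs with flow 0 and backwards through arcs with flow 1, so a
step of 1 is admissible; the arc `(s, x_i)` on it allows no more. -/
theorem isMaxStep_iff (h : Balanced f L) {p : List (ResArc (Arc D))}
    (hp : (graph D).IsResPath f p) (ε : ℝ) : (graph D).IsMaxStep f p ε ↔ ε = 1 := by
  have h1 : (graph D).IsMaxStep f p 1 := by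
    refine ⟨fun a => ?_, fun δ hδ => ?_⟩
    · rcases h.add_chi_apply hp.2.1 a with ⟨-, e, e'⟩ | ⟨-, e, e'⟩ | e' <;>
        rcases h.integral a with e'' | e'' <;> simp_all [graph]
    · obtain ⟨i, mid, d, k, rfl, hm, -, -, hi, -⟩ := h.form_of_isResPath hp
      have := (hδ (srcArc i)).2
      rw [chi_srcArc hm, hi] at this
      simpa [graph] using this
  exact ⟨fun h' => h'.unique h1, fun e => e ▸ h1⟩

/-- Augmentation creates no residual arcs except reversals of arcs of the path. -/
theorem innerStep_add_chi (h : Balanced f L) {p : List (ResArc (Arc D))}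
    (hp : ∀ r ∈ p, (graph D).InResidual f r) {u v : Vertex D} (hs : InnerStep (f + chi p) u v) :
    InnerStep f u v ∨ ∃ r ∈ p, kind r.arc = 1 ∧ (graph D).resTail r = v ∧
      (graph D).resHead r = u := by
  obtain ⟨r, hk, hr, rfl, rfl⟩ := hs
  obtain a | a := r
  · rcases h.add_chi_apply hp a with ⟨-, e, e'⟩ | ⟨hm, -, -⟩ | e'
    · simp [Network.InResidual, graph, e, e'] at hr
    · exact Or.inr ⟨_, hm, hk, rfl, rfl⟩
    · refine Or.inl ⟨_, hk, ?_, rfl, rfl⟩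
      simpa [Network.InResidual, e'] using hr
  · rcases h.add_chi_apply hp a with ⟨hm, -, -⟩ | ⟨-, e, e'⟩ | e'
    · exact Or.inr ⟨_, hm, hk, rfl, rfl⟩
    · simp [Network.InResidual, e, e'] at hr
    · refine Or.inl ⟨_, hk, ?_, rfl, rfl⟩
      simpa [Network.InResidual, e'] using hr

theorem zero : Balanced (0 : Arc D → ℝ) 0 where
  integral _ := Or.inl rfl
  flow := ⟨fun _ => le_rfl, fun v _ _ => by rw [Network.outflow_zero, Network.inflow_zero]⟩
  le_card _ := Nat.zero_le _
  sink _ _ := by simp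
  level _ _ _ := Nat.zero_le _

theorem augment (h : Balanced f L) {p : List (ResArc (Arc D))}
    (hp : (graph D).IsMinCostResPath f p) :
    ∃ L' : DX D → ℕ, Balanced (f + chi p) L' := by
  obtain ⟨i, mid, d, k, hpf, hm, hr, hw, hi, hk, hmin⟩ := h.form_of_isMinCostResPath hp
  refine ⟨Function.update L d (L d + 1), ?_, ⟨?_, ?_⟩, ?_, ?_, ?_⟩
  · intro a
    rcases h.add_chi_apply hp.1.2.1 a with ⟨-, e, e'⟩ | ⟨-, e, e'⟩ | e'
    · right; simp [e, e']
    · left; simp [e, e']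
    · simpa [e'] using h.integral a
  · intro a
    rcases h.add_chi_apply hp.1.2.1 a with ⟨-, e, e'⟩ | ⟨-, e, e'⟩ | e'
    · simp [e, e']
    · simp [e, e']
    · simpa [e'] using h.flow.1 a
  · exact fun v hs ht => hp.1.conservation hs ht (h.flow.2 v hs ht)
  · intro d'
    rcases eq_or_ne d' d with rfl | hd
    · rw [Function.update_self, ← hk]; exact k.2
    · rw [Function.update_of_ne hd]; exact h.le_card d'
  · intro d' k'
    rw [Pi.add_apply, hpf, chi_snkArc hm, h.sink, hk]
    rcases eq_or_ne d' d with rfl | hd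
    · rw [Function.update_self]
      rcases lt_trichotomy (k' : ℕ) (L d') with hlt | heq | hgt
      · rw [if_pos hlt, if_neg (by omega), if_pos (by omega), add_zero]
      · rw [if_neg (by omega), if_pos ⟨rfl, heq⟩, if_pos (by omega), zero_add]
      · rw [if_neg (by omega), if_neg (by omega), if_neg (by omega), add_zero]
    · rw [Function.update_of_ne hd, if_neg (c := _ ∧ _) (fun h => hd h.1), add_zero]
  -- At a reversed path arc `r`, the vertex just reached is the head of `r`, from which the path
  -- leads on to `d`; the next vertex is the tail of `r`, to which the path leads from `x_i`. Both
  -- connections existed before the augmentation.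
  · have key : ∀ u v, InnerReach (f + chi p) u v → InnerReach f u v ∨
        (InnerReach f u (.val d) ∧ InnerReach f (.var i) v) := by
      intro u v huv
      induction huv with
      | refl => exact Or.inl .refl
      | tail _ hs ih =>
        rcases h.innerStep_add_chi hp.1.2.1 hs with hs | ⟨r, hrp, hrk, rfl, rfl⟩
        · rcases ih with ih | ih
          · exact Or.inl (ih.tail hs)
          · exact Or.inr ⟨ih.1, ih.2.tail hs⟩
        · have hrm : r ∈ mid := by
            rw [hpf] at hrp
            simp only [List.mem_cons, List.mem_append, List.not_mem_nil, or_false] at hrp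
            rcases hrp with rfl | hrp | rfl
            · simp [kind, ResArc.arc] at hrk
            · exact hrp
            · simp [kind, ResArc.arc] at hrk
          have hr' := innerReach_of_mem_walk hw hm hr hrm
          rcases ih with ih | ih
          · exact Or.inr ⟨ih.trans hr'.2, hr'.1⟩
          · exact Or.inr ⟨ih.1, hr'.1⟩
    have hid : InnerReach f (.var i) (.val d) := innerReach_of_walk hw hm hr
    intro d₁ d₂ h12
    -- The condition for the old levels but the new reachability; a new connection is bridged by `L
    -- d₁ ≤ L d + 1` and `L d ≤ L d₂`.
    have h0 : L d₁ ≤ L d₂ + 1 := by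
      rcases key _ _ h12 with h' | h'
      · exact h.level _ _ h'
      · exact (h.level _ _ h'.1).trans (Nat.succ_le_succ (hmin i d₂ hi h'.2))
    have h1 : InnerReach f (.val d) (.val d₂) ∨ InnerReach f (.var i) (.val d₂) → L d ≤ L d₂ :=
      fun h' => hmin i d₂ hi (h'.elim hid.trans id)
    -- The only critical case: the level of the start has risen by 1. Then `d₂` was reachable from
    -- `x_i` via `d` or directly, and minimality of the path applies.
    have h2 : d₁ = d → L d ≤ L d₂ := by
      rintro rfl
      exact h1 ((key _ _ h12).imp id And.right)
    simp only [Function.update_apply]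
    have h3 : d₂ = d → L d₂ = L d := congrArg L
    have h4 : d₁ = d → L d₁ = L d := congrArg L
    split_ifs with e1 e2 e2
    · omega
    · have := h2 e1; omega
    · have := h3 e2; omega
    · omega

end Balanced

theorem sspRun_balanced {l : List (List (ResArc (Arc D)) × ℝ)} {f : Arc D → ℝ}
    (h : (graph D).SSPRun l f) : ∃ L, Balanced f L := by
  induction h with
  | init => exact ⟨0, .zero⟩
  | step _ hp hε ih =>
    obtain ⟨L, hL⟩ := ih
    rw [hL.isMaxStep_iff hp.1] at hε
    subst hε
    rw [one_smul]
    exact hL.augment hp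

/-- Each augmentation adds one unit on exactly one source arc; this sum yields both the bound on the
number of augmentations and saturation after `n` of them. -/
theorem sspRun_sum {l : List (List (ResArc (Arc D)) × ℝ)} {f : Arc D → ℝ}
    (h : (graph D).SSPRun l f) : ∑ i, f (srcArc i) = l.length := by
  induction h with
  | init => simp
  | step hr hp hε ih =>
    obtain ⟨L, hL⟩ := sspRun_balanced hr
    rw [hL.isMaxStep_iff hp.1] at hε
    subst hε
    obtain ⟨i, mid, d, k, rfl, hm, -⟩ := hL.form_of_isMinCostResPath hp
    simp only [one_smul, Pi.add_apply, chi_srcArc hm, Finset.sum_add_distrib, ih]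
    simp

theorem sspRun_augmentations {l : List (List (ResArc (Arc D)) × ℝ)} {f : Arc D → ℝ}
    (h : (graph D).SSPRun l f) : ∀ q ∈ l, q.2 = 1 ∧
      (∃ i, q.1.filter (fun r => kind r.arc = 0) = [ResArc.fwd (srcArc i)]) ∧
      (∃ d k, q.1.filter (fun r => kind r.arc = 2) = [ResArc.fwd (snkArc d k)]) := by
  induction h with
  | init => simp
  | step hr hp hε ih =>
    obtain ⟨L, hL⟩ := sspRun_balanced hr
    rw [hL.isMaxStep_iff hp.1] at hε
    intro q hq
    rcases List.mem_append.1 hq with hq | hq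
    · exact ih q hq
    · rw [List.mem_singleton] at hq
      subst hq
      obtain ⟨i, mid, d, k, rfl, hm, -⟩ := hL.form_of_isMinCostResPath hp
      refine ⟨hε, ⟨i, ?_⟩, d, k, ?_⟩
      · have : mid.filter (fun r => kind r.arc = 0) = [] := by
          rw [List.filter_eq_nil_iff]; intro r hr; simp [hm r hr]
        rw [List.filter_cons, List.filter_append, this]
        simp [kind, ResArc.arc]
      · have : mid.filter (fun r => kind r.arc = 2) = [] := by
          rw [List.filter_eq_nil_iff]; intro r hr; simp [hm r hr]
        rw [List.filter_cons, List.filter_append, this]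
        simp [kind, ResArc.arc]

theorem sspRun_length_le {l : List (List (ResArc (Arc D)) × ℝ)} {f : Arc D → ℝ}
    (h : (graph D).SSPRun l f) : l.length ≤ n := by
  obtain ⟨L, hL⟩ := sspRun_balanced h
  have h1 := sspRun_sum h
  have h2 : ∑ i : Fin n, f (srcArc i) ≤ ∑ _i : Fin n, (1 : ℝ) :=
    Finset.sum_le_sum fun i _ => by rcases hL.integral (srcArc i) with e | e <;> simp [e]
  rw [h1] at h2
  simpa using h2

theorem sspRun_exists_path {l : List (List (ResArc (Arc D)) × ℝ)} {f : Arc D → ℝ}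
    (hD : ∀ i, (D i).Nonempty) (h : (graph D).SSPRun l f) (hl : l.length < n) :
    ∃ p, (graph D).IsMinCostResPath f p := by
  obtain ⟨L, hL⟩ := sspRun_balanced h
  have h1 := sspRun_sum h
  have : ∃ i : Fin n, f (srcArc i) = 0 := by
    by_contra! hne
    have : ∀ i : Fin n, f (srcArc i) = 1 := fun i => (hL.integral _).resolve_left (hne i)
    simp only [this] at h1
    simp only [Finset.sum_const, Finset.card_univ, Fintype.card_fin, nsmul_eq_mul, mul_one,
      Nat.cast_inj] at h1
    omega
  obtain ⟨i, hi⟩ := this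
  obtain ⟨d, hd⟩ := hD i
  obtain ⟨p, hp, -⟩ := hL.exists_resPath hi (hL.innerReach_of_unassigned hi ⟨d, hd⟩).2
  exact hL.exists_isMinCostResPath hp

theorem sspRun_saturated {l : List (List (ResArc (Arc D)) × ℝ)} {f : Arc D → ℝ}
    (h : (graph D).SSPRun l f) (hl : l.length = n) (i : Fin n) : f (srcArc i) = 1 := by
  obtain ⟨L, hL⟩ := sspRun_balanced h
  have h1 := sspRun_sum h
  have h2 : ∑ i : Fin n, f (srcArc i) = ∑ _i : Fin n, (1 : ℝ) := by rw [h1, hl]; simp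
  rw [Finset.sum_eq_sum_iff_of_le] at h2
  · exact h2 i (Finset.mem_univ _)
  · intro i _
    rcases hL.integral (srcArc i) with e | e <;> simp [e]

theorem not_exists_resPath {f : Arc D → ℝ} (h : ∀ i, f (srcArc i) = 1) :
    ¬ ∃ p, (graph D).IsResPath f p := by
  rintro ⟨p, hp⟩
  obtain ⟨i, mid, d, k, rfl, -⟩ := resPath_form hp
  have := hp.2.1 (.fwd (srcArc i)) (by simp)
  simp [Network.InResidual, graph, h] at this

end Graph

section MinCost

variable {α : Type*} [DecidableEq α] {n : ℕ} {D : Fin n → Finset α}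

/-! ## Optimality, and flows of tuples -/

theorem graph_flowCost (f : Arc D → ℝ) :
    (graph D).flowCost f = ∑ d : DX D, ∑ k : Fin (owners D d.1).card, ((k : ℕ) : ℝ) * f (snkArc d k) := by
  simp only [Network.flowCost, Fintype.sum_sum_type, Fintype.sum_sigma]
  simp [graph]

theorem graph_value (f : Arc D → ℝ) : (graph D).value f = ∑ i, f (srcArc i) := by
  have : (graph D).source = .s := rfl
  rw [Network.value, this, outflow_source, inflow_source, sub_zero]

/-- Double counting of the arcs `(x_i, d)`, by values and by variables. -/
theorem sum_DX_eq (F : ∀ i, D i → ℝ) :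
    (∑ d : DX D, ∑ i : Fin n, if h : d.1 ∈ D i then F i ⟨d.1, h⟩ else 0) = ∑ i, ∑ d, F i d := by
  rw [Finset.sum_comm]
  refine Finset.sum_congr rfl fun i _ => ?_
  rw [← Finset.sum_filter_add_sum_filter_not _ (fun d : DX D => d.1 ∈ D i)]
  rw [Finset.sum_eq_zero (s := Finset.univ.filter _) (fun d hd => dif_neg (Finset.mem_filter.1 hd).2),
    add_zero]
  symm
  refine Finset.sum_bij (fun d _ => toDX i d) ?_ ?_ ?_ ?_
  · intro d _
    exact Finset.mem_filter.2 ⟨Finset.mem_univ _, d.2⟩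
  · intro d _ d' _ h
    exact Subtype.ext (congrArg (fun z : DX D => z.1) h)
  · intro d hd
    exact ⟨⟨d.1, (Finset.mem_filter.1 hd).2⟩, Finset.mem_univ _, rfl⟩
  · intro d _
    rw [dif_pos (show (toDX i d).1 ∈ D i from d.2)]
    rfl

/-- Reduced costs: by conservation at `d`, an amount `π d` per unit can be shifted from the arcs
leaving `d` to the arcs entering it. -/
theorem flowCost_potential {f : Arc D → ℝ} (hf : (graph D).IsFlow f) (π : DX D → ℝ) :
    (graph D).flowCost f = (∑ d : DX D, ∑ k : Fin (owners D d.1).card, (((k : ℕ) : ℝ) - π d) * f (snkArc d k)) +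
      ∑ i, ∑ d : D i, π (toDX i d) * f (domArc i d) := by
  have h1 : ∀ d, ∑ k, f (snkArc d k) =
      ∑ i : Fin n, if h : d.1 ∈ D i then f (domArc i ⟨d.1, h⟩) else 0 := fun d => by
    rw [← inflow_val, ← outflow_val]
    exact hf.2 _ (by simp [graph]) (by simp [graph])
  rw [← sum_DX_eq, graph_flowCost, ← Finset.sum_add_distrib]
  refine Finset.sum_congr rfl fun d _ => ?_
  simp only [sub_mul, Finset.sum_sub_distrib]
  rw [← Finset.mul_sum, h1, Finset.mul_sum]
  have : ∀ i : Fin n, π d * (if h : d.1 ∈ D i then f (domArc i ⟨d.1, h⟩) else 0) =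
      if h : d.1 ∈ D i then π (toDX i ⟨d.1, h⟩) * f (domArc i ⟨d.1, h⟩) else 0 := fun i => by
    split_ifs <;> simp [toDX]
  simp only [this]
  ring

namespace Balanced

variable {f : Arc D → ℝ} {L : DX D → ℕ}

theorem assigned_unique (h : Balanced f L) {i : Fin n} {d d' : D i} (hd : f (domArc i d) = 1)
    (hd' : f (domArc i d') = 1) : d = d' := by
  by_contra hne
  have h1 : ∑ e ∈ {d, d'}, f (domArc i e) ≤ ∑ e, f (domArc i e) :=
    Finset.sum_le_sum_of_subset_of_nonneg (Finset.subset_univ _) fun e _ _ => h.flow.1 _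
  rw [Finset.sum_pair hne, hd, hd', h.sum_var] at h1
  rcases h.integral (srcArc i) with e | e <;> rw [e] at h1 <;> norm_num at h1

theorem exists_assigned (h : Balanced f L) {i : Fin n} (hi : f (srcArc i) = 1) :
    ∃ d : D i, f (domArc i d) = 1 := by
  by_contra! hne
  have := h.sum_var i
  rw [Finset.sum_eq_zero fun d _ => (h.integral _).resolve_right (hne d), hi] at this
  norm_num at this

/-- One goes back to `x_i` along the used arc and on to any other value. Consequently the assigned
value has the least potential in its domain. -/
theorem innerReach_of_assigned (h : Balanced f L) {i : Fin n} {d : D i} (hd : f (domArc i d) = 1)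
    (d' : D i) : InnerReach f (.val (toDX i d)) (.val (toDX i d')) := by
  rcases h.integral (domArc i d') with e | e
  · exact (Relation.ReflTransGen.single ⟨.bwd (domArc i d), rfl, (h.residual_iff _).2.2 hd, rfl, rfl⟩).tail
      ⟨.fwd (domArc i d'), rfl, (h.residual_iff _).1.2 e, rfl, rfl⟩
  · rw [h.assigned_unique hd e]

/-- The least level that can be reached from a value. -/
noncomputable def potential (f : Arc D → ℝ) (L : DX D → ℕ) (d : DX D) : ℕ :=
  sInf {k | ∃ d', InnerReach f (.val d) (.val d') ∧ L d' = k}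

theorem potential_le {d d' : DX D} (hr : InnerReach f (.val d) (.val d')) :
    potential f L d ≤ L d' :=
  Nat.sInf_le ⟨d', hr, rfl⟩

theorem exists_potential (f : Arc D → ℝ) (L : DX D → ℕ) (d : DX D) :
    ∃ d', InnerReach f (.val d) (.val d') ∧ L d' = potential f L d :=
  Nat.sInf_mem (s := {k | ∃ d', InnerReach f (.val d) (.val d') ∧ L d' = k}) ⟨L d, d, .refl, rfl⟩

theorem potential_mono {d d' : DX D} (hr : InnerReach f (.val d) (.val d')) :
    potential f L d ≤ potential f L d' := by
  obtain ⟨e, he, h'⟩ := exists_potential f L d'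
  rw [← h']
  exact potential_le (hr.trans he)

/-- This is where the level condition of `Balanced` enters optimality; together with `potential_le`
it confines the potential to `L d - 1` and `L d`. -/
theorem le_potential (h : Balanced f L) (d : DX D) : L d ≤ potential f L d + 1 := by
  obtain ⟨e, he, h'⟩ := exists_potential f L d
  rw [← h']
  exact h.level _ _ he

/-- Complementary slackness. A competitor `g` of the same value also saturates all source arcs, and
`f` is no dearer than `g` in every term of the reduced cost. -/
theorem isMinCostFlow (h : Balanced f L) (hs : ∀ i, f (srcArc i) = 1) :
    (graph D).IsMinCostFlow f := by
  have hle : ∀ g, (graph D).IsFeasible g → ∀ i ∈ (Finset.univ : Finset (Fin n)),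
      g (srcArc i) ≤ f (srcArc i) := fun g hg i _ => by
    rw [hs]; simpa [graph] using hg.2 (srcArc i)
  refine ⟨h.feasible, fun g hg => ?_, fun g hg hv => ?_⟩
  · rw [graph_value, graph_value]
    exact Finset.sum_le_sum (hle g hg)
  · rw [graph_value, graph_value, Finset.sum_eq_sum_iff_of_le (hle g hg)] at hv
    have hg1 : ∀ i, g (srcArc i) = 1 := fun i => by rw [hv i (Finset.mem_univ _), hs]
    rw [flowCost_potential h.flow fun d => potential f L d,
      flowCost_potential hg.1 fun d => potential f L d]
    refine add_le_add (Finset.sum_le_sum fun d _ => Finset.sum_le_sum fun k _ => ?_)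
      (Finset.sum_le_sum fun i _ => ?_)
    · have h0 := hg.1.1 (snkArc d k)
      have h1 : g (snkArc d k) ≤ 1 := by simpa [graph] using hg.2 (snkArc d k)
      rw [h.sink]
      split_ifs with hk
      -- A used arc has index at most `L d - 1`, hence nonpositive reduced cost, and carries the
      -- full unit; an unused one, treated next, has index at least `L d` and nonnegative reduced
      -- cost.
      · have h2 : (k : ℕ) ≤ potential f L d := by have := h.le_potential d; omega
        have h2 : ((k : ℕ) : ℝ) ≤ potential f L d := by exact_mod_cast h2
        nlinarith
      · have h2 : potential f L d ≤ (k : ℕ) := by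
          have := potential_le (f := f) (L := L) (d := d) .refl; omega
        have h2 : (potential f L d : ℝ) ≤ (k : ℕ) := by exact_mod_cast h2
        nlinarith
    -- Both flows send one unit through `x_i`; `f` sends it to a value of least potential in the
    -- domain.
    · obtain ⟨d₀, hd₀⟩ := h.exists_assigned (hs i)
      have e1 : ∑ d : D i, (potential f L (toDX i d) : ℝ) * f (domArc i d) =
          potential f L (toDX i d₀) := by
        rw [Finset.sum_eq_single d₀]
        · rw [hd₀, mul_one]
        · intro d _ hd
          rw [(h.integral _).resolve_right fun e => hd (h.assigned_unique e hd₀), mul_zero]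
        · simp
      have e2 : ∑ d : D i, (potential f L (toDX i d₀) : ℝ) * g (domArc i d) =
          potential f L (toDX i d₀) := by
        have : ∑ d : D i, g (domArc i d) = 1 := by
          rw [← hg1 i, ← outflow_var, ← inflow_var g i]
          exact hg.1.2 _ (by simp [graph]) (by simp [graph])
        rw [← Finset.mul_sum, this, mul_one]
      rw [e1, ← e2]
      refine Finset.sum_le_sum fun d _ => mul_le_mul_of_nonneg_right ?_ (hg.1.1 _)
      exact_mod_cast potential_mono (h.innerReach_of_assigned hd₀ d)

end Balanced

/-! ### Tuples as flows, violation as cost -/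

/-- The number of variables with value `d`. -/
def multiplicity (x : ∀ i, D i) (d : DX D) : ℕ :=
  (Finset.univ.filter fun i => toDX i (x i) = d).card

/-- The flow that sends one unit through each `x_i` to the value of `x_i`. -/
def tupleFlow (x : ∀ i, D i) : Arc D → ℝ
  | .inl _ => 1
  | .inr (.inl q) => if x q.1 = q.2 then 1 else 0
  | .inr (.inr q) => if (q.2 : ℕ) < multiplicity x q.1 then 1 else 0

theorem multiplicity_le (x : ∀ i, D i) (d : DX D) :
    multiplicity x d ≤ (owners D d.1).card := by
  refine Finset.card_le_card fun i hi => Finset.mem_filter.2 ⟨Finset.mem_univ _, ?_⟩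
  rw [← (Finset.mem_filter.1 hi).2]
  exact (x i).2

theorem tupleFlow_sum_val (x : ∀ i, D i) (d : DX D) :
    (∑ i : Fin n, if h : d.1 ∈ D i then tupleFlow x (domArc i ⟨d.1, h⟩) else 0) =
      multiplicity x d := by
  rw [multiplicity, Finset.card_filter, Nat.cast_sum]
  refine Finset.sum_congr rfl fun i _ => ?_
  by_cases h : d.1 ∈ D i
  · rw [dif_pos h]
    simp [tupleFlow, toDX, Subtype.ext_iff]
  · rw [dif_neg h, if_neg]
    · simp
    · rintro rfl
      exact h (x i).2

theorem tupleFlow_isFeasible (x : ∀ i, D i) : (graph D).IsFeasible (tupleFlow x) := by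
  refine ⟨⟨?_, ?_⟩, ?_⟩
  · rintro (i | q | q) <;> simp only [tupleFlow] <;> (try split_ifs) <;> norm_num
  · rintro (_ | _ | i | d) h1 h2
    · exact absurd rfl h1
    · exact absurd rfl h2
    · rw [outflow_var, inflow_var]
      simp [tupleFlow]
    · rw [outflow_val, inflow_val, tupleFlow_sum_val]
      simp only [tupleFlow]
      rw [Finset.sum_boole, Fin.card_filter_val_lt, min_eq_right (multiplicity_le x d)]
  · rintro (i | q | q) <;> simp only [tupleFlow, graph] <;> (try split_ifs) <;> norm_num

theorem tupleFlow_value (x : ∀ i, D i) : (graph D).value (tupleFlow x) = n := by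
  rw [graph_value]
  simp [tupleFlow]

/-- The pairs of a finite set, counted by their larger element; a new maximum is above all of the
old set. The right side is the cost of the first `S.card` parallel arcs. -/
theorem sum_card_filter_lt {ι : Type*} [LinearOrder ι] (S : Finset ι) :
    ∑ j ∈ S, (S.filter (· < j)).card = ∑ k ∈ Finset.range S.card, k := by
  induction S using Finset.induction_on_max with
  | empty => simp
  | insert a S ha ih =>
    have hn : a ∉ S := fun h => lt_irrefl _ (ha a h)
    rw [Finset.sum_insert hn, Finset.card_insert_of_notMem hn, Finset.sum_range_succ, ← ih,
      add_comm]
    congr 1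
    · refine Finset.sum_congr rfl fun j hj => ?_
      rw [Finset.filter_insert, if_neg (not_lt.2 (ha j hj).le)]
    · rw [Finset.filter_insert, if_neg (lt_irrefl a), Finset.filter_true_of_mem ha]

/-- The violating pairs are counted by their larger index and then grouped by their common value. -/
theorem violation_eq (x : ∀ i, D i) :
    violation (fun i => (x i).1) = ∑ d, ∑ k ∈ Finset.range (multiplicity x d), k := by
  have h1 : violation (fun i => (x i).1) =
      ∑ j : Fin n, (Finset.univ.filter fun i => i < j ∧ toDX i (x i) = toDX j (x j)).card := by
    rw [violation, Finset.card_filter, Fintype.sum_prod_type_right]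
    refine Finset.sum_congr rfl fun j _ => ?_
    rw [Finset.card_filter]
    exact Finset.sum_congr rfl fun i _ => if_congr
      (and_congr_right' (Subtype.ext_iff (a1 := toDX i (x i)) (a2 := toDX j (x j))).symm) rfl rfl
  rw [h1, ← Finset.sum_fiberwise Finset.univ (fun j => toDX j (x j))]
  refine Finset.sum_congr rfl fun d _ => ?_
  rw [multiplicity, ← sum_card_filter_lt]
  refine Finset.sum_congr rfl fun j hj => ?_
  rw [(Finset.mem_filter.1 hj).2, Finset.filter_filter]
  simp only [and_comm]

theorem tupleFlow_flowCost (x : ∀ i, D i) :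
    (graph D).flowCost (tupleFlow x) = violation (fun i => (x i).1) := by
  rw [graph_flowCost, violation_eq, Nat.cast_sum]
  refine Finset.sum_congr rfl fun d _ => ?_
  simp only [tupleFlow, mul_ite, mul_one, mul_zero]
  rw [Fin.sum_univ_eq_sum_range (fun k => if k < multiplicity x d then (k : ℝ) else 0),
    ← Finset.sum_filter, Nat.cast_sum]
  refine Finset.sum_congr ?_ fun _ _ => rfl
  ext k
  have := multiplicity_le x d
  simp only [Finset.mem_filter, Finset.mem_range]
  omega

theorem Balanced.exists_tuple {f : Arc D → ℝ} {L : DX D → ℕ} (h : Balanced f L)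
    (hs : ∀ i, f (srcArc i) = 1) : ∃ x : ∀ i, D i, f = tupleFlow x := by
  choose x hx using fun i => h.exists_assigned (hs i)
  have h1 : ∀ i d, f (domArc i d) = tupleFlow x (domArc i d) := by
    intro i d
    simp only [tupleFlow]
    split_ifs with e
    · rw [← e, hx]
    · exact (h.integral _).resolve_right fun e' => e (h.assigned_unique (hx i) e')
  refine ⟨x, funext ?_⟩
  rintro (i | ⟨i, d⟩ | ⟨d, k⟩)
  · exact hs i
  · exact h1 i d
  -- The inflow of `d` is the level on one hand and the multiplicity on the other, so the same
  -- parallel arcs are filled.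
  · have h2 := h.sum_val d
    simp only [h1] at h2
    rw [tupleFlow_sum_val] at h2
    have h3 := h.sink d k
    rw [← Nat.cast_injective h2] at h3
    exact h3

/-- The cost of `f` is the least violation of any tuple: every tuple is a flow of the same value,
and `f` itself is the flow of a tuple. The largest admissible `z` is the best choice. -/
theorem Balanced.consistent_iff {f : Arc D → ℝ} {L : DX D → ℕ} (h : Balanced f L)
    (hs : ∀ i, f (srcArc i) = 1) {Dz : Finset ℤ} {M : ℤ} (hM : M ∈ Dz) (hle : ∀ z ∈ Dz, z ≤ M) :
    Consistent D Dz ↔ (graph D).flowCost f ≤ M := by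
  constructor
  · rintro ⟨⟨x, z⟩, hx, hz, hv⟩
    have h1 := (h.isMinCostFlow hs).2.2 (tupleFlow fun i => ⟨x i, hx i⟩) (tupleFlow_isFeasible _)
      (by rw [tupleFlow_value, graph_value]; simp [hs])
    rw [tupleFlow_flowCost] at h1
    refine h1.trans ?_
    have h2 : ((violation x : ℕ) : ℤ) ≤ M := hv.trans (hle z hz)
    exact_mod_cast h2
  · intro hc
    obtain ⟨x, rfl⟩ := h.exists_tuple hs
    rw [tupleFlow_flowCost] at hc
    exact ⟨⟨fun i => x i, M⟩, fun i => (x i).2, hM, by exact_mod_cast hc⟩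

end MinCost

/-! ## Reasoning about programs -/

namespace Store

@[simp] theorem setVar_var (s : Store) (x y : ℕ) (z : ℤ) :
    (s.setVar x z).var y = if y = x then z else s.var y := by
  simp [setVar, Function.update_apply]

@[simp] theorem setVar_arr (s : Store) (x : ℕ) (z : ℤ) : (s.setVar x z).arr = s.arr := rfl

@[simp] theorem setArr_var (s : Store) (a : ℕ) (i z : ℤ) : (s.setArr a i z).var = s.var := rfl

@[simp] theorem setArr_arr (s : Store) (a b : ℕ) (i j z : ℤ) :
    (s.setArr a i z).arr b j = if b = a ∧ j = i then z else s.arr b j := by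
  by_cases h : b = a
  · subst h; simp [setArr, Function.update_apply]
  · simp [setArr, h]

end Store

namespace Program

/-- Programs whose final store is given by evaluation and whose number of steps is bounded
independently of the store. Only loops need invariants. -/
def LoopFree : Program → Prop
  | skip => True
  | assign _ _ => True
  | store _ _ _ => True
  | seq c₁ c₂ => c₁.LoopFree ∧ c₂.LoopFree
  | ite _ c₁ c₂ => c₁.LoopFree ∧ c₂.LoopFree
  | loop _ _ => False

open Classical in
/-- The effect of a loop-free program. -/
noncomputable def sem : Program → Store → Store
  | skip, s => s
  | assign x e, s => s.setVar x (e.eval s)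
  | store a i e, s => s.setArr a (i.eval s) (e.eval s)
  | seq c₁ c₂, s => c₂.sem (c₁.sem s)
  | ite b c₁ c₂, s => if b.eval s then c₁.sem s else c₂.sem s
  | loop _ _, s => s

/-- A bound for the number of steps of a loop-free program. -/
def cost : Program → ℕ
  | skip => 1
  | assign _ e => e.time + 1
  | store _ i e => i.time + e.time + 1
  | seq c₁ c₂ => c₁.cost + c₂.cost
  | ite b c₁ c₂ => b.time + max c₁.cost c₂.cost + 1
  | loop _ _ => 0

/-- Syntactic lists, so that `decide` settles that a concrete program leaves a given register alone.
-/
def varsWritten : Program → List ℕ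
  | skip => []
  | assign x _ => [x]
  | store _ _ _ => []
  | seq c₁ c₂ => c₁.varsWritten ++ c₂.varsWritten
  | ite _ c₁ c₂ => c₁.varsWritten ++ c₂.varsWritten
  | loop _ c => c.varsWritten

def arrsWritten : Program → List ℕ
  | skip => []
  | assign _ _ => []
  | store a _ _ => [a]
  | seq c₁ c₂ => c₁.arrsWritten ++ c₂.arrsWritten
  | ite _ c₁ c₂ => c₁.arrsWritten ++ c₂.arrsWritten
  | loop _ c => c.arrsWritten

theorem exec_sem {c : Program} (h : c.LoopFree) (s : Store) :
    ∃ T, Exec c s (c.sem s) T ∧ T ≤ c.cost := by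
  induction c generalizing s with
  | skip => exact ⟨1, .skip s, le_rfl⟩
  | assign x e => exact ⟨_, .assign s x e, le_rfl⟩
  | store a i e => exact ⟨_, .store s a i e, le_rfl⟩
  | seq c₁ c₂ ih₁ ih₂ =>
    obtain ⟨T₁, h₁, t₁⟩ := ih₁ h.1 s
    obtain ⟨T₂, h₂, t₂⟩ := ih₂ h.2 (c₁.sem s)
    exact ⟨_, .seq h₁ h₂, add_le_add t₁ t₂⟩
  | ite b c₁ c₂ ih₁ ih₂ =>
    rw [sem]
    split_ifs with hb
    · obtain ⟨T₁, h₁, t₁⟩ := ih₁ h.1 s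
      exact ⟨_, .iteTrue hb h₁, by rw [cost]; omega⟩
    · obtain ⟨T₂, h₂, t₂⟩ := ih₂ h.2 s
      exact ⟨_, .iteFalse hb h₂, by rw [cost]; omega⟩
  | loop b c => exact h.elim

/-- `s'` agrees with `s` on all that `c` does not write to. -/
structure Unchanged (c : Program) (s s' : Store) : Prop where
  var : ∀ x, x ∉ c.varsWritten → s'.var x = s.var x
  arr : ∀ a, a ∉ c.arrsWritten → s'.arr a = s.arr a

namespace Unchanged

variable {c c₁ c₂ : Program} {s s' s'' : Store}

theorem refl (c : Program) (s : Store) : Unchanged c s s := ⟨fun _ _ => rfl, fun _ _ => rfl⟩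

theorem trans (h : Unchanged c s s') (h' : Unchanged c s' s'') : Unchanged c s s'' :=
  ⟨fun x hx => (h'.var x hx).trans (h.var x hx), fun a ha => (h'.arr a ha).trans (h.arr a ha)⟩

theorem mono (h : Unchanged c₁ s s') (hv : c₁.varsWritten ⊆ c₂.varsWritten)
    (ha : c₁.arrsWritten ⊆ c₂.arrsWritten) : Unchanged c₂ s s' :=
  ⟨fun x hx => h.var x fun h' => hx (hv h'), fun a hx => h.arr a fun h' => hx (ha h')⟩

end Unchanged

theorem _root_.SoftAlldiff.Exec.unchanged {c : Program} {s s' : Store} {T : ℕ} (h : Exec c s s' T) :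
    Unchanged c s s' := by
  induction h with
  | skip => exact .refl _ _
  | assign s x e =>
    refine ⟨fun y hy => ?_, fun _ _ => rfl⟩
    simp only [varsWritten, List.mem_singleton] at hy
    simp [hy]
  | store s a i e =>
    refine ⟨fun _ _ => rfl, fun b hb => ?_⟩
    simp only [arrsWritten, List.mem_singleton] at hb
    funext j
    simp [hb]
  | seq _ _ ih₁ ih₂ =>
    exact (ih₁.mono (by simp [varsWritten]) (by simp [arrsWritten])).trans
      (ih₂.mono (by simp [varsWritten]) (by simp [arrsWritten]))
  | iteTrue _ _ ih => exact ih.mono (by simp [varsWritten]) (by simp [arrsWritten])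
  | iteFalse _ _ ih => exact ih.mono (by simp [varsWritten]) (by simp [arrsWritten])
  -- A loop writes by definition what its body writes, so the statement for the body is repackaged
  -- as one for the loop.
  | loopTrue _ _ _ ih₁ ih₂ => exact Unchanged.trans (c := .loop _ _) ⟨ih₁.var, ih₁.arr⟩ ih₂
  | loopFalse => exact .refl _ _

/-- Started in `s`, the program halts within `B` steps, in a store with property `Q`. -/
def Runs (c : Program) (s : Store) (B : ℕ) (Q : Store → Prop) : Prop :=
  ∃ s' T, Exec c s s' T ∧ T ≤ B ∧ Unchanged c s s' ∧ Q s'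

namespace Runs

variable {c c₁ c₂ : Program} {s : Store} {B B₁ B₂ : ℕ} {Q R : Store → Prop} {b : Test}

theorem mono (h : Runs c s B₁ Q) (hB : B₁ ≤ B₂) (hQ : ∀ s', Unchanged c s s' → Q s' → R s') :
    Runs c s B₂ R := by
  obtain ⟨s', T, he, hT, hu, hq⟩ := h
  exact ⟨s', T, he, hT.trans hB, hu, hQ s' hu hq⟩

theorem of_sem (hc : c.LoopFree) (h : Q (c.sem s)) : Runs c s c.cost Q := by
  obtain ⟨T, he, hT⟩ := exec_sem hc s
  exact ⟨_, T, he, hT, he.unchanged, h⟩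

theorem seq (h₁ : Runs c₁ s B₁ Q) (h₂ : ∀ s', Unchanged c₁ s s' → Q s' → Runs c₂ s' B₂ R) :
    Runs (c₁.seq c₂) s (B₁ + B₂) R := by
  obtain ⟨s', T₁, he₁, hT₁, hu₁, hq⟩ := h₁
  obtain ⟨s'', T₂, he₂, hT₂, hu₂, hr⟩ := h₂ s' hu₁ hq
  have he := he₁.seq he₂
  exact ⟨s'', _, he, add_le_add hT₁ hT₂, he.unchanged, hr⟩

theorem ite (h₁ : b.eval s → Runs c₁ s B Q) (h₂ : ¬ b.eval s → Runs c₂ s B Q) :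
    Runs (.ite b c₁ c₂) s (b.time + 1 + B) Q := by
  by_cases hb : b.eval s
  · obtain ⟨s', T, he, hT, -, hq⟩ := h₁ hb
    exact ⟨s', _, .iteTrue hb he, by omega, (Exec.iteTrue hb he).unchanged, hq⟩
  · obtain ⟨s', T, he, hT, -, hq⟩ := h₂ hb
    exact ⟨s', _, .iteFalse hb he, by omega, (Exec.iteFalse hb he).unchanged, hq⟩

/-- A loop with an invariant `I` that contains a decreasing counter. -/
theorem loop (I : ℕ → Store → Prop)
    (step : ∀ k s', Unchanged c s s' → I k s' → b.eval s' →
      Runs c s' B fun s'' => ∃ k' < k, I k' s'') {k : ℕ} (h : I k s) :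
    Runs (.loop b c) s ((b.time + B + 1) * k + (b.time + 1))
      fun s' => (∃ k', I k' s') ∧ ¬ b.eval s' := by
  have key : ∀ k s', Unchanged c s s' → I k s' → ∃ s'' T, Exec (.loop b c) s' s'' T ∧
      T ≤ (b.time + B + 1) * k + (b.time + 1) ∧ (∃ k', I k' s'') ∧ ¬ b.eval s'' := by
    intro k
    induction k using Nat.strong_induction_on with
    | _ k ih =>
      intro s' hu hI
      by_cases hb : b.eval s'
      · obtain ⟨s₁, T₁, he₁, hT₁, hu₁, k', hk', hI'⟩ := step k s' hu hI hb
        obtain ⟨s₂, T₂, he₂, hT₂, hq⟩ := ih k' hk' s₁ (hu.trans hu₁) hI'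
        refine ⟨s₂, _, .loopTrue hb he₁ he₂, ?_, hq⟩
        have : (b.time + B + 1) * (k' + 1) ≤ (b.time + B + 1) * k := Nat.mul_le_mul_left _ hk'
        rw [Nat.mul_succ] at this
        omega
      · exact ⟨s', _, .loopFalse hb, by omega, ⟨k, hI⟩, hb⟩
  obtain ⟨s', T, he, hT, hq⟩ := key k s (.refl _ _) h
  exact ⟨s', T, he, hT, he.unchanged, hq⟩

end Runs

/-- Execute `c` for the values `0, 1, …` of register `x` below register `y`. -/
def forLoop (x y : ℕ) (c : Program) : Program :=
  .seq (.assign x (.const 0))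
    (.loop (.not (.le (.var y) (.var x))) (.seq c (.assign x (.add (.var x) (.const 1)))))

/-- The bound is stated with some `M ≥ N`, so that loops over the `n` variables can be charged to
`m`. -/
theorem Runs.forLoop {x y : ℕ} {c : Program} {s : Store} {N M : ℕ} (hc : c.LoopFree)
    (hxy : y ≠ x) (hx : x ∉ c.varsWritten) (hy : y ∉ c.varsWritten) (hN : s.var y = N)
    (I : ℕ → Store → Prop) (h0 : I 0 (s.setVar x 0))
    (step : ∀ j < N, ∀ s', Unchanged (forLoop x y c) s s' → s'.var x = j → I j s' →
      I (j + 1) ((c.sem s').setVar x (j + 1))) (hM : N ≤ M) (hM' : 1 ≤ M) :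
    Runs (forLoop x y c) s ((c.cost + 20) * M) (I N) := by
  have h1 : Runs (.assign x (.const 0)) s 2 fun s' => s' = s.setVar x 0 := of_sem trivial rfl
  have h2 : Runs (Program.forLoop x y c) s (2 + ((4 + (c.cost + 4) + 1) * N + (4 + 1))) (I N) := by
    refine h1.seq ?_
    rintro s₁ hu rfl
    have := Runs.loop (c := .seq c (.assign x (.add (.var x) (.const 1)))) (s := s.setVar x 0)
      (b := .not (.le (.var y) (.var x))) (B := c.cost + 4)
      (fun k s' => ∃ j : ℕ, j + k = N ∧ s'.var x = j ∧ I j s') ?_ (k := N) ⟨0, by simp, by simp, h0⟩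
    · refine this.mono le_rfl ?_
      rintro s' hu' ⟨⟨k, j, hjk, hj, hI⟩, hb⟩
      have : s'.var y = N := by
        rw [hu'.var y (by simp [varsWritten, hxy, hy])]
        simp [hxy, hN]
      simp only [Test.eval, Exp.eval, not_not, this, hj] at hb
      have : j = N := by omega
      exact this ▸ hI
    · rintro k s' hu' ⟨j, hjk, hj, hI⟩ hb
      have hy' : s'.var y = N := by
        rw [hu'.var y (by simp [varsWritten, hxy, hy])]
        simp [hxy, hN]
      simp only [Test.eval, Exp.eval, hy', hj] at hb
      refine Runs.of_sem (Q := fun s'' => ∃ k' < k, ∃ j : ℕ, j + k' = N ∧ s''.var x = j ∧ I j s'')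
        ⟨hc, trivial⟩ ?_
      have hu'' : Unchanged (Program.forLoop x y c) s s' :=
        (hu.mono (by simp [Program.forLoop, varsWritten])
          (by simp [Program.forLoop, arrsWritten])).trans
        (hu'.mono (by simp [Program.forLoop, varsWritten])
          (by simp [Program.forLoop, arrsWritten]))
      have hs := step j (by omega) s' hu'' hj hI
      have hxs : (c.sem s').var x = j := by
        obtain ⟨T, he, -⟩ := exec_sem hc s'
        rw [he.unchanged.var x hx, hj]
      refine ⟨k - 1, by omega, j + 1, by omega, ?_, ?_⟩
      · simp [sem, Exp.eval, hxs]
      · simpa [sem, Exp.eval, hxs] using hs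
  refine h2.mono ?_ fun _ _ h => h
  -- Loop control takes 9 steps per pass; the 7 steps outside the passes are paid from `11 * M`, as
  -- `M ≥ 1`.
  have : (c.cost + 20) * M = (c.cost + 9) * M + 11 * M := by ring
  have : (c.cost + 9) * N ≤ (c.cost + 9) * M := Nat.mul_le_mul_left _ hM
  have : (4 + (c.cost + 4) + 1) * N = (c.cost + 9) * N := by ring
  omega

end Program

section Positions

variable {α : Type*} {n : ℕ} {D : Fin n → Finset α}

/-! ## Positions in the concatenated lists -/

theorem start_zero : start D 0 = 0 := by simp [start]

theorem start_succ (i : Fin n) : start D (i + 1) = start D i + (D i).card := by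
  have : Finset.univ.filter (fun j : Fin n => (j : ℕ) < i + 1) =
      insert i (Finset.univ.filter (fun j : Fin n => (j : ℕ) < i)) := by
    ext j
    simp only [Finset.mem_filter, Finset.mem_univ, true_and, Finset.mem_insert, Fin.ext_iff]
    omega
  rw [start, this, Finset.sum_insert (by simp), start, add_comm]

theorem start_mono : Monotone (start D) := fun a b h =>
  Finset.sum_le_sum_of_subset fun j hj => by
    simp only [Finset.mem_filter, Finset.mem_univ, true_and] at hj ⊢
    omega

theorem start_last : start D n = domSum D := by
  simp [start, domSum]

theorem le_domSum (hD : ∀ i, (D i).Nonempty) : n ≤ domSum D := by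
  have : ∑ _i : Fin n, 1 ≤ domSum D := Finset.sum_le_sum fun i _ => (hD i).card_pos
  simpa using this

variable (e : ∀ i, Fin (D i).card ≃ D i)

theorem start_le_pos (i : Fin n) (d : D i) : start D i ≤ pos e i d := Nat.le_add_right _ _

theorem pos_lt (i : Fin n) (d : D i) : pos e i d < start D (i + 1) := by
  rw [start_succ]
  exact Nat.add_lt_add_left ((e i).symm d).2 _

theorem pos_lt_domSum (i : Fin n) (d : D i) : pos e i d < domSum D :=
  (pos_lt e i d).trans_le (start_last (D := D) ▸ start_mono i.2)

theorem pos_lt_pos {i j : Fin n} (h : i < j) (d : D i) (d' : D j) : pos e i d < pos e j d' :=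
  (pos_lt e i d).trans_le ((start_mono (Nat.succ_le_of_lt h)).trans (start_le_pos e j d'))

theorem var_eq_of_pos {i j : Fin n} {d : D i} {d' : D j} (h : pos e i d = pos e j d') : i = j := by
  rcases lt_trichotomy i j with hlt | heq | hgt
  · exact absurd h (pos_lt_pos e hlt d d').ne
  · exact heq
  · exact absurd h (pos_lt_pos e hgt d' d).ne'

theorem pos_inj {i : Fin n} {d d' : D i} (h : pos e i d = pos e i d') : d = d' := by
  have := Nat.add_left_cancel h
  exact (e i).symm.injective (Fin.ext this)

theorem exists_pos_of_le {i : Fin n} {q : ℕ} (h : start D i ≤ q) (h' : q < start D (i + 1)) :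
    ∃ d, pos e i d = q := by
  rw [start_succ] at h'
  refine ⟨e i ⟨q - start D i, by omega⟩, ?_⟩
  simp only [pos, Equiv.symm_apply_apply]
  omega

theorem exists_pos {q : ℕ} (h : q < domSum D) : ∃ i d, pos e i d = q := by
  have key : ∀ k ≤ n, q < start D k → ∃ i d, pos e i d = q := by
    intro k
    induction k with
    | zero => intro _ h; rw [start_zero] at h; omega
    | succ k ih =>
      intro hk h
      by_cases hq : q < start D k
      · exact ih (by omega) hq
      · obtain ⟨d, hd⟩ := exists_pos_of_le e (i := ⟨k, hk⟩) (not_lt.1 hq) h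
        exact ⟨_, d, hd⟩
  exact key n le_rfl (start_last (D := D) ▸ h)

variable [DecidableEq α]

theorem cell_srcArc (i : Fin n) : cell e (srcArc i : Arc D) = i := rfl

theorem cell_domArc (i : Fin n) (d : D i) : cell e (domArc i d) = pos e i d := rfl

theorem cell_snkArc (v : DX D) (k : Fin (owners D v.1).card) :
    cell e (snkArc v k) = pos e (owner v k) ⟨v.1, mem_owner v k⟩ := rfl

/-- The reason for this choice of cells: an increasing sweep meets the parallel arcs of a value in
order of their costs. -/
theorem cell_snkArc_lt {v : DX D} {k k' : Fin (owners D v.1).card} (h : k < k') :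
    cell e (snkArc v k) < cell e (snkArc v k') :=
  pos_lt_pos e (((owners D v.1).orderEmbOfFin rfl).strictMono h) _ _

/-- With `cell_injective`, every position is the cell of exactly one arc into `t`, so one sweep
covers all these arcs. -/
theorem exists_snkArc (i : Fin n) (d : D i) : ∃ k, cell e (snkArc (toDX i d) k) = pos e i d := by
  have hi : i ∈ owners D (toDX i d).1 := Finset.mem_filter.2 ⟨Finset.mem_univ _, d.2⟩
  rw [← Finset.mem_coe, ← Finset.range_orderEmbOfFin _ rfl] at hi
  obtain ⟨k, hk⟩ := hi
  refine ⟨k, ?_⟩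
  have : ∀ j (hj : (toDX i d).1 ∈ D j), j = i → pos e j ⟨_, hj⟩ = pos e i d := by
    rintro j hj rfl
    rfl
  exact this _ _ hk

theorem val_eq_of_cell {v : DX D} {k : Fin (owners D v.1).card} {i : Fin n} {d : D i}
    (h : cell e (snkArc v k) = pos e i d) : v = toDX i d := by
  rw [cell_snkArc] at h
  have hi := var_eq_of_pos e h
  subst hi
  have hd : (⟨v.1, mem_owner v k⟩ : D (owner v k)) = d := pos_inj e h
  have hv : v.1 = d.1 := congrArg Subtype.val hd
  exact Subtype.ext hv

theorem cell_snkArc_lt_domSum (v : DX D) (k : Fin (owners D v.1).card) :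
    cell e (snkArc v k) < domSum D := pos_lt_domSum e _ _

theorem cell_injective {a b : Arc D} (hk : kind a = kind b) (h : cell e a = cell e b) : a = b := by
  obtain i | ⟨i, d⟩ | ⟨v, k⟩ := a <;> obtain j | ⟨j, d'⟩ | ⟨w, k'⟩ := b <;>
    simp only [kind, OfNat.ofNat_ne_zero, OfNat.zero_ne_ofNat, zero_ne_one,
      one_ne_zero, OfNat.ofNat_ne_one, OfNat.one_ne_ofNat] at hk
  · exact congrArg _ (Fin.ext h)
  · have hi : i = j := var_eq_of_pos e h
    subst hi
    have hd : d = d' := pos_inj e h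
    rw [hd]
  · have hv : v = w := val_eq_of_cell e (h.trans (cell_snkArc e w k'))
    subst hv
    have : k = k' := by
      rcases lt_trichotomy k k' with hlt | heq | hgt
      · exact absurd h (cell_snkArc_lt e hlt).ne
      · exact heq
      · exact absurd h (cell_snkArc_lt e hgt).ne'
    rw [this]

/-! ### Reading the encodings in memory -/

variable {e}

theorem EncodesDomains.congr {code : DX D ↪ ℤ} {s s' : Store} (h : EncodesDomains code e s)
    (hv : s'.var 0 = s.var 0) (h0 : s'.arr 0 = s.arr 0) (h1 : s'.arr 1 = s.arr 1) :
    EncodesDomains code e s' := by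
  obtain ⟨a, b, c⟩ := h
  exact ⟨hv.trans a, fun i hi => by rw [h0, b i hi], fun i d => by rw [h1, c i d]⟩

theorem EncodesFlow.congr {f : Arc D → ℝ} {s s' : Store} (h : EncodesFlow e f s)
    (h3 : s'.arr 3 = s.arr 3) (h4 : s'.arr 4 = s.arr 4) (h5 : s'.arr 5 = s.arr 5) :
    EncodesFlow e f s' := by
  intro a
  rw [← h a]
  obtain i | q | q := a <;> simp [kind, h3, h4, h5]

/-- Cells hold integers while flows are real; this and its two companions translate the tests of the
programs into statements about `f`. -/
theorem EncodesFlow.src {f : Arc D → ℝ} {s : Store} (h : EncodesFlow e f s) (i : Fin n) (z : ℤ) :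
    s.arr 3 (i : ℕ) = z ↔ f (srcArc i) = z := by
  rw [← h (srcArc i)]
  simp only [cell_srcArc, kind, add_zero]
  norm_cast

theorem EncodesFlow.dom {f : Arc D → ℝ} {s : Store} (h : EncodesFlow e f s) (i : Fin n) (d : D i)
    (z : ℤ) : s.arr 4 (pos e i d) = z ↔ f (domArc i d) = z := by
  rw [← h (domArc i d)]
  simp only [cell_domArc, kind]
  norm_cast

theorem EncodesFlow.snk {f : Arc D → ℝ} {s : Store} (h : EncodesFlow e f s) (v : DX D)
    (k : Fin (owners D v.1).card) (z : ℤ) :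
    s.arr 5 (cell e (snkArc v k)) = z ↔ f (snkArc v k) = z := by
  rw [← h (snkArc v k)]
  simp only [kind]
  norm_cast

end Positions

/-! ## Setting the zero flow and augmenting -/

open Program

/-- Put the sum of the sizes of the domains into register `4`. -/
def sizeProgram : Program := .assign 4 (.arr 0 (.var 0))

def clearSources : Program := forLoop 5 0 (.store 3 (.var 5) (.const 0))

def clearCells : Program :=
  forLoop 5 4 (.seq (.store 4 (.var 5) (.const 0)) (.store 5 (.var 5) (.const 0)))

def initProgram : Program := .seq sizeProgram (.seq clearSources clearCells)

/-- Add the direction of the residual arc in row `5` of the path to the flow in array `a`. -/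
def bump (a : ℕ) : Program :=
  .store a (.arr 7 (.var 5)) (.add (.arr a (.arr 7 (.var 5))) (.arr 8 (.var 5)))

def augmentProgram : Program :=
  forLoop 5 3 (.ite (.eq (.arr 6 (.var 5)) (.const 0)) (bump 3)
    (.ite (.eq (.arr 6 (.var 5)) (.const 1)) (bump 4) (bump 5)))

section Simple

variable {α : Type*} [DecidableEq α] {n : ℕ} {D : Fin n → Finset α}
variable {e : ∀ i, Fin (D i).card ≃ D i} {code : DX D ↪ ℤ} {s : Store}

theorem sizeProgram_runs (h : EncodesDomains code e s) :
    Runs sizeProgram s 3 fun s' => s'.var 4 = domSum D := by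
  refine Runs.of_sem (c := sizeProgram) trivial ?_
  simp [sizeProgram, sem, Exp.eval, h.1, h.2.1 n le_rfl, start_last]

theorem initProgram_runs (hn : 0 < n) (hD : ∀ i, (D i).Nonempty) (h : EncodesDomains code e s) :
    Runs initProgram s (100 * domSum D) (EncodesFlow e 0) := by
  have hm := le_domSum hD
  have hrun : Runs initProgram s (3 + ((3 + 20) * domSum D + (6 + 20) * domSum D))
      (EncodesFlow e 0) := by
    refine (sizeProgram_runs h).seq fun s₁ hu₁ h₁ => Runs.seq (Q := fun s' => ∀ i : ℕ, i < n →
      s'.arr 3 i = 0) ?_ fun s₂ hu₂ h₂ => ?_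
    · refine Runs.forLoop (c := .store 3 (.var 5) (.const 0)) (N := n) trivial (by decide)
        (by decide) (by decide) ?_ (fun j s' => ∀ i : ℕ, i < j → s'.arr 3 i = 0) (by simp) ?_ hm
        (by omega)
      · rw [hu₁.var 0 (by decide), h.1]
      · intro j _ s' _ hj hI i hi
        simp only [sem, Exp.eval, hj, Store.setVar_arr, Store.setArr_arr, true_and, Nat.cast_inj]
        split_ifs
        · rfl
        · exact hI i (by omega)
    · have := Runs.forLoop (c := .seq (.store 4 (.var 5) (.const 0)) (.store 5 (.var 5) (.const 0)))
        (x := 5) (y := 4) (s := s₂)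
        (N := domSum D) (M := domSum D) ⟨trivial, trivial⟩ (by decide)
        (by decide) (by decide) (by rw [hu₂.var 4 (by decide), h₁])
        (fun j s' => ∀ i : ℕ, i < j → s'.arr 4 i = 0 ∧ s'.arr 5 i = 0) (by simp) ?_ le_rfl
        (by omega)
      · refine this.mono le_rfl fun s₃ hu₃ h₃ => ?_
        rintro (i | q | q)
        · simp only [kind]
          rw [add_zero, hu₃.arr 3 (by decide), cell_srcArc, h₂ i i.2]
          simp
        · rw [show (3 + kind (Sum.inr (Sum.inl q) : Arc D)) = 4 from rfl,
            show cell e (Sum.inr (Sum.inl q)) = pos e q.1 q.2 from rfl, (h₃ _ (pos_lt_domSum e q.1 q.2)).1]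
          simp
        · rw [show (3 + kind (Sum.inr (Sum.inr q) : Arc D)) = 5 from rfl,
            (h₃ _ (cell_snkArc_lt_domSum e q.1 q.2)).2]
          simp
      · intro j _ s' _ hj hI i hi
        simp only [sem, Exp.eval, hj, Store.setVar_arr, Store.setArr_arr, Store.setArr_var,
          Nat.cast_inj]
        norm_num
        exact ⟨fun hij => (hI i (by omega)).1, fun hij => (hI i (by omega)).2⟩
  exact hrun.mono (by omega) fun _ _ h => h

theorem resPath_length_le (hD : ∀ i, (D i).Nonempty) {f : Arc D → ℝ} {p : List (ResArc (Arc D))}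
    (hn : 0 < n) (h : (graph D).IsResPath f p) : p.length ≤ 4 * domSum D := by
  have hn' : (p.map (graph D).resHead).Nodup := (List.nodup_cons.1 h.2.2).2
  -- An embedding into a type with `n + |D_X| + 2` elements. The heads on the path are distinct, so
  -- this bounds its length, and it is at most `2m + 2 ≤ 4m`.
  let g : Vertex D → Option (Option (Fin n ⊕ DX D)) := fun v =>
    match v with
    | .s => none
    | .t => some none
    | .var i => some (some (.inl i))
    | .val d => some (some (.inr d))
  have hg : Function.Injective g := by
    rintro (_ | _ | i | d) (_ | _ | j | d') hh <;> simp_all [g]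
  have h1 := (hn'.map hg).length_le_card
  simp only [List.length_map, Fintype.card_option, Fintype.card_sum, Fintype.card_fin,
    Fintype.card_coe] at h1
  have h2 : (DX D).card ≤ domSum D := Finset.card_biUnion_le
  have := le_domSum hD
  omega

theorem augmentProgram_runs (hD : ∀ i, (D i).Nonempty) (hn : 0 < n) {f : Arc D → ℝ}
    {p : List (ResArc (Arc D))} (hp : (graph D).IsResPath f p) (hf : EncodesFlow e f s)
    (hps : EncodesPath e p s) :
    Runs augmentProgram s (400 * domSum D) (EncodesFlow e (f + chi p)) := by
  have hm := le_domSum hD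
  have hnd := hp.arcs_nodup
  have := Runs.forLoop (x := 5) (y := 3) (c := .ite (.eq (.arr 6 (.var 5)) (.const 0)) (bump 3)
    (.ite (.eq (.arr 6 (.var 5)) (.const 1)) (bump 4) (bump 5))) (s := s) (N := p.length)
    (M := 4 * domSum D) ⟨trivial, trivial, trivial⟩ (by decide) (by decide) (by decide) hps.1
    -- A prefix of the path need not give a flow, but its incidence vector is still the sum of its
    -- unit changes, one per row.
    (fun j s' => EncodesFlow e (f + chi (p.take j)) s') ?_ ?_ (resPath_length_le hD hn hp) (by omega)
  · rw [List.take_length] at this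
    refine this.mono ?_ fun _ _ h => h
    simp [Program.cost, Test.time, Exp.time, bump]
    omega
  · rw [List.take_zero, chi_nil, add_zero]
    exact hf.congr rfl rfl rfl
  · intro j hj s' hu hjs hI
    have htake : p.take (j + 1) = p.take j ++ [p[j]] := by simp
    have hchi : chi (p.take (j + 1)) = chi (p.take j) + (p[j]).unit := by
      have h1 : ((p.take (j + 1)).map ResArc.arc).Nodup := by
        rw [List.map_take]; exact hnd.sublist (List.take_sublist _ _)
      have h2 : ((p.take j).map ResArc.arc).Nodup := by
        rw [List.map_take]; exact hnd.sublist (List.take_sublist _ _)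
      rw [chi_eq_sum h1, chi_eq_sum h2, htake, List.map_append, List.sum_append]
      simp
    have hrow := hps.2 ⟨j, hj⟩
    simp only [List.get_eq_getElem] at hrow
    rw [← hu.arr 6 (by decide), ← hu.arr 7 (by decide), ← hu.arr 8 (by decide), ← hjs] at hrow
    obtain ⟨h6, h7, h8⟩ := hrow
    set r := p[j] with hr
    have key : ∀ a, ((bump (3 + kind r.arc)).sem s').setVar 5 (j + 1) = a →
        EncodesFlow e (f + chi (p.take (j + 1))) a := by
      rintro _ rfl b
      rw [hchi, ← add_assoc, Pi.add_apply, ← hI b]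
      simp only [bump, sem, Exp.eval, Store.setVar_arr, Store.setArr_arr, h7, h8, ResArc.unit,
        Pi.single_apply]
      by_cases hb : b = r.arc
      · subst hb
        simp
      · rw [if_neg, if_neg hb, add_zero]
        rintro ⟨h1, h2⟩
        exact hb (cell_injective e (by omega) (by exact_mod_cast h2))
    apply key
    have hk : kind r.arc = 0 ∨ kind r.arc = 1 ∨ kind r.arc = 2 := by
      rcases r.arc with i | q | q <;> simp [kind]
    congr 1
    rcases hk with hk | hk | hk <;> rw [hk] at h6 <;> simp [sem, Test.eval, Exp.eval, h6, hk]

end Simple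

open Program

/-! ## The search: preparation -/

/-- For each value: no assigned cell, count `0`, not visited. -/
def resetBody : Program :=
  .seq (.store 9 (.arr 1 (.var 5)) (.const (-1)))
    (.seq (.store 12 (.arr 1 (.var 5)) (.const 0)) (.store 14 (.arr 1 (.var 5)) (.const (-1))))

def resetProgram : Program := forLoop 5 4 resetBody

/-- Cell by cell: the variable of the cell in array `11`; if the cell is assigned, it is put in front
of the list of the assigned cells of its value (arrays `9` and `10`), and is recorded as the cell of
its variable (array `16`). -/
def linkBody : Program :=
  .seq (.store 11 (.var 5) (.var 6))
    (.seq (.ite (.eq (.arr 4 (.var 5)) (.const 1))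
        (.seq (.store 10 (.var 5) (.arr 9 (.arr 1 (.var 5))))
          (.seq (.store 9 (.arr 1 (.var 5)) (.var 5)) (.store 16 (.var 6) (.var 5))))
        .skip)
      (.ite (.eq (.arr 0 (.add (.var 6) (.const 1))) (.add (.var 5) (.const 1)))
        (.assign 6 (.add (.var 6) (.const 1))) .skip))

def linkProgram : Program := .seq (.assign 6 (.const 0)) (forLoop 5 4 linkBody)

/-- The queue (array `15`, length in register `7`) starts with the unassigned variables. -/
def enqueueBody : Program :=
  .ite (.eq (.arr 3 (.var 5)) (.const 0))
    (.seq (.store 15 (.var 7) (.var 5)) (.assign 7 (.add (.var 7) (.const 1)))) .skip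

def enqueueProgram : Program := .seq (.assign 7 (.const 0)) (forLoop 5 0 enqueueBody)

section Preparation

variable {α : Type*} [DecidableEq α] {n : ℕ} {D : Fin n → Finset α}
variable {e : ∀ i, Fin (D i).card ≃ D i} {code : DX D ↪ ℤ} {s : Store} {f : Arc D → ℝ}

theorem exists_toDX (v : DX D) : ∃ i, ∃ d : D i, toDX i d = v := by
  obtain ⟨i, -, hi⟩ := Finset.mem_biUnion.1 v.2
  exact ⟨i, ⟨v.1, hi⟩, rfl⟩

/-- Every value occurs in some cell, so a sweep over the cells resets all values in time
proportional to `m`, however large their integer names are. -/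
theorem resetProgram_runs (hn : 0 < domSum D) (h : EncodesDomains code e s)
    (h4 : s.var 4 = domSum D) :
    Runs resetProgram s (100 * domSum D) fun s' => ∀ v, s'.arr 9 (code v) = -1 ∧
      s'.arr 12 (code v) = 0 ∧ s'.arr 14 (code v) = -1 := by
  have := Runs.forLoop (x := 5) (y := 4) (c := resetBody) (s := s) (N := domSum D)
    (M := domSum D) ⟨trivial, trivial, trivial⟩ (by decide) (by decide) (by decide) h4
    (fun j s' => ∀ i d, pos e i d < j → s'.arr 9 (code (toDX i d)) = -1 ∧
      s'.arr 12 (code (toDX i d)) = 0 ∧ s'.arr 14 (code (toDX i d)) = -1) (by simp) ?_ le_rfl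
    (by omega)
  · refine this.mono ?_ fun s' _ h' v => ?_
    · simp [Program.cost, Exp.time, resetBody]
      omega
    · obtain ⟨i, d, rfl⟩ := exists_toDX v
      exact h' i d (pos_lt_domSum e i d)
  · intro j hj s' hu hjs hI i d hd
    obtain ⟨i', d', rfl⟩ := exists_pos e hj
    have h1 : s'.arr 1 (pos e i' d') = code (toDX i' d') := by
      rw [hu.arr 1 (by decide), h.2.2]
    simp only [resetBody, sem, Exp.eval, hjs, Store.setVar_arr, Store.setArr_arr,
      Store.setArr_var, h1]
    rcases Nat.lt_succ_iff_lt_or_eq.1 hd with hlt | heq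
    · have := hI i d hlt
      norm_num
      exact ⟨fun _ => this.1, fun _ => this.2.1, fun _ => this.2.2⟩
    · have hi := var_eq_of_pos e heq
      subst hi
      rw [pos_inj e heq]
      norm_num

/-- `x` is the last assigned cell of value `v` before position `q`, or `-1`. -/
def IsLastCell (e : ∀ i, Fin (D i).card ≃ D i) (f : Arc D → ℝ) (v : DX D) (q : ℕ) (x : ℤ) : Prop :=
  (∀ i d, toDX i d = v → f (domArc i d) = 1 → pos e i d < q → (pos e i d : ℤ) ≤ x) ∧
    (x = -1 ∨ ∃ i d, toDX i d = v ∧ f (domArc i d) = 1 ∧ x = pos e i d ∧ pos e i d < q)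

theorem IsLastCell.succ_of_ne {v : DX D} {q : ℕ} {x : ℤ} (h : IsLastCell e f v q x)
    (hne : ∀ i d, pos e i d = q → toDX i d = v → f (domArc i d) ≠ 1) :
    IsLastCell e f v (q + 1) x := by
  refine ⟨fun i d hv hd hq => h.1 i d hv hd ?_, h.2.imp id ?_⟩
  · rcases Nat.lt_succ_iff_lt_or_eq.1 hq with hlt | heq
    · exact hlt
    · exact absurd hd (hne i d heq hv)
  · rintro ⟨i, d, hv, hd, hx, hq⟩
    exact ⟨i, d, hv, hd, hx, hq.trans (Nat.lt_succ_self _)⟩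

theorem IsLastCell.self {i : Fin n} {d : D i} (h : f (domArc i d) = 1) :
    IsLastCell e f (toDX i d) (pos e i d + 1) (pos e i d) :=
  ⟨fun i' d' _ _ hq => by exact_mod_cast Nat.lt_succ_iff.1 hq,
    Or.inr ⟨i, d, rfl, h, rfl, Nat.lt_succ_self _⟩⟩

/-- The tables that the preparation computes, up to position `q`. -/
structure Linked (e : ∀ i, Fin (D i).card ≃ D i) (code : DX D ↪ ℤ) (f : Arc D → ℝ) (q : ℕ)
    (s : Store) : Prop where
  head : ∀ v, IsLastCell e f v q (s.arr 9 (code v))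
  next : ∀ i d, pos e i d < q → f (domArc i d) = 1 →
    IsLastCell e f (toDX i d) (pos e i d) (s.arr 10 (pos e i d))
  owner : ∀ i d, pos e i d < q → s.arr 11 (pos e i d) = (i : ℕ)
  assigned : ∀ i d, pos e i d < q → f (domArc i d) = 1 → s.arr 16 (i : ℕ) = pos e i d

theorem linkProgram_runs {L : DX D → ℕ} (hb : Balanced f L) (hD : ∀ i, (D i).Nonempty)
    (hn : 0 < n) (h : EncodesDomains code e s) (hf : EncodesFlow e f s)
    (h4 : s.var 4 = domSum D) (h9 : ∀ v, s.arr 9 (code v) = -1) :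
    Runs linkProgram s (100 * domSum D) (Linked e code f (domSum D)) := by
  have hm := le_domSum hD
  have h1 : Runs (.assign 6 (.const 0)) s 2 fun s' => s' = s.setVar 6 0 := Runs.of_sem trivial rfl
  refine Runs.mono (B₁ := 2 + (linkBody.cost + 20) * domSum D)
    (h1.seq (R := Linked e code f (domSum D)) ?_) ?_ fun _ _ h => h
  swap
  · simp [Program.cost, Exp.time, Test.time, linkBody]
    omega
  rintro _ hu rfl
  have := Runs.forLoop (x := 5) (y := 4) (c := linkBody) (s := s.setVar 6 0) (N := domSum D)
    (M := domSum D) ⟨trivial, ⟨⟨trivial, trivial, trivial⟩, trivial⟩, trivial, trivial⟩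
    (by decide) (by decide) (by decide) (by simpa using h4)
    -- Register `6` holds the variable that owns the current cell; after the last cell there is
    -- none, hence the condition on `q`. As domains are nonempty, one increment suffices to reach
    -- the next owner.
    (fun q s' => Linked e code f q s' ∧ (q < domSum D → ∃ i : Fin n, s'.var 6 = (i : ℕ) ∧
      start D i ≤ q ∧ q < start D (i + 1))) ?_ ?_ le_rfl (by omega)
  · exact this.mono le_rfl fun _ _ h => h.1
  · refine ⟨⟨fun v => ?_, by simp, by simp, by simp⟩, fun _ => ⟨⟨0, hn⟩, by simp, ?_, ?_⟩⟩
    · simp [h9, IsLastCell]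
    · simp [start_zero]
    · have := start_succ (D := D) ⟨0, hn⟩
      have := (hD ⟨0, hn⟩).card_pos
      simp only at *
      omega
  · rintro q hq s' hu' hq5 ⟨hL, hi⟩
    obtain ⟨i, hi6, hle, hlt⟩ := hi hq
    obtain ⟨d, rfl⟩ := exists_pos_of_le e hle hlt
    have e1 : s'.arr 1 (pos e i d) = code (toDX i d) := by
      rw [hu'.arr 1 (by decide)]; exact h.2.2 i d
    have e0 : s'.arr 0 ((i : ℕ) + 1) = start D (i + 1) := by
      rw [hu'.arr 0 (by decide)]; exact_mod_cast h.2.1 (i + 1) i.2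
    have e4 : s'.arr 4 (pos e i d) = 1 ↔ f (domArc i d) = 1 := by
      rw [hu'.arr 4 (by decide)]; exact_mod_cast hf.dom i d 1
    -- The effect of the body as updates of whole arrays; afterwards the program text is no longer
    -- needed.
    have hsem : ∀ s'', s'' = linkBody.sem s' →
        s''.arr 11 = Function.update (s'.arr 11) (pos e i d) (i : ℕ) ∧
        (f (domArc i d) = 1 →
          s''.arr 10 = Function.update (s'.arr 10) (pos e i d) (s'.arr 9 (code (toDX i d))) ∧
          s''.arr 9 = Function.update (s'.arr 9) (code (toDX i d)) (pos e i d) ∧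
          s''.arr 16 = Function.update (s'.arr 16) (i : ℕ) (pos e i d)) ∧
        (f (domArc i d) ≠ 1 → s''.arr 10 = s'.arr 10 ∧ s''.arr 9 = s'.arr 9 ∧
          s''.arr 16 = s'.arr 16) ∧
        s''.var 6 = if start D (i + 1) = pos e i d + 1 then ((i : ℕ) : ℤ) + 1 else (i : ℕ) := by
      rintro _ rfl
      by_cases hd : f (domArc i d) = 1
      · by_cases hs : start D (i + 1) = pos e i d + 1
        · have hs' : (start D (i + 1) : ℤ) = pos e i d + 1 := by exact_mod_cast hs
          refine ⟨?_, fun _ => ⟨?_, ?_, ?_⟩, fun h => absurd hd h, ?_⟩ <;> (try funext x) <;>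
            simp [linkBody, sem, Exp.eval, Test.eval, hq5, hi6, e1, e4, e0, hd, hs,
              Function.update_apply]
        · have hs' : ¬ (start D (i + 1) : ℤ) = pos e i d + 1 := by exact_mod_cast hs
          refine ⟨?_, fun _ => ⟨?_, ?_, ?_⟩, fun h => absurd hd h, ?_⟩ <;> (try funext x) <;>
            simp [linkBody, sem, Exp.eval, Test.eval, hq5, hi6, e1, e4, e0, hd, hs, hs',
              Function.update_apply]
      · by_cases hs : start D (i + 1) = pos e i d + 1
        · have hs' : (start D (i + 1) : ℤ) = pos e i d + 1 := by exact_mod_cast hs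
          refine ⟨?_, fun h => absurd h hd, fun _ => ⟨?_, ?_, ?_⟩, ?_⟩ <;> (try funext x) <;>
            simp [linkBody, sem, Exp.eval, Test.eval, hq5, hi6, e4, e0, hd, hs,
              Function.update_apply]
        · have hs' : ¬ (start D (i + 1) : ℤ) = pos e i d + 1 := by exact_mod_cast hs
          refine ⟨?_, fun h => absurd h hd, fun _ => ⟨?_, ?_, ?_⟩, ?_⟩ <;> (try funext x) <;>
            simp [linkBody, sem, Exp.eval, Test.eval, hq5, hi6, e4, e0, hd, hs, hs',
              Function.update_apply]
    obtain ⟨h11, hyes, hno, h6⟩ := hsem _ rfl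
    generalize linkBody.sem s' = s'' at *
    have huniq : ∀ i' d', pos e i' d' = pos e i d → i' = i ∧ HEq d' d := by
      intro i' d' hp
      have := var_eq_of_pos e hp
      subst this
      exact ⟨rfl, heq_of_eq (pos_inj e hp)⟩
    constructor
    · by_cases hd : f (domArc i d) = 1
      · obtain ⟨h10, h9, h16⟩ := hyes hd
        constructor
        · intro v
          rw [Store.setVar_arr, h9, Function.update_apply]
          split_ifs with hv
          · rw [code.injective hv]
            exact IsLastCell.self hd
          · refine (hL.head v).succ_of_ne fun i' d' hp hv' => ?_
            obtain ⟨rfl, hdd⟩ := huniq i' d' hp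
            rw [eq_of_heq hdd] at hv'
            exact absurd (congrArg code hv'.symm) hv
        · intro i' d' hp hd'
          rw [Store.setVar_arr, h10, Function.update_apply]
          rcases Nat.lt_succ_iff_lt_or_eq.1 hp with hlt' | heq
          · rw [if_neg (by exact_mod_cast hlt'.ne)]
            exact hL.next i' d' hlt' hd'
          · obtain ⟨rfl, hdd⟩ := huniq i' d' heq
            rw [eq_of_heq hdd, if_pos rfl]
            exact hL.head _
        · intro i' d' hp
          rw [Store.setVar_arr, h11, Function.update_apply]
          rcases Nat.lt_succ_iff_lt_or_eq.1 hp with hlt' | heq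
          · rw [if_neg (by exact_mod_cast hlt'.ne)]
            exact hL.owner i' d' hlt'
          · obtain ⟨rfl, hdd⟩ := huniq i' d' heq
            rw [eq_of_heq hdd, if_pos rfl]
        · intro i' d' hp hd'
          rw [Store.setVar_arr, h16, Function.update_apply]
          rcases Nat.lt_succ_iff_lt_or_eq.1 hp with hlt' | heq
          -- Overwriting the recorded cell of a variable does no harm, since a variable has at most
          -- one assigned cell.
          · split_ifs with hii
            · have : i' = i := Fin.ext (by exact_mod_cast hii)
              subst this
              rw [hb.assigned_unique hd hd']
            · exact hL.assigned i' d' hlt' hd'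
          · obtain ⟨rfl, hdd⟩ := huniq i' d' heq
            rw [eq_of_heq hdd, if_pos rfl]
      · obtain ⟨h10, h9, h16⟩ := hno hd
        have hlt' : ∀ i' d', pos e i' d' < pos e i d + 1 → f (domArc i' d') = 1 →
            pos e i' d' < pos e i d := by
          intro i' d' hp hd'
          rcases Nat.lt_succ_iff_lt_or_eq.1 hp with hlt' | heq
          · exact hlt'
          · obtain ⟨rfl, hdd⟩ := huniq i' d' heq
            rw [eq_of_heq hdd] at hd'
            exact absurd hd' hd
        constructor
        · intro v
          rw [Store.setVar_arr, h9]
          refine (hL.head v).succ_of_ne fun i' d' hp _ hd' => ?_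
          exact absurd (hlt' i' d' (by omega) hd') (by omega)
        · intro i' d' hp hd'
          rw [Store.setVar_arr, h10]
          exact hL.next i' d' (hlt' i' d' hp hd') hd'
        · intro i' d' hp
          rw [Store.setVar_arr, h11, Function.update_apply]
          rcases Nat.lt_succ_iff_lt_or_eq.1 hp with hlt' | heq
          · rw [if_neg (by exact_mod_cast hlt'.ne)]
            exact hL.owner i' d' hlt'
          · obtain ⟨rfl, hdd⟩ := huniq i' d' heq
            rw [eq_of_heq hdd, if_pos rfl]
        · intro i' d' hp hd'
          rw [Store.setVar_arr, h16]
          exact hL.assigned i' d' (hlt' i' d' hp hd') hd'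
    · intro hlt1
      simp only [Store.setVar_var, h6]
      rw [if_neg (by decide)]
      by_cases hs : start D (i + 1) = pos e i d + 1
      · rw [if_pos hs]
        have hi1 : (i : ℕ) + 1 < n := by
          by_contra hcon
          have : (i : ℕ) + 1 = n := by omega
          rw [this, start_last] at hs
          omega
        refine ⟨⟨i + 1, hi1⟩, by push_cast; rfl, hs.le, ?_⟩
        have := start_succ (D := D) ⟨i + 1, hi1⟩
        have := (hD ⟨i + 1, hi1⟩).card_pos
        simp only at *
        omega
      · rw [if_neg hs]
        exact ⟨i, rfl, by omega, by omega⟩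

/-- The queue in memory: its length in register `7`, its entries in array `15`. -/
structure IsQueue (ql : List (Fin n)) (s : Store) : Prop where
  nodup : ql.Nodup
  length : s.var 7 = ql.length
  entry : ∀ (k : ℕ) (hk : k < ql.length), s.arr 15 k = (ql[k] : ℕ)

theorem IsQueue.push {ql : List (Fin n)} {s s' : Store} (h : IsQueue ql s) {i : Fin n}
    (hi : i ∉ ql) (h7 : s'.var 7 = s.var 7 + 1)
    (h15 : s'.arr 15 = Function.update (s.arr 15) (s.var 7) (i : ℕ)) : IsQueue (ql ++ [i]) s' where
  nodup := by
    rw [List.nodup_append]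
    exact ⟨h.nodup, by simp, fun a ha b hb hab => hi (by simp_all)⟩
  length := by rw [h7, h.length]; simp
  entry k hk := by
    rw [List.length_append, List.length_singleton] at hk
    rw [h15, h.length, Function.update_apply]
    rcases Nat.lt_succ_iff_lt_or_eq.1 hk with hlt | rfl
    · rw [if_neg (by exact_mod_cast hlt.ne), h.entry k hlt, List.getElem_append_left hlt]
    · rw [if_pos rfl]
      simp

theorem IsQueue.congr {ql : List (Fin n)} {s s' : Store} (h : IsQueue ql s)
    (h7 : s'.var 7 = s.var 7) (h15 : s'.arr 15 = s.arr 15) : IsQueue ql s' :=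
  ⟨h.nodup, h7.trans h.length, fun k hk => by rw [h15, h.entry k hk]⟩

theorem enqueueProgram_runs (hD : ∀ i, (D i).Nonempty) (hn : 0 < n) (h : EncodesDomains code e s)
    (hf : EncodesFlow e f s) :
    Runs enqueueProgram s (100 * domSum D) fun s' => ∃ ql : List (Fin n), IsQueue ql s' ∧
      ∀ i, i ∈ ql ↔ f (srcArc i) = 0 := by
  have hm := le_domSum hD
  have h1 : Runs (.assign 7 (.const 0)) s 2 fun s' => s' = s.setVar 7 0 := Runs.of_sem trivial rfl
  refine Runs.mono (B₁ := 2 + (enqueueBody.cost + 20) * domSum D) (h1.seq (R := fun s' =>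
    ∃ ql : List (Fin n), IsQueue ql s' ∧ ∀ i, i ∈ ql ↔ f (srcArc i) = 0) ?_) ?_ fun _ _ h => h
  swap
  · simp [Program.cost, Exp.time, Test.time, enqueueBody]
    omega
  rintro _ hu rfl
  have := Runs.forLoop (x := 5) (y := 0) (c := enqueueBody) (s := s.setVar 7 0) (N := n)
    (M := domSum D) ⟨⟨trivial, trivial⟩, trivial⟩
    (by decide) (by decide) (by decide) (by simpa using h.1)
    (fun j s' => ∃ ql : List (Fin n), IsQueue ql s' ∧
      ∀ i : Fin n, i ∈ ql ↔ (i : ℕ) < j ∧ f (srcArc i) = 0) ?_ ?_ hm (by omega)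
  · refine this.mono le_rfl fun _ _ h => ?_
    obtain ⟨ql, hq, hmem⟩ := h
    exact ⟨ql, hq, fun i => by simp [hmem]⟩
  · exact ⟨[], ⟨by simp, by simp, by simp⟩, by simp⟩
  · rintro j hj s' hu' hj5 ⟨ql, hq, hmem⟩
    have e3 : s'.arr 3 j = 0 ↔ f (srcArc ⟨j, hj⟩) = 0 := by
      rw [hu'.arr 3 (by decide)]; exact_mod_cast hf.src ⟨j, hj⟩ 0
    by_cases h0 : f (srcArc ⟨j, hj⟩) = 0
    · refine ⟨ql ++ [⟨j, hj⟩], hq.push (by simp [hmem]) ?_ ?_, fun i => ?_⟩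
      · simp [enqueueBody, sem, Test.eval, Exp.eval, hj5, e3, h0]
      · funext x
        simp [enqueueBody, sem, Test.eval, Exp.eval, hj5, e3, h0, Function.update_apply]
      · rw [List.mem_append, hmem, List.mem_singleton, Fin.ext_iff]
        constructor
        · rintro (⟨hi, hi'⟩ | hi)
          · exact ⟨by omega, hi'⟩
          · have : i = ⟨j, hj⟩ := Fin.ext hi
            subst this
            exact ⟨by simp, h0⟩
        · rintro ⟨hi, hi'⟩
          rcases Nat.lt_succ_iff_lt_or_eq.1 hi with hlt | heq
          · exact Or.inl ⟨hlt, hi'⟩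
          · exact Or.inr heq
    · refine ⟨ql, hq.congr ?_ ?_, fun i => ?_⟩
      · simp [enqueueBody, sem, Test.eval, Exp.eval, hj5, e3, h0]
      · simp [enqueueBody, sem, Test.eval, Exp.eval, hj5, e3, h0]
      · rw [hmem]
        refine ⟨fun h => ⟨by omega, h.2⟩, fun ⟨hi, hi'⟩ => ⟨?_, hi'⟩⟩
        rcases Nat.lt_succ_iff_lt_or_eq.1 hi with hlt | heq
        · exact hlt
        · have : i = ⟨j, hj⟩ := Fin.ext heq
          subst this
          exact absurd hi' h0

end Preparation

open Program

/-! ## The search -/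

/-- Append the variable of the assigned cell in register `10` to the queue, and go to the next
assigned cell of the same value. -/
def pushBody : Program :=
  .seq (.store 15 (.var 7) (.arr 11 (.var 10)))
    (.seq (.assign 7 (.add (.var 7) (.const 1))) (.assign 10 (.arr 10 (.var 10))))

/-- Mark the value of the cell in register `8` as visited: the cell goes to array `14`, the depth to
array `13`, and the assigned cells of the value will be gone through. -/
def visitBody : Program :=
  .seq (.store 14 (.arr 1 (.var 8)) (.var 8))
    (.seq (.ite (.eq (.arr 3 (.arr 11 (.var 8))) (.const 0))
        (.store 13 (.arr 1 (.var 8)) (.const 0))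
        (.store 13 (.arr 1 (.var 8))
          (.add (.arr 13 (.arr 1 (.arr 16 (.arr 11 (.var 8))))) (.const 1))))
      (.assign 10 (.arr 9 (.arr 1 (.var 8)))))

/-- Go on to the next cell of the current variable. -/
def scanBody : Program :=
  .seq (.ite (.le (.const 0) (.arr 14 (.arr 1 (.var 8)))) .skip visitBody)
    (.assign 8 (.add (.var 8) (.const 1)))

/-- Take the next variable from the queue. -/
def popBody : Program :=
  .seq (.assign 8 (.arr 0 (.arr 15 (.var 6))))
    (.seq (.assign 9 (.arr 0 (.add (.arr 15 (.var 6)) (.const 1))))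
      (.assign 6 (.add (.var 6) (.const 1))))

def searchBody : Program :=
  .ite (.le (.const 0) (.var 10)) pushBody (.ite (.le (.var 9) (.var 8)) popBody scanBody)

def searchInit : Program :=
  .seq (.assign 6 (.const 0)) (.seq (.assign 8 (.const 0))
    (.seq (.assign 9 (.const 0)) (.assign 10 (.const (-1)))))

def searchLoop : Program :=
  .loop (.not (.and (.not (.le (.const 0) (.var 10))) (.and (.le (.var 9) (.var 8))
    (.le (.var 7) (.var 6))))) searchBody

def searchProgram : Program := .seq searchInit searchLoop

section Search

variable {α : Type*} [DecidableEq α] {n : ℕ} {D : Fin n → Finset α}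
variable {e : ∀ i, Fin (D i).card ≃ D i} {code : DX D ↪ ℤ} {s : Store} {f : Arc D → ℝ}

def Visited (code : DX D ↪ ℤ) (s : Store) (v : DX D) : Prop := 0 ≤ s.arr 14 (code v)

/-- A visited value has a parent cell of a variable that is unassigned or whose value is visited,
with the depth increased by one. -/
def HasParent (e : ∀ i, Fin (D i).card ≃ D i) (code : DX D ↪ ℤ) (f : Arc D → ℝ) (s : Store)
    (B : ℕ) (v : DX D) : Prop :=
  ∃ i, ∃ d : D i, ∃ l : ℕ, toDX i d = v ∧ s.arr 14 (code v) = pos e i d ∧ s.arr 13 (code v) = l ∧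
    l ≤ B ∧ ((f (srcArc i) = 0 ∧ l = 0) ∨ ∃ d', f (domArc i d') = 1 ∧ Visited code s (toDX i d') ∧
      s.arr 13 (code (toDX i d')) + 1 = l)

/-- The labels of visited values are never changed later, so parents and depths persist. -/
theorem HasParent.mono {s s' : Store} {B B' : ℕ} {v : DX D} (h : HasParent e code f s B v)
    (hB : B ≤ B') (h14 : ∀ w, Visited code s w → s'.arr 14 (code w) = s.arr 14 (code w))
    (h13 : ∀ w, Visited code s w → s'.arr 13 (code w) = s.arr 13 (code w)) (hv : Visited code s v) :
    HasParent e code f s' B' v := by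
  obtain ⟨i, d, l, h1, h2, h3, h4, h5⟩ := h
  refine ⟨i, d, l, h1, (h14 v hv).trans h2, (h13 v hv).trans h3, h4.trans hB, h5.imp id ?_⟩
  rintro ⟨d', h6, h7, h8⟩
  refine ⟨d', h6, ?_, by rw [h13 _ h7, h8]⟩
  rw [Visited, h14 _ h7]
  exact h7

/-- The assigned cell `(i, d)` is still to be gone through in the list of its value. -/
def Pending (e : ∀ i, Fin (D i).card ≃ D i) (code : DX D ↪ ℤ) (s : Store) (i : Fin n) (d : D i) :
    Prop :=
  (pos e i d : ℤ) ≤ s.var 10 ∧ s.arr 1 (s.var 10) = code (toDX i d)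

/-- The invariant of the search: `ql` is the queue, of which the first `h` variables have been taken;
the cells from `qc` to `qe` of the last one are still to be scanned. -/
structure Search (e : ∀ i, Fin (D i).card ≃ D i) (code : DX D ↪ ℤ) (f : Arc D → ℝ) (K : ℕ)
    (s : Store) (ql : List (Fin n)) (h qc qe k : ℕ) : Prop where
  queue : IsQueue ql s
  reg6 : s.var 6 = h
  reg8 : s.var 8 = qc
  reg9 : s.var 9 = qe
  le_length : h ≤ ql.length
  list : s.var 10 = -1 ∨ ∃ i d, f (domArc i d) = 1 ∧ s.var 10 = pos e i d ∧
    Visited code s (toDX i d)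
  mem : ∀ i, i ∈ ql ↔ f (srcArc i) = 0 ∨ ∃ d, f (domArc i d) = 1 ∧ Visited code s (toDX i d) ∧
    ¬ Pending e code s i d
  cells : qc < qe → ∃ i ∈ ql.take h, start D i ≤ qc ∧ qe = start D (i + 1)
  done : ∀ i ∈ ql.take h, ∀ d, Visited code s (toDX i d) ∨ (qc ≤ pos e i d ∧ pos e i d < qe)
  -- Depths are bounded by the budget already spent, which will bound the length of the path that is
  -- written.
  tree : ∀ v, Visited code s v → HasParent e code f s (K - k) v
  le_bound : k ≤ K
  -- The budget pays 1 for each variable not yet enqueued, 1 for each cell left of the current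
  -- variable, and for each variable not yet taken its cells and 1 for taking it.
  measure : (n - ql.length) + (qe - qc) +
    ∑ i ∈ Finset.univ.filter (fun i => i ∉ ql.take h), ((D i).card + 1) ≤ k

namespace Search

variable {L : DX D → ℕ} {K : ℕ} {ql : List (Fin n)} {h qc qe k : ℕ}

/-- The owner of the current list cell is assigned and its cell is pending, so it is not yet in the
queue. Enqueuing it and following the link removes exactly this cell from the pending ones. -/
theorem push (hb : Balanced f L) (hd : EncodesDomains code e s)
    (hl : Linked e code f (domSum D) s) (hS : Search e code f K s ql h qc qe k)
    (hp : 0 ≤ s.var 10) :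
    ∃ ql', ∃ k' < k, Search e code f K (pushBody.sem s) ql' h qc qe k' := by
  obtain hp' | ⟨i, d, hf1, hp', hvis⟩ := hS.list
  · omega
  have hlt := pos_lt_domSum e i d
  have hnext := hl.next i d hlt hf1
  have e1 : s.arr 1 (pos e i d) = code (toDX i d) := hd.2.2 i d
  have hi : i ∉ ql := by
    rw [hS.mem]
    rintro (h0 | ⟨d', hf', -, hpe⟩)
    · rw [← hb.sum_var i, Finset.sum_eq_zero_iff_of_nonneg fun d _ => hb.flow.1 _] at h0
      rw [h0 d (Finset.mem_univ _)] at hf1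
      exact zero_ne_one hf1
    · rw [hb.assigned_unique hf' hf1] at hpe
      exact hpe ⟨hp'.ge, by rw [hp', e1]⟩
  have h7 : (pushBody.sem s).var 7 = s.var 7 + 1 := by simp [pushBody, sem, Exp.eval]
  have h10 : (pushBody.sem s).var 10 = s.arr 10 (pos e i d) := by
    simp [pushBody, sem, Exp.eval, hp']
  have h15 : (pushBody.sem s).arr 15 = Function.update (s.arr 15) (s.var 7) (i : ℕ) := by
    funext x
    simp [pushBody, sem, Exp.eval, hp', hl.owner i d hlt, Function.update_apply]
  obtain ⟨T, hex, -⟩ := exec_sem (c := pushBody) ⟨trivial, trivial, trivial⟩ s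
  have hu := hex.unchanged
  clear hex
  generalize pushBody.sem s = s' at *
  have hvv : ∀ v, Visited code s' v ↔ Visited code s v := fun v => by
    rw [Visited, hu.arr 14 (by decide)]; rfl
  have hq := hS.queue.push hi h7 h15
  have hlen : ql.length + 1 ≤ n := by
    have := hq.nodup.length_le_card
    simpa using this
  have hk := hS.measure
  have htake : (ql ++ [i]).take h = ql.take h := List.take_append_of_le_length hS.le_length
  -- The link leads to the preceding assigned cell of the same value, so no other assigned cell of
  -- that value is skipped.
  have hpend : ∀ j d', f (domArc j d') = 1 → j ≠ i →
      (Pending e code s' j d' ↔ Pending e code s j d') := by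
    intro j d' hf' hji
    rw [Pending, Pending, h10, hu.arr 1 (by decide), hp', e1]
    have hne : pos e j d' ≠ pos e i d := fun h => hji (var_eq_of_pos e h)
    constructor
    · rintro ⟨h1, h2⟩
      rcases hnext.2 with hx | ⟨i₂, d₂, hv₂, -, hx, hlt₂⟩
      · omega
      · rw [hx, hd.2.2, hv₂] at h2
        exact ⟨by omega, h2⟩
    · rintro ⟨h1, h2⟩
      have h3 := hnext.1 j d' (code.injective h2.symm) hf' (by omega)
      refine ⟨h3, ?_⟩
      rcases hnext.2 with hx | ⟨i₂, d₂, hv₂, -, hx, hlt₂⟩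
      · omega
      · rw [hx, hd.2.2, hv₂, h2]
  refine ⟨ql ++ [i], k - 1, by omega, hq, (hu.var 6 (by decide)).trans hS.reg6,
    (hu.var 8 (by decide)).trans hS.reg8, (hu.var 9 (by decide)).trans hS.reg9, ?_, ?_, ?_, ?_, ?_,
    ?_, ?_, ?_⟩
  · have := hS.le_length
    rw [List.length_append]
    omega
  · rw [h10]
    rcases hnext.2 with hx | ⟨i₂, d₂, hv₂, hf₂, hx, -⟩
    · exact Or.inl hx
    · exact Or.inr ⟨i₂, d₂, hf₂, hx, by rw [hvv, hv₂]; exact hvis⟩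
  · intro j
    rw [List.mem_append, List.mem_singleton, hS.mem]
    by_cases hji : j = i
    · subst hji
      refine ⟨fun _ => Or.inr ⟨d, hf1, (hvv _).2 hvis, ?_⟩, fun _ => Or.inr rfl⟩
      rw [Pending, h10]
      rintro ⟨h1, -⟩
      rcases hnext.2 with hx | ⟨i₂, d₂, -, -, hx, hlt₂⟩ <;> omega
    · simp only [hji, or_false]
      refine or_congr Iff.rfl (exists_congr fun d' => and_congr_right fun hf' => ?_)
      rw [hvv, hpend j d' hf' hji]
  · intro hlt'
    rw [htake]
    exact hS.cells hlt'
  · intro j hj d'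
    rw [htake] at hj
    rw [hvv]
    exact hS.done j hj d'
  · intro v hv
    rw [hvv] at hv
    exact (hS.tree v hv).mono (by omega) (fun w _ => by rw [hu.arr 14 (by decide)])
      (fun w _ => by rw [hu.arr 13 (by decide)]) hv
  · have := hS.le_bound
    omega
  · rw [htake, List.length_append, List.length_singleton]
    omega

theorem pop (hd : EncodesDomains code e s)
    (hS : Search e code f K s ql h qc qe k) (hq : qe ≤ qc)
    (hh : h < ql.length) :
    ∃ h' qc' qe', ∃ k' < k, Search e code f K (popBody.sem s) ql h' qc' qe' k' := by
  have h15 := hS.queue.entry h hh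
  set i := ql[h] with hi
  have e0 : s.arr 0 (i : ℕ) = start D i := hd.2.1 i i.2.le
  have e0' : s.arr 0 ((i : ℕ) + 1) = start D (i + 1) := by exact_mod_cast hd.2.1 (i + 1) i.2
  have h6 : (popBody.sem s).var 6 = (h + 1 : ℕ) := by simp [popBody, sem, Exp.eval, hS.reg6]
  have h8 : (popBody.sem s).var 8 = start D i := by
    simp [popBody, sem, Exp.eval, hS.reg6, h15, e0]
  have h9 : (popBody.sem s).var 9 = start D (i + 1) := by
    simp [popBody, sem, Exp.eval, hS.reg6, h15, e0']
  obtain ⟨T, hex, -⟩ := exec_sem (c := popBody) ⟨trivial, trivial, trivial⟩ s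
  have hu := hex.unchanged
  clear hex
  generalize popBody.sem s = s' at *
  have hvv : ∀ v, Visited code s' v ↔ Visited code s v := fun v => by
    rw [Visited, hu.arr 14 (by decide)]; rfl
  have hpp : ∀ j d, Pending e code s' j d ↔ Pending e code s j d := fun j d => by
    rw [Pending, hu.var 10 (by decide), hu.arr 1 (by decide)]; rfl
  have htake : ql.take (h + 1) = ql.take h ++ [i] := by simp [hi]
  have hnot : i ∉ ql.take h := by
    have := hS.queue.nodup.sublist (List.take_sublist (h + 1) ql)
    rw [htake, List.nodup_append] at this
    exact fun hm => this.2.2 i hm i (by simp) rfl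
  -- The variable taken leaves the sum with `(D i).card + 1`, of which `(D i).card` reappears as
  -- cells to scan; the budget drops by 1.
  have hsum : ∑ j ∈ Finset.univ.filter (fun j => j ∉ ql.take h), ((D j).card + 1) =
      ((D i).card + 1) + ∑ j ∈ Finset.univ.filter (fun j => j ∉ ql.take (h + 1)),
        ((D j).card + 1) := by
    refine Eq.trans ?_ (Finset.sum_insert (a := i) (f := fun j => (D j).card + 1)
      (s := Finset.univ.filter (fun j => j ∉ ql.take (h + 1))) (by simp [htake]))
    refine Finset.sum_congr ?_ fun _ _ => rfl
    ext j
    simp only [Finset.mem_filter, Finset.mem_univ, true_and, Finset.mem_insert, htake,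
      List.mem_append, List.mem_singleton, not_or]
    constructor
    · intro hj
      by_cases hji : j = i
      · exact Or.inl hji
      · exact Or.inr ⟨hj, hji⟩
    · rintro (rfl | hj)
      · exact hnot
      · exact hj.1
  have hk := hS.measure
  have hst := start_succ (D := D) i
  refine ⟨h + 1, start D i, start D (i + 1), k - 1, by omega,
    hS.queue.congr (hu.var 7 (by decide)) (hu.arr 15 (by decide)), h6, h8, h9, hh, ?_, ?_, ?_, ?_,
    ?_, ?_, ?_⟩
  · rw [hu.var 10 (by decide)]
    exact hS.list.imp id fun ⟨i, d, h1, h2, h3⟩ => ⟨i, d, h1, h2, (hvv _).2 h3⟩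
  · intro j
    rw [hS.mem]
    simp only [hvv, hpp]
  · exact fun _ => ⟨i, by simp [htake], le_rfl, rfl⟩
  · intro j hj d
    rw [htake, List.mem_append, List.mem_singleton] at hj
    rw [hvv]
    rcases hj with hj | rfl
    · exact Or.inl ((hS.done j hj d).resolve_right fun h => by omega)
    · exact Or.inr ⟨start_le_pos e _ d, pos_lt e _ d⟩
  · intro v hv
    rw [hvv] at hv
    exact (hS.tree v hv).mono (by omega) (fun w _ => by rw [hu.arr 14 (by decide)])
      (fun w _ => by rw [hu.arr 13 (by decide)]) hv
  · have := hS.le_bound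
    omega
  · omega

/-- When a value is newly visited, all its assigned cells become pending at once, so the description
of the queue stays true although the queue does not change. -/
theorem scan (hd : EncodesDomains code e s) (hf : EncodesFlow e f s) (hb : Balanced f L)
    (hl : Linked e code f (domSum D) s) (hS : Search e code f K s ql h qc qe k)
    (hp : ¬ 0 ≤ s.var 10) (hq : qc < qe) :
    ∃ k' < k, Search e code f K (scanBody.sem s) ql h (qc + 1) qe k' := by
  obtain ⟨i, hi, hle, rfl⟩ := hS.cells hq
  obtain ⟨d, rfl⟩ := exists_pos_of_le e hle hq
  have hlt := pos_lt_domSum e i d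
  have e1 : s.arr 1 (pos e i d) = code (toDX i d) := hd.2.2 i d
  have h10 : s.var 10 = -1 := hS.list.resolve_right fun ⟨_, _, _, h, _⟩ => hp (by omega)
  have hk := hS.measure
  have hkb := hS.le_bound
  by_cases hvis : Visited code s (toDX i d)
  · have hvis' : 0 ≤ s.arr 14 (code (toDX i d)) := hvis
    have hs' : scanBody.sem s = s.setVar 8 (pos e i d + 1) := by
      simp [scanBody, sem, Exp.eval, Test.eval, hS.reg8, e1, hvis']
    rw [hs']
    refine ⟨k - 1, by omega, hS.queue.congr (by simp) (by simp), by simpa using hS.reg6, by simp,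
      by simpa using hS.reg9, hS.le_length, by
      rw [Store.setVar_var, if_neg (by decide)]; exact hS.list, hS.mem, ?_, ?_, ?_, by omega,
      by omega⟩
    · exact fun _ => ⟨i, hi, by omega, rfl⟩
    · intro j hj d'
      rcases hS.done j hj d' with h1 | h1
      · exact Or.inl h1
      · by_cases hpos : pos e j d' = pos e i d
        · have := var_eq_of_pos e hpos
          subst this
          rw [pos_inj e hpos]
          exact Or.inl hvis
        · exact Or.inr ⟨by omega, h1.2⟩
    · intro v hv
      exact (hS.tree v hv).mono (by omega) (fun w _ => rfl) (fun w _ => rfl) hv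
  · have hvis' : ¬ 0 ≤ s.arr 14 (code (toDX i d)) := hvis
    set v := toDX i d with hv
    have e3 : s.arr 3 (i : ℕ) = 0 ↔ f (srcArc i) = 0 := by exact_mod_cast hf.src i 0
    have h8 : (scanBody.sem s).var 8 = (pos e i d + 1 : ℕ) := by
      by_cases h0 : f (srcArc i) = 0 <;>
        simp [scanBody, visitBody, sem, Exp.eval, Test.eval, hS.reg8, e1, hvis', e3, h0,
          hl.owner i d hlt]
    have h10' : (scanBody.sem s).var 10 = s.arr 9 (code v) := by
      by_cases h0 : f (srcArc i) = 0 <;>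
        simp [scanBody, visitBody, sem, Exp.eval, Test.eval, hS.reg8, e1, hvis', e3, h0,
          hl.owner i d hlt]
    have h14 : (scanBody.sem s).arr 14 = Function.update (s.arr 14) (code v) (pos e i d) := by
      funext x
      by_cases h0 : f (srcArc i) = 0 <;>
        simp [scanBody, visitBody, sem, Exp.eval, Test.eval, hS.reg8, e1, hvis', e3, h0,
          hl.owner i d hlt, Function.update_apply]
    -- The scanned variable is in the queue, so it is unassigned (depth 0) or its value is visited
    -- (one more than that depth). One unit of budget pays for the increase.
    have h13 : ∃ l : ℕ, (scanBody.sem s).arr 13 = Function.update (s.arr 13) (code v) l ∧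
        l ≤ K - (k - 1) ∧ ((f (srcArc i) = 0 ∧ l = 0) ∨ ∃ d', f (domArc i d') = 1 ∧
          Visited code s (toDX i d') ∧ s.arr 13 (code (toDX i d')) + 1 = l) := by
      rcases (hS.mem i).1 (List.mem_of_mem_take hi) with h0 | ⟨d', hf', hv', -⟩
      · refine ⟨0, ?_, by omega, Or.inl ⟨h0, rfl⟩⟩
        funext x
        simp [scanBody, visitBody, sem, Exp.eval, Test.eval, hS.reg8, e1, hvis', e3, h0,
          hl.owner i d hlt, Function.update_apply]
      · have h0 : f (srcArc i) ≠ 0 := by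
          intro h0
          rw [← hb.sum_var i, Finset.sum_eq_zero_iff_of_nonneg fun d _ => hb.flow.1 _] at h0
          rw [h0 d' (Finset.mem_univ _)] at hf'
          exact zero_ne_one hf'
        obtain ⟨_, _, l, -, -, hl', hl'', -⟩ := hS.tree _ hv'
        refine ⟨l + 1, ?_, by omega, Or.inr ⟨d', hf', hv', by rw [hl']; push_cast; rfl⟩⟩
        funext x
        simp [scanBody, visitBody, sem, Exp.eval, Test.eval, hS.reg8, e1, hvis', e3, h0,
          hl.owner i d hlt, Function.update_apply, hl.assigned i d' (pos_lt_domSum e i d') hf',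
          hd.2.2 i d', hl']
    obtain ⟨l, h13, hlb, hpar⟩ := h13
    obtain ⟨T, hex, -⟩ := exec_sem (c := scanBody)
      ⟨⟨trivial, trivial, ⟨trivial, trivial⟩, trivial⟩, trivial⟩ s
    have hu := hex.unchanged
    clear hex
    generalize scanBody.sem s = s' at *
    have hne : ∀ w, Visited code s w → code w ≠ code v := fun w hw h =>
      hvis (code.injective h ▸ hw)
    have h14' : ∀ w, Visited code s w → s'.arr 14 (code w) = s.arr 14 (code w) := fun w hw => by
      rw [h14, Function.update_of_ne (hne w hw)]
    have h13' : ∀ w, Visited code s w → s'.arr 13 (code w) = s.arr 13 (code w) := fun w hw => by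
      rw [h13, Function.update_of_ne (hne w hw)]
    have hvv : ∀ w, Visited code s' w ↔ w = v ∨ Visited code s w := fun w => by
      by_cases hw : w = v
      · simp [hw, Visited, h14]
      · rw [Visited, h14, Function.update_of_ne (code.injective.ne hw)]
        simp [hw, Visited]
    have hlast := hl.head v
    have hk1 : k - 1 < k := by clear hpar; omega
    have hk2 : (n - ql.length) + (start D (i + 1) - (pos e i d + 1)) +
        ∑ i ∈ Finset.univ.filter (fun i => i ∉ ql.take h), ((D i).card + 1) ≤ k - 1 := by
      clear hpar; omega
    refine ⟨k - 1, hk1, hS.queue.congr (hu.var 7 (by decide)) (hu.arr 15 (by decide)),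
      (hu.var 6 (by decide)).trans hS.reg6, h8, (hu.var 9 (by decide)).trans hS.reg9, hS.le_length,
      ?_, ?_, ?_, ?_, ?_, hk1.le.trans hkb, hk2⟩
    · rw [h10']
      exact hlast.2.imp id fun ⟨i₂, d₂, hv₂, hf₂, hx, _⟩ =>
        ⟨i₂, d₂, hf₂, hx, (hvv _).2 (Or.inl hv₂)⟩
    · intro j
      rw [hS.mem]
      refine or_congr Iff.rfl (exists_congr fun d' => and_congr_right fun hf' => ?_)
      rw [hvv]
      have hp1 : ¬ Pending e code s j d' := by
        rw [Pending, h10]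
        rintro ⟨h1, -⟩
        omega
      by_cases hw : toDX j d' = v
      · have hp2 : Pending e code s' j d' := by
          have hle' := hlast.1 j d' hw hf' (pos_lt_domSum e j d')
          rw [Pending, h10', hu.arr 1 (by decide)]
          refine ⟨hle', ?_⟩
          rcases hlast.2 with hx | ⟨i₂, d₂, hv₂, -, hx, -⟩
          · omega
          · rw [hx, hd.2.2, hv₂, hw]
        simp only [hp2, not_true_eq_false, and_false, iff_false, not_and]
        rw [hw]
        exact fun h => absurd h hvis
      · have hp2 : ¬ Pending e code s' j d' := by
          rw [Pending, h10', hu.arr 1 (by decide)]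
          rintro ⟨h1, h2⟩
          rcases hlast.2 with hx | ⟨i₂, d₂, hv₂, -, hx, -⟩
          · omega
          · rw [hx, hd.2.2, hv₂] at h2
            exact hw (code.injective h2).symm
        simp [hp1, hp2, hw]
    · exact fun _ => ⟨i, hi, by omega, rfl⟩
    · intro j hj d'
      rw [hvv]
      rcases hS.done j hj d' with h1 | h1
      · exact Or.inl (Or.inr h1)
      · by_cases hpos : pos e j d' = pos e i d
        · have := var_eq_of_pos e hpos
          subst this
          rw [pos_inj e hpos]
          exact Or.inl (Or.inl rfl)
        · exact Or.inr ⟨by omega, h1.2⟩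
    · intro w hw
      rcases (hvv w).1 hw with rfl | hw
      · refine ⟨i, d, l, rfl, by rw [h14, Function.update_self], by rw [h13, Function.update_self],
          hlb, hpar.imp id ?_⟩
        rintro ⟨d', hf', hv', hl'⟩
        exact ⟨d', hf', (hvv _).2 (Or.inr hv'), by rw [h13' _ hv', hl']⟩
      · exact (hS.tree w hw).mono (by omega) h14' h13' hw

end Search

/-- The result of the search. -/
structure Explored (e : ∀ i, Fin (D i).card ≃ D i) (code : DX D ↪ ℤ) (f : Arc D → ℝ)
    (s : Store) : Prop where
  closed : ∀ i, (f (srcArc i) = 0 ∨ ∃ d, f (domArc i d) = 1 ∧ Visited code s (toDX i d)) →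
    ∀ d, Visited code s (toDX i d)
  tree : ∀ v, Visited code s v → HasParent e code f s (3 * domSum D) v

theorem searchProgram_runs {L : DX D → ℕ} (hD : ∀ i, (D i).Nonempty) (hn : 0 < n)
    (hb : Balanced f L) (hd : EncodesDomains code e s) (hf : EncodesFlow e f s)
    (hl : Linked e code f (domSum D) s) (h14 : ∀ v, s.arr 14 (code v) = -1)
    (hq : ∃ ql : List (Fin n), IsQueue ql s ∧ ∀ i, i ∈ ql ↔ f (srcArc i) = 0) :
    Runs searchProgram s (1000 * domSum D) (Explored e code f) := by
  have hm := le_domSum hD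
  obtain ⟨ql, hql, hmem⟩ := hq
  have hnv : ∀ s', s'.arr 14 = s.arr 14 → ∀ v, ¬ Visited code s' v := by
    intro s' h' v
    rw [Visited, h', h14]
    decide
  have h1 : Runs searchInit s searchInit.cost
      fun s' => Search e code f (3 * domSum D) s' ql 0 0 0 (3 * domSum D) := by
    refine Runs.of_sem ⟨trivial, trivial, trivial, trivial⟩ ⟨hql.congr ?_ ?_, ?_, ?_, ?_, ?_, ?_, ?_,
      ?_, ?_, ?_, le_rfl, ?_⟩
    · simp [searchInit, sem]
    · simp [searchInit, sem]
    · simp [searchInit, sem, Exp.eval]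
    · simp [searchInit, sem, Exp.eval]
    · simp [searchInit, sem, Exp.eval]
    · exact Nat.zero_le _
    · left; simp [searchInit, sem, Exp.eval]
    · intro i
      rw [hmem]
      refine ⟨Or.inl, fun h => h.resolve_right ?_⟩
      rintro ⟨d, -, hv, -⟩
      exact hnv _ (by simp [searchInit, sem]) _ hv
    · simp
    · simp
    · exact fun v hv => absurd hv (hnv _ (by simp [searchInit, sem]) v)
    -- The initial budget is at most `n + (m + n)`, hence at most `3m`.
    · have : ∑ i : Fin n, ((D i).card + 1) = domSum D + n := by
        simp [Finset.sum_add_distrib, domSum]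
      simp [this]
      omega
  have h2 : Runs searchProgram s (searchInit.cost +
      ((13 + searchBody.cost + 1) * (3 * domSum D) + (13 + 1))) (Explored e code f) := by
    refine h1.seq fun s₁ hu₁ hS₁ => ?_
    have := Runs.loop (c := searchBody) (s := s₁) (B := searchBody.cost)
      (b := .not (.and (.not (.le (.const 0) (.var 10))) (.and (.le (.var 9) (.var 8))
        (.le (.var 7) (.var 6)))))
      (fun k s' => ∃ ql h qc qe, Search e code f (3 * domSum D) s' ql h qc qe k) ?_
      (k := 3 * domSum D) ⟨_, _, _, _, hS₁⟩
    · refine this.mono (by simp [Test.time, Exp.time]) fun s' hu' ⟨⟨k, ql, h, qc, qe, hS⟩, hne⟩ => ?_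
      simp only [Test.eval, Exp.eval, not_not, hS.reg8, hS.reg9, hS.reg6, hS.queue.length] at hne
      obtain ⟨hp, hqe, hlen⟩ := hne
      -- At the exit nothing is pending, so every unassigned variable and every variable whose
      -- assigned value is visited is in the queue; all have been taken and no cells are left to
      -- scan.
      have htake : ql.take h = ql := List.take_of_length_le (by exact_mod_cast hlen)
      have h10 : s'.var 10 = -1 := hS.list.resolve_right fun ⟨_, _, _, h, _⟩ => hp (by omega)
      constructor
      · intro i hi d
        have hiq : i ∈ ql := by
          rw [hS.mem]
          refine hi.imp id fun ⟨d, h1, h2⟩ => ⟨d, h1, h2, ?_⟩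
          rw [Pending, h10]
          rintro ⟨h1, -⟩
          omega
        exact (hS.done i (htake.symm ▸ hiq) d).resolve_right fun h => by omega
      · exact fun v hv => (hS.tree v hv).mono (by omega) (fun _ _ => rfl) (fun _ _ => rfl) hv
    · rintro k s' hu' ⟨ql, h, qc, qe, hS⟩ hb'
      have hu : Unchanged searchProgram s s' :=
        (hu₁.mono (by simp [searchProgram, varsWritten])
          (by simp [searchProgram, arrsWritten])).trans
        (hu'.mono (by simp [searchProgram, searchLoop, varsWritten])
          (by simp [searchProgram, searchLoop, arrsWritten]))
      have hd' : EncodesDomains code e s' :=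
        hd.congr (hu.var 0 (by decide)) (hu.arr 0 (by decide)) (hu.arr 1 (by decide))
      have hf' : EncodesFlow e f s' :=
        hf.congr (hu.arr 3 (by decide)) (hu.arr 4 (by decide)) (hu.arr 5 (by decide))
      have hl' : Linked e code f (domSum D) s' := by
        refine ⟨?_, ?_, ?_, ?_⟩
        · rw [hu.arr 9 (by decide)]; exact hl.head
        · rw [hu.arr 10 (by decide)]; exact hl.next
        · rw [hu.arr 11 (by decide)]; exact hl.owner
        · rw [hu.arr 16 (by decide)]; exact hl.assigned
      refine Runs.of_sem (Q := fun s'' => ∃ k' < k, ∃ ql h qc qe,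
        Search e code f (3 * domSum D) s'' ql h qc qe k') ⟨⟨trivial, trivial, trivial⟩,
        ⟨trivial, trivial, trivial⟩, ⟨trivial, trivial, ⟨trivial, trivial⟩, trivial⟩, trivial⟩ ?_
      by_cases hp : 0 ≤ s'.var 10
      · have : searchBody.sem s' = pushBody.sem s' := by
          simp [searchBody, sem, Test.eval, Exp.eval, hp]
        rw [this]
        obtain ⟨ql', k', hk', h'⟩ := hS.push hb hd' hl' hp
        exact ⟨k', hk', _, _, _, _, h'⟩
      · by_cases hq : qe ≤ qc
        · have : searchBody.sem s' = popBody.sem s' := by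
            simp [searchBody, sem, Test.eval, Exp.eval, hp, hS.reg8, hS.reg9, hq]
          rw [this]
          have hh : h < ql.length := by
            by_contra hcon
            apply hb'
            simp only [Test.eval, Exp.eval, hS.reg8, hS.reg9, hS.reg6, hS.queue.length]
            exact ⟨hp, by exact_mod_cast hq, by exact_mod_cast not_lt.1 hcon⟩
          obtain ⟨h', qc', qe', k', hk', hS'⟩ := hS.pop hd' hq hh
          exact ⟨k', hk', _, _, _, _, hS'⟩
        · have : searchBody.sem s' = scanBody.sem s' := by
            simp [searchBody, sem, Test.eval, Exp.eval, hp, hS.reg8, hS.reg9, hq]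
          rw [this]
          obtain ⟨k', hk', h'⟩ := hS.scan hd' hf' hb hl' hp (not_le.1 hq)
          exact ⟨k', hk', _, _, _, _, h'⟩
  refine h2.mono ?_ fun _ _ h => h
  simp [Program.cost, Exp.time, Test.time, searchInit, searchBody, pushBody, popBody, scanBody,
    visitBody]
  omega

end Search

open Program

/-! ## Choosing the end of the path, and writing the path -/

/-- Keep the cell of the cheapest unused arc `(d, t)_k` from a visited value seen so far in register
`12`, and its cost in register `13`. -/
def selectBody : Program :=
  .seq (.assign 11 (.arr 1 (.var 5)))
    (.seq (.ite (.and (.le (.const 0) (.arr 14 (.var 11))) (.and (.eq (.arr 5 (.var 5)) (.const 0))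
          (.not (.and (.le (.const 0) (.var 12)) (.le (.var 13) (.arr 12 (.var 11)))))))
        (.seq (.assign 12 (.var 5)) (.assign 13 (.arr 12 (.var 11)))) .skip)
      (.store 12 (.var 11) (.add (.arr 12 (.var 11)) (.const 1))))

def selectProgram : Program := .seq (.assign 12 (.const (-1))) (forLoop 5 4 selectBody)

/-- Write the last arc of the path. -/
def pathInit : Program :=
  .seq (.assign 11 (.arr 1 (.var 12)))
    (.seq (.assign 15 (.add (.add (.arr 13 (.var 11)) (.arr 13 (.var 11))) (.const 1)))
      (.seq (.assign 3 (.add (.var 15) (.const 2)))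
        (.seq (.store 6 (.add (.var 15) (.const 1)) (.const 2))
          (.seq (.store 7 (.add (.var 15) (.const 1)) (.var 12))
            (.store 8 (.add (.var 15) (.const 1)) (.const 1))))))

/-- Write the two residual arcs that lead to the value in register `11`. -/
def pathBody : Program :=
  .seq (.assign 8 (.arr 14 (.var 11)))
    (.seq (.assign 14 (.arr 11 (.var 8)))
      (.seq (.store 6 (.var 15) (.const 1))
        (.seq (.store 7 (.var 15) (.var 8))
          (.seq (.store 8 (.var 15) (.const 1))
            (.seq (.ite (.eq (.arr 3 (.var 14)) (.const 0))
              (.seq (.store 6 (.sub (.var 15) (.const 1)) (.const 0))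
                (.seq (.store 7 (.sub (.var 15) (.const 1)) (.var 14))
                  (.store 8 (.sub (.var 15) (.const 1)) (.const 1))))
              (.seq (.store 6 (.sub (.var 15) (.const 1)) (.const 1))
                (.seq (.store 7 (.sub (.var 15) (.const 1)) (.arr 16 (.var 14)))
                  (.seq (.store 8 (.sub (.var 15) (.const 1)) (.const (-1)))
                    (.assign 11 (.arr 1 (.arr 16 (.var 14))))))))
              (.assign 15 (.sub (.var 15) (.const 2))))))))

def pathProgram : Program := .seq pathInit (.loop (.le (.const 0) (.var 15)) pathBody)

def reportProgram : Program :=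
  .ite (.le (.const 0) (.var 12)) (.seq pathProgram (.assign 2 (.const 1)))
    (.assign 2 (.const 0))

def findPathProgram : Program :=
  .seq sizeProgram (.seq resetProgram (.seq linkProgram (.seq enqueueProgram
    (.seq searchProgram (.seq selectProgram reportProgram)))))

section FindPath

variable {α : Type*} [DecidableEq α] {n : ℕ} {D : Fin n → Finset α}
variable {e : ∀ i, Fin (D i).card ≃ D i} {code : DX D ↪ ℤ} {s : Store} {f : Arc D → ℝ}

/-- The choice among the cells before position `q`. -/
def Selected (e : ∀ i, Fin (D i).card ≃ D i) (code : DX D ↪ ℤ) (f : Arc D → ℝ) (q : ℕ)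
    (s : Store) : Prop :=
  (s.var 12 = -1 ∧ ∀ v k, Visited code s v → f (snkArc v k) = 0 → ¬ cell e (snkArc v k) < q) ∨
    ∃ v, ∃ k : Fin (owners D v.1).card, Visited code s v ∧ f (snkArc v k) = 0 ∧
      s.var 12 = cell e (snkArc v k) ∧ s.var 13 = (k : ℕ) ∧
      ∀ v', ∀ k' : Fin (owners D v'.1).card, Visited code s v' → f (snkArc v' k') = 0 →
        cell e (snkArc v' k') < q → (k : ℕ) ≤ k'

/-- If `c` counts the parallel arcs of `v` met before this cell, then the arc at this cell has
index, and so cost, `c`. -/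
theorem snk_index_eq {v : DX D} {k : Fin (owners D v.1).card} {c : ℕ}
    (hc : ∀ k', cell e (snkArc v k') < cell e (snkArc v k) ↔ (k' : ℕ) < c) : (k : ℕ) = c := by
  have h1 : ¬ (k : ℕ) < c := fun h => lt_irrefl _ ((hc k).2 h)
  by_contra hne
  have hck : c < k := by omega
  have := (hc ⟨c, hck.trans k.2⟩).1 (cell_snkArc_lt e hck)
  exact lt_irrefl _ this

theorem snk_cell_eq_iff {v w : DX D} {k : Fin (owners D v.1).card}
    {k' : Fin (owners D w.1).card} :
    cell e (snkArc w k') = cell e (snkArc v k) ↔ w = v ∧ (k' : ℕ) = k := by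
  constructor
  · intro h
    have := cell_injective e (a := snkArc w k') (b := snkArc v k) rfl h
    cases this
    exact ⟨rfl, rfl⟩
  · rintro ⟨rfl, h⟩
    rw [Fin.ext h]

open Classical in
theorem selectBody_sem {q c k : ℤ} (h5 : s.var 5 = q) (h1 : s.arr 1 q = c) (h12 : s.arr 12 c = k) :
    selectBody.sem s = (if 0 ≤ s.arr 14 c ∧ s.arr 5 q = 0 ∧ ¬ (0 ≤ s.var 12 ∧ s.var 13 ≤ k) then
      ((s.setVar 11 c).setVar 12 q).setVar 13 k else s.setVar 11 c).setArr 12 c (k + 1) := by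
  have hev : (Test.and (.le (.const 0) (.arr 14 (.var 11))) (.and (.eq (.arr 5 (.var 5)) (.const 0))
      (.not (.and (.le (.const 0) (.var 12)) (.le (.var 13) (.arr 12 (.var 11))))))).eval
      (s.setVar 11 c) ↔
      0 ≤ s.arr 14 c ∧ s.arr 5 q = 0 ∧ ¬ (0 ≤ s.var 12 ∧ s.var 13 ≤ k) := by
    simp [Exp.eval, Test.eval, h5, h12]
  simp only [selectBody, sem, Exp.eval, h5, h1, hev]
  split_ifs <;> simp [h12, h5]

theorem selectProgram_runs (hn : 0 < domSum D) (hd : EncodesDomains code e s)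
    (hf : EncodesFlow e f s) (h4 : s.var 4 = domSum D) (h12 : ∀ v, s.arr 12 (code v) = 0) :
    Runs selectProgram s (100 * domSum D) (Selected e code f (domSum D)) := by
  have h1 : Runs (.assign 12 (.const (-1))) s 2 fun s' => s' = s.setVar 12 (-1) :=
    Runs.of_sem trivial rfl
  refine Runs.mono (B₁ := 2 + (selectBody.cost + 20) * domSum D)
    (h1.seq (R := Selected e code f (domSum D)) ?_) ?_ fun _ _ h => h
  swap
  · simp [Program.cost, Exp.time, Test.time, selectBody]
    omega
  rintro _ hu rfl
  have := Runs.forLoop (x := 5) (y := 4) (c := selectBody) (s := s.setVar 12 (-1)) (N := domSum D)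
    (M := domSum D) ⟨trivial, ⟨⟨trivial, trivial⟩, trivial⟩, trivial⟩
    (by decide) (by decide) (by decide) (by simpa using h4)
    -- Array `12` counts for every value, visited or not, its arcs into `t` before `q`; the count at
    -- the current cell is the cost of the arc there.
    (fun q s' => Selected e code f q s' ∧ ∀ v, ∃ c : ℕ, s'.arr 12 (code v) = c ∧
      ∀ k, cell e (snkArc v k) < q ↔ (k : ℕ) < c) ?_ ?_ le_rfl (by omega)
  · exact this.mono le_rfl fun _ _ h => h.1
  · exact ⟨Or.inl ⟨by simp, by simp⟩, fun v => ⟨0, by simp [h12], by simp⟩⟩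
  · rintro q hq s' hu' hq5 ⟨hS, hC⟩
    obtain ⟨v, k, rfl, e1⟩ : ∃ v : DX D, ∃ k : Fin (owners D v.1).card,
        cell e (snkArc v k) = q ∧ s'.arr 1 q = code v := by
      obtain ⟨i, d, rfl⟩ := exists_pos e hq
      obtain ⟨k, hk⟩ := exists_snkArc e i d
      exact ⟨_, k, hk, by rw [hu'.arr 1 (by decide)]; exact hd.2.2 i d⟩
    obtain ⟨c, hc, hck⟩ := hC v
    have hkc := snk_index_eq hck
    rw [← hkc] at hc
    have e5 : s'.arr 5 (cell e (snkArc v k)) = 0 ↔ f (snkArc v k) = 0 := by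
      rw [hu'.arr 5 (by decide)]; exact_mod_cast hf.snk v k 0
    have hsem := selectBody_sem hq5 e1 hc
    simp only [e5] at hsem
    have h12' : (selectBody.sem s').arr 12 = Function.update (s'.arr 12) (code v) ((k : ℕ) + 1) := by
      rw [hsem]
      funext x
      split_ifs <;> simp [Function.update_apply]
    have h14' : (selectBody.sem s').arr 14 = s'.arr 14 := by
      rw [hsem]
      funext x
      split_ifs <;> simp
    have hcond : (Visited code s' v ∧ f (snkArc v k) = 0 ∧
          ¬ (0 ≤ s'.var 12 ∧ s'.var 13 ≤ (k : ℕ))) ∧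
          (selectBody.sem s').var 12 = cell e (snkArc v k) ∧ (selectBody.sem s').var 13 = (k : ℕ) ∨
        ¬ (Visited code s' v ∧ f (snkArc v k) = 0 ∧ ¬ (0 ≤ s'.var 12 ∧ s'.var 13 ≤ (k : ℕ))) ∧
          (selectBody.sem s').var 12 = s'.var 12 ∧ (selectBody.sem s').var 13 = s'.var 13 := by
      rw [hsem]
      by_cases hh : 0 ≤ s'.arr 14 (code v) ∧ f (snkArc v k) = 0 ∧
          ¬ (0 ≤ s'.var 12 ∧ s'.var 13 ≤ (k : ℕ))
      · refine Or.inl ⟨hh, ?_⟩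
        rw [if_pos hh]
        simp
      · refine Or.inr ⟨hh, ?_⟩
        rw [if_neg hh]
        simp
    generalize selectBody.sem s' = s'' at *
    have hvv : ∀ w, Visited code s'' w ↔ Visited code s' w := fun w => by
      rw [Visited, h14']; rfl
    have hlt : ∀ w, ∀ k' : Fin (owners D w.1).card,
        cell e (snkArc w k') < cell e (snkArc v k) + 1 ↔
        cell e (snkArc w k') < cell e (snkArc v k) ∨ (w = v ∧ (k' : ℕ) = k) := fun w k' => by
      rw [← snk_cell_eq_iff (e := e), Nat.lt_succ_iff_lt_or_eq]
    refine ⟨?_, fun w => ?_⟩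
    · unfold Selected
      simp only [Store.setVar_var, show (12 : ℕ) ≠ 5 by decide, show (13 : ℕ) ≠ 5 by decide,
        if_false]
      have hvis5 : ∀ w z, Visited code (s''.setVar 5 z) w ↔ Visited code s' w := fun w z => hvv w
      simp only [hvis5, hlt]
      rcases hcond with ⟨hh, hcond⟩ | ⟨hh, hcond⟩
      · right
        refine ⟨v, k, hh.1, hh.2.1, hcond.1, hcond.2, fun w k' hw hw' hor => ?_⟩
        rcases hor with h' | ⟨-, h'⟩
        · rcases hS with ⟨-, hno⟩ | ⟨v₁, k₁, -, -, h121, h131, hmin⟩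
          · exact absurd h' (hno w k' hw hw')
          · have := hmin w k' hw hw' h'
            have := hh.2.2
            omega
        · exact h'.ge
      · rcases hS with ⟨h12e, hno⟩ | ⟨v₁, k₁, hv₁, hf₁, h121, h131, hmin⟩
        · left
          refine ⟨hcond.1.trans h12e, fun w k' hw hw' hor => ?_⟩
          rcases hor with h' | ⟨rfl, h'⟩
          · exact hno w k' hw hw' h'
          · refine hh ⟨hw, Fin.ext h' ▸ hw', ?_⟩
            rw [h12e]
            omega
        · right
          refine ⟨v₁, k₁, hv₁, hf₁, hcond.1.trans h121, hcond.2.trans h131,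
            fun w k' hw hw' hor => ?_⟩
          rcases hor with h' | ⟨rfl, h'⟩
          · exact hmin w k' hw hw' h'
          · by_contra hlt'
            refine hh ⟨hw, Fin.ext h' ▸ hw', ?_⟩
            omega
    · rw [Store.setVar_arr, h12']
      by_cases hw : w = v
      · subst hw
        refine ⟨k + 1, by rw [Function.update_self]; push_cast; rfl, fun k' => ?_⟩
        rw [hlt, hck, ← hkc]
        simp only [true_and]
        omega
      · obtain ⟨c', hc', hck'⟩ := hC w
        refine ⟨c', by rw [Function.update_of_ne (code.injective.ne hw), hc'], fun k' => ?_⟩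
        rw [hlt, hck']
        simp [hw]

/-- The residual arcs of `p` are stored in the arrays `6`, `7`, `8` from index `b` on. -/
def PathAt (e : ∀ i, Fin (D i).card ≃ D i) (s : Store) (b : ℤ) (p : List (ResArc (Arc D))) : Prop :=
  ∀ (j : ℕ) (hj : j < p.length), s.arr 6 (b + j) = kind p[j].arc ∧
    s.arr 7 (b + j) = cell e p[j].arc ∧ s.arr 8 (b + j) = p[j].dir

theorem PathAt.cons {s s' : Store} {b : ℤ} {p : List (ResArc (Arc D))} (h : PathAt e s (b + 1) p)
    (hs : ∀ a, a = 6 ∨ a = 7 ∨ a = 8 → ∀ j, b + 1 ≤ j → s'.arr a j = s.arr a j)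
    {r : ResArc (Arc D)} (h6 : s'.arr 6 b = kind r.arc) (h7 : s'.arr 7 b = cell e r.arc)
    (h8 : s'.arr 8 b = r.dir) : PathAt e s' b (r :: p) := by
  rintro (_ | j) hj
  · simpa using ⟨h6, h7, h8⟩
  · have := h j (by simpa using hj)
    have hb : b + ((j + 1 : ℕ) : ℤ) = b + 1 + j := by push_cast; ring
    rw [hb, hs 6 (by simp) _ (by omega), hs 7 (by simp) _ (by omega), hs 8 (by simp) _ (by omega)]
    simpa using this

/-- A residual path from the value `v` of depth `l` to the sink, of cost `κ`, through vertices that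
do not occur on the way back from `v` to the source. -/
structure TailPath (code : DX D ↪ ℤ) (f : Arc D → ℝ) (s : Store) (κ : ℝ) (v : DX D) (l : ℤ)
    (p : List (ResArc (Arc D))) : Prop where
  walk : (graph D).IsWalk (.val v) p .t
  residual : ∀ r ∈ p, (graph D).InResidual f r
  nodup : (p.map (graph D).resHead).Nodup
  fresh : ∀ x ∈ p.map (graph D).resHead, x = .t ∨ (∃ w, x = .val w ∧ l < s.arr 13 (code w)) ∨
    ∃ i d, x = .var i ∧ f (domArc i d) = 1 ∧ l ≤ s.arr 13 (code (toDX i d))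
  cost : (graph D).pathCost p = κ

theorem pathCost_cons_of_kind {r : ResArc (Arc D)} {p : List (ResArc (Arc D))}
    (h : (graph D).resCost r = 0) : (graph D).pathCost (r :: p) = (graph D).pathCost p := by
  simp [Network.pathCost, h]

namespace TailPath

variable {κ : ℝ} {l : ℤ} {p : List (ResArc (Arc D))} {i : Fin n} {d : D i}

/-- The later variables are assigned whereas `x_i` is not, and the later values are deeper than `d`,
so no vertex is repeated. -/
theorem source_cons (h : TailPath code f s κ (toDX i d) l p)
    (hl : s.arr 13 (code (toDX i d)) = l) (hi : f (srcArc i) = 0) (hd : f (domArc i d) = 0)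
    (hd' : ∀ d', f (domArc i d') ≠ 1) :
    (graph D).IsResPath f (.fwd (srcArc i) :: .fwd (domArc i d) :: p) ∧
      (graph D).pathCost (.fwd (srcArc i) :: .fwd (domArc i d) :: p) = κ := by
  refine ⟨⟨⟨rfl, rfl, h.walk⟩, ?_, ?_⟩, ?_⟩
  · simp only [List.forall_mem_cons]
    refine ⟨?_, ?_, h.residual⟩
    · simp [Network.InResidual, graph, hi]
    · simp [Network.InResidual, graph, hd]
  · have e1 : (graph D).resHead (.fwd (srcArc i)) = .var i := rfl
    have e2 : (graph D).resHead (.fwd (domArc i d)) = .val (toDX i d) := rfl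
    have e3 : (graph D).source = .s := rfl
    rw [List.map_cons, List.map_cons, e1, e2, e3, List.nodup_cons, List.nodup_cons,
      List.nodup_cons]
    refine ⟨?_, ?_, ?_, h.nodup⟩
    · simp only [List.mem_cons, reduceCtorEq, false_or]
      intro hm
      rcases h.fresh _ hm with h' | ⟨w, h', -⟩ | ⟨j, d', h', -⟩ <;> cases h'
    · simp only [List.mem_cons, reduceCtorEq, false_or]
      intro hm
      rcases h.fresh _ hm with h' | ⟨w, h', -⟩ | ⟨j, d', h', hf', -⟩ <;> cases h'
      exact hd' d' hf'
    · intro hm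
      rcases h.fresh _ hm with h' | ⟨w, h', hlt⟩ | ⟨j, d', h', hf', -⟩ <;> cases h'
      omega
  · rw [pathCost_cons_of_kind (by simp [Network.resCost, graph]),
      pathCost_cons_of_kind (by simp [Network.resCost, graph]), h.cost]

/-- The assigned value of `x_i` has depth `l - 1`, those of the later variables have depth at least
`l`, and later values are deeper than `l`; hence neither `x_i` nor `d` occurs in `p`. -/
theorem cons_cons {L : DX D → ℕ} (hb : Balanced f L) (h : TailPath code f s κ (toDX i d) l p)
    (hl : s.arr 13 (code (toDX i d)) = l) (hd : f (domArc i d) = 0) {d' : D i}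
    (hd' : f (domArc i d') = 1) (hl' : s.arr 13 (code (toDX i d')) + 1 = l) :
    TailPath code f s κ (toDX i d') (l - 1)
      (.bwd (domArc i d') :: .fwd (domArc i d) :: p) := by
  have e1 : (graph D).resHead (.bwd (domArc i d')) = .var i := rfl
  have e2 : (graph D).resHead (.fwd (domArc i d)) = .val (toDX i d) := rfl
  refine ⟨⟨rfl, rfl, h.walk⟩, ?_, ?_, ?_, ?_⟩
  · simp only [List.forall_mem_cons]
    refine ⟨?_, ?_, h.residual⟩
    · simp [Network.InResidual, hd']
    · simp [Network.InResidual, graph, hd]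
  · rw [List.map_cons, List.map_cons, e1, e2, List.nodup_cons, List.nodup_cons]
    refine ⟨?_, ?_, h.nodup⟩
    · simp only [List.mem_cons, reduceCtorEq, false_or]
      intro hm
      rcases h.fresh _ hm with h' | ⟨w, h', -⟩ | ⟨j, d₂, h', hf', hle⟩ <;> cases h'
      rw [hb.assigned_unique hf' hd'] at hle
      omega
    · intro hm
      rcases h.fresh _ hm with h' | ⟨w, h', hlt⟩ | ⟨j, d', h', hf', -⟩ <;> cases h'
      omega
  · intro x hx
    rw [List.map_cons, List.map_cons, e1, e2, List.mem_cons, List.mem_cons] at hx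
    rcases hx with rfl | rfl | hx
    · exact Or.inr (Or.inr ⟨i, d', rfl, hd', by omega⟩)
    · exact Or.inr (Or.inl ⟨_, rfl, by omega⟩)
    · rcases h.fresh x hx with h' | ⟨w, h', hlt⟩ | ⟨j, d₂, h', hf', hle⟩
      · exact Or.inl h'
      · exact Or.inr (Or.inl ⟨w, h', by omega⟩)
      · exact Or.inr (Or.inr ⟨j, d₂, h', hf', by omega⟩)
  · rw [pathCost_cons_of_kind (by simp [Network.resCost, graph]),
      pathCost_cons_of_kind (by simp [Network.resCost, graph]), h.cost]

end TailPath

theorem pathProgram_runs {L : DX D → ℕ} (hn : 0 < domSum D) (hb : Balanced f L)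
    (hd : EncodesDomains code e s) (hf : EncodesFlow e f s) (hl : Linked e code f (domSum D) s)
    (hE : Explored e code f s) {v : DX D} {k : Fin (owners D v.1).card} (hv : Visited code s v)
    (hk : f (snkArc v k) = 0) (h12 : s.var 12 = cell e (snkArc v k)) :
    Runs pathProgram s (1000 * domSum D) fun s' => ∃ p, (graph D).IsResPath f p ∧
      (graph D).pathCost p = (k : ℕ) ∧ EncodesPath e p s' := by
  obtain ⟨i₀, d₀, l₀, hv₀, -, hl₀, hlb, -⟩ := hE.tree v hv
  have e1 : s.arr 1 (cell e (snkArc v k)) = code v := hd.2.2 _ _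
  -- A path to a value of depth `l` takes rows `0` to `2l + 1`, and the rest starts at row `2l + 2`.
  -- Register `15` is the row of the arc into the current value; each pass fills two rows, and after
  -- depth 0 the register becomes `-1`, which ends the loop.
  let I : ℕ → Store → Prop := fun m s' =>
    (∃ w, ∃ l : ℕ, ∃ p, m = l + 1 ∧ s'.var 11 = code w ∧ Visited code s w ∧
      s.arr 13 (code w) = l ∧ s'.var 15 = 2 * l + 1 ∧ TailPath code f s (k : ℕ) w l p ∧
      PathAt e s' (2 * l + 2) p ∧ s'.var 3 = 2 * l + 2 + p.length) ∨
    (s'.var 15 < 0 ∧ ∃ p, (graph D).IsResPath f p ∧ (graph D).pathCost p = (k : ℕ) ∧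
      EncodesPath e p s')
  have h1 : Runs pathInit s pathInit.cost fun s' => I (l₀ + 1) s' := by
    refine Runs.of_sem ⟨trivial, trivial, trivial, trivial, trivial, trivial⟩ (Or.inl
      ⟨v, l₀, [.fwd (snkArc v k)], rfl, ?_, hv, hl₀, ?_, ⟨⟨rfl, rfl⟩, ?_, ?_, ?_, ?_⟩, ?_, ?_⟩)
    · simp [pathInit, sem, Exp.eval, h12, e1]
    · simp [pathInit, sem, Exp.eval, h12, e1, hl₀]
      ring
    · simp [Network.InResidual, graph, hk]
    · simp
    · intro x hx
      left
      simpa [Network.resHead, graph] using hx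
    · simp [Network.pathCost, Network.resCost, graph]
    · intro j hj
      have : j = 0 := by simpa using hj
      subst this
      have h2 : 2 * (l₀ : ℤ) + 2 = l₀ + l₀ + 1 + 1 := by ring
      simp [pathInit, sem, Exp.eval, h12, e1, hl₀, h2, ResArc.arc, ResArc.dir, kind]
    · simp [pathInit, sem, Exp.eval, h12, e1, hl₀]
      ring
  have h2 : Runs pathProgram s (pathInit.cost + ((3 + pathBody.cost + 1) * (l₀ + 1) + (3 + 1)))
      fun s' => ∃ p, (graph D).IsResPath f p ∧ (graph D).pathCost p = (k : ℕ) ∧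
        EncodesPath e p s' := by
    refine h1.seq fun s₁ hu₁ hI₁ => ?_
    refine (Runs.loop (B := pathBody.cost) I ?_ hI₁).mono (by simp [Test.time, Exp.time]) ?_
    · intro m s' hu' hI hb'
      simp only [Test.eval, Exp.eval] at hb'
      have hu : Unchanged pathProgram s s' :=
        (hu₁.mono (by simp [pathProgram, varsWritten]) (by simp [pathProgram, arrsWritten])).trans
        (hu'.mono (by simp [pathProgram, varsWritten]) (by simp [pathProgram, arrsWritten]))
      obtain ⟨w, l, p, rfl, h11, hw, hwl, h15, hT, hP, h3⟩ | ⟨hneg, -⟩ := hI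
      swap
      · omega
      refine Runs.of_sem (Q := fun s'' => ∃ m' < l + 1, I m' s'')
        ⟨trivial, trivial, trivial, trivial, trivial, ⟨⟨trivial, trivial, trivial⟩,
          trivial, trivial, trivial, trivial⟩, trivial⟩ ?_
      obtain ⟨i, d, l', rfl, h14, hl', -, hpar⟩ := hE.tree w hw
      have hll : l' = l := by omega
      subst hll
      have e14 : s'.arr 14 (code (toDX i d)) = pos e i d := by rw [hu.arr 14 (by decide), h14]
      have e11 : s'.arr 11 (pos e i d) = (i : ℕ) := by
        rw [hu.arr 11 (by decide), hl.owner i d (pos_lt_domSum e i d)]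
      have e3 : s'.arr 3 (i : ℕ) = 0 ↔ f (srcArc i) = 0 := by
        rw [hu.arr 3 (by decide)]; exact_mod_cast hf.src i 0
      have hsrc : f (srcArc i) = 0 → ∀ d', f (domArc i d') = 0 := by
        intro h0 d'
        rw [← hb.sum_var i, Finset.sum_eq_zero_iff_of_nonneg fun d _ => hb.flow.1 _] at h0
        exact h0 d' (Finset.mem_univ _)
      rcases hpar with ⟨h0, rfl⟩ | ⟨d', hf', hv', hdep⟩
      · refine ⟨0, by omega, Or.inr ⟨?_, _, (hT.source_cons hl' h0 (hsrc h0 d) fun d' h => ?_).1,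
          (hT.source_cons hl' h0 (hsrc h0 d) fun d' h => ?_).2, ?_, ?_⟩⟩
        · simp [pathBody, sem, Exp.eval, Test.eval, h11, e14, e11, e3, h0, h15]
        · rw [hsrc h0 d'] at h; exact zero_ne_one h
        · rw [hsrc h0 d'] at h; exact zero_ne_one h
        · simp [pathBody, sem, Exp.eval, Test.eval, h11, e14, e11, e3, h0, h3]
          ring
        · have hPA : PathAt e (pathBody.sem s') 0 (.fwd (srcArc i) :: .fwd (domArc i d) :: p) := by
            refine PathAt.cons (s := pathBody.sem s') (PathAt.cons (s := s') (by simpa using hP)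
              ?_ ?_ ?_ ?_) (fun _ _ _ _ => rfl) ?_ ?_ ?_
            · rintro a (rfl | rfl | rfl) j hj <;>
                simp [pathBody, sem, Exp.eval, Test.eval, h11, e14, e11, e3, h0, h15] <;>
                rw [if_neg (by omega), if_neg (by omega)]
            all_goals simp [pathBody, sem, Exp.eval, Test.eval, h11, e14, e11, e3, h0, h15,
              ResArc.arc, ResArc.dir, kind, cell_srcArc, cell_domArc]
          intro j
          simpa using hPA j j.2
      · have h0 : f (srcArc i) ≠ 0 := fun h0 => by
          rw [hsrc h0 d'] at hf'; exact zero_ne_one hf'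
        have e16 : s'.arr 16 (i : ℕ) = pos e i d' := by
          rw [hu.arr 16 (by decide), hl.assigned i d' (pos_lt_domSum e i d') hf']
        have e1' : s'.arr 1 (pos e i d') = code (toDX i d') := by
          rw [hu.arr 1 (by decide)]; exact hd.2.2 i d'
        -- If the parent cell were the assigned one, `d` and `d'` would coincide, but their depths
        -- differ by 1.
        have hd0 : f (domArc i d) = 0 := by
          refine (hb.integral _).resolve_right fun h => ?_
          rw [hb.assigned_unique h hf'] at hl'
          omega
        have hlpos : 1 ≤ l' := by
          have : (0 : ℤ) ≤ s.arr 13 (code (toDX i d')) := by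
            obtain ⟨_, _, l₂, -, -, h, -⟩ := hE.tree _ hv'
            omega
          omega
        obtain ⟨l, rfl⟩ : ∃ l, l' = l + 1 := ⟨l' - 1, by omega⟩
        have hT' := hT.cons_cons hb hl' hd0 hf' hdep
        refine ⟨l + 1, by omega, Or.inl ⟨toDX i d', l,
          .bwd (domArc i d') :: .fwd (domArc i d) :: p, rfl, ?_, hv', ?_, ?_, ?_, ?_, ?_⟩⟩
        rotate_left 3
        · have : ((l + 1 : ℕ) : ℤ) - 1 = l := by push_cast; ring
          rw [this] at hT'
          exact hT'
        · have hPA : PathAt e s' (2 * l + 2 + 1 + 1) p := by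
            have : 2 * ((l + 1 : ℕ) : ℤ) + 2 = 2 * l + 2 + 1 + 1 := by push_cast; ring
            rwa [this] at hP
          have h15' : s'.var 15 = 2 * l + 2 + 1 := by rw [h15]; push_cast; ring
          refine PathAt.cons (s := pathBody.sem s') (PathAt.cons (s := s') hPA ?_ ?_ ?_ ?_)
            (fun _ _ _ _ => rfl) ?_ ?_ ?_
          · rintro a (rfl | rfl | rfl) j hj <;>
              simp [pathBody, sem, Exp.eval, Test.eval, h11, e14, e11, e3, h0, h15'] <;>
              rw [if_neg (by omega), if_neg (by omega)]
          all_goals simp [pathBody, sem, Exp.eval, Test.eval, h11, e14, e11, e3, h0, h15', e16,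
            ResArc.arc, ResArc.dir, kind, cell_domArc]
        · simp [pathBody, sem, Exp.eval, Test.eval, h11, e14, e11, e3, h0, h3]
          ring
        · simp [pathBody, sem, Exp.eval, Test.eval, h11, e14, e11, e3, h0, e16, e1']
        · push_cast at hdep; omega
        · simp [pathBody, sem, Exp.eval, Test.eval, h11, e14, e11, e3, h0, h15]
          ring
    · rintro s' hu' ⟨⟨m, hI⟩, hne⟩
      obtain ⟨w, l, p, -, -, -, -, h15, -⟩ | ⟨-, h⟩ := hI
      · simp only [Test.eval, Exp.eval, h15] at hne
        omega
      · exact h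
  refine h2.mono ?_ fun _ _ h => h
  simp [Program.cost, Exp.time, Test.time, pathInit, pathBody]
  omega

/-- Along inner residual arcs, visited values lead back to variables assigned to them, and `closed`
then leads on to visited values. -/
theorem Explored.visited {L : DX D → ℕ} (hb : Balanced f L) (h : Explored e code f s) {i : Fin n}
    {v : DX D} (hi : f (srcArc i) = 0) (hr : InnerReach f (.var i) (.val v)) :
    Visited code s v := by
  have key : ∀ x, InnerReach f (.var i) x → (∀ v, x = .val v → Visited code s v) ∧
      ∀ j, x = .var j → f (srcArc j) = 0 ∨ ∃ d, f (domArc j d) = 1 ∧ Visited code s (toDX j d) := by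
    intro x hx
    induction hx with
    | refl => exact ⟨fun v hv => (by cases hv), fun j hj => by cases hj; exact Or.inl hi⟩
    | tail _ hs ih =>
      obtain ⟨r, hk, hr, rfl, rfl⟩ := hs
      obtain (j | ⟨j, d⟩ | q) | (j | ⟨j, d⟩ | q) := r
      · simp [kind, ResArc.arc] at hk
      · refine ⟨fun v hv => ?_, fun j hj => by cases hj⟩
        cases hv
        exact h.closed j (ih.2 j rfl) d
      · simp [kind, ResArc.arc] at hk
      · simp [kind, ResArc.arc] at hk
      · refine ⟨fun v hv => (by cases hv), fun j' hj => ?_⟩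
        cases hj
        exact Or.inr ⟨d, (hb.residual_iff _).2.1 hr, ih.1 _ rfl⟩
      · simp [kind, ResArc.arc] at hk
  exact (key _ hr).1 v rfl

theorem reportProgram_runs {L : DX D → ℕ} (hn : 0 < domSum D) (hb : Balanced f L)
    (hd : EncodesDomains code e s) (hf : EncodesFlow e f s) (hl : Linked e code f (domSum D) s)
    (hE : Explored e code f s) (hS : Selected e code f (domSum D) s) :
    Runs reportProgram s (1010 * domSum D) fun s' =>
      (s'.var 2 = 1 ∧ ∃ p, (graph D).IsMinCostResPath f p ∧ EncodesPath e p s' ∧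
        (graph D).pathCost p = s'.var 13) ∨
      (s'.var 2 = 0 ∧ ¬ ∃ p, (graph D).IsResPath f p) := by
  -- Every residual path ends with one of the arcs among which the selection takes the cheapest; so
  -- the written path is optimal, and without a candidate there is no path.
  have hcand : ∀ p, (graph D).IsResPath f p → ∃ v, ∃ k : Fin (owners D v.1).card,
      Visited code s v ∧ f (snkArc v k) = 0 ∧ (graph D).pathCost p = (k : ℕ) := by
    intro p hp
    obtain ⟨i, mid, v, k, -, -, -, -, hi, hk, hr, hc⟩ := hb.form_of_isResPath hp
    exact ⟨v, k, hE.visited hb hi hr, by rw [hb.sink, if_neg (not_lt.2 hk)], hc⟩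
  have h2 : Runs reportProgram s (3 + 1 + (1000 * domSum D + 2)) fun s' =>
      (s'.var 2 = 1 ∧ ∃ p, (graph D).IsMinCostResPath f p ∧ EncodesPath e p s' ∧
        (graph D).pathCost p = s'.var 13) ∨
      (s'.var 2 = 0 ∧ ¬ ∃ p, (graph D).IsResPath f p) := by
    refine Runs.ite (b := .le (.const 0) (.var 12)) (fun h12 => ?_) (fun h12 => ?_)
    · simp only [Test.eval, Exp.eval] at h12
      obtain ⟨h, -⟩ | ⟨v, k, hv, hk, h12', h13, hmin⟩ := hS
      · omega
      · refine (pathProgram_runs hn hb hd hf hl hE hv hk h12').seq fun s₁ hu₁ h₁ => ?_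
        refine Runs.of_sem (c := .assign 2 (.const 1)) trivial (Or.inl ⟨by simp [sem, Exp.eval], ?_⟩)
        obtain ⟨p, hp, hpc, hpe⟩ := h₁
        refine ⟨p, ⟨hp, fun q hq => ?_⟩, ⟨?_, ?_⟩, ?_⟩
        · obtain ⟨v', k', hv', hk', hq'⟩ := hcand q hq
          rw [hpc, hq']
          exact_mod_cast hmin v' k' hv' hk' (cell_snkArc_lt_domSum e v' k')
        · simpa [sem, Exp.eval] using hpe.1
        · simpa [sem, Exp.eval] using hpe.2
        · have : s₁.var 13 = (k : ℕ) := by rw [hu₁.var 13 (by decide), h13]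
          simp [sem, this, hpc]
    · refine Runs.mono (Runs.of_sem (c := .assign 2 (.const 0)) (Q := fun s' => s'.var 2 = 0) trivial
        (by simp [sem, Exp.eval])) ?_ fun s' hu' h' => Or.inr ⟨h', ?_⟩
      · simp [Program.cost, Exp.time]
      · rintro ⟨p, hp⟩
        simp only [Test.eval, Exp.eval] at h12
        obtain ⟨v', k', hv', hk', hq'⟩ := hcand p hp
        obtain ⟨-, h⟩ | ⟨v, k, hv, hk, h12', h13, hmin⟩ := hS
        · exact h v' k' hv' hk' (cell_snkArc_lt_domSum e v' k')
        · omega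
  exact h2.mono (by omega) fun _ _ h => h

theorem Linked.congr {s s' : Store} {q : ℕ} (hl : Linked e code f q s)
    (h9 : s'.arr 9 = s.arr 9) (h10 : s'.arr 10 = s.arr 10) (h11 : s'.arr 11 = s.arr 11)
    (h16 : s'.arr 16 = s.arr 16) : Linked e code f q s' :=
  ⟨h9 ▸ hl.head, h10 ▸ hl.next, h11 ▸ hl.owner, h16 ▸ hl.assigned⟩

theorem Explored.congr {s s' : Store} (hE : Explored e code f s) (h13 : s'.arr 13 = s.arr 13)
    (h14 : s'.arr 14 = s.arr 14) : Explored e code f s' := by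
  have hvv : ∀ v, Visited code s' v ↔ Visited code s v := fun v => by rw [Visited, h14]; rfl
  refine ⟨fun i hi d => ?_, fun v hv => ?_⟩
  · rw [hvv]
    refine hE.closed i (hi.imp id fun ⟨d, h, h'⟩ => ⟨d, h, (hvv _).1 h'⟩) d
  · rw [hvv] at hv
    exact (hE.tree v hv).mono le_rfl (fun _ _ => by rw [h14]) (fun _ _ => by rw [h13]) hv

/-- Nothing is assumed about the working arrays, so leftovers of earlier rounds are harmless: every
table entry that is read has been rebuilt. Register `13` returns the cost of the path for the
running total. -/
theorem findPathProgram_runs {L : DX D → ℕ} (hD : ∀ i, (D i).Nonempty) (hn : 0 < n)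
    (hb : Balanced f L) (hd : EncodesDomains code e s) (hf : EncodesFlow e f s) :
    Runs findPathProgram s (3000 * domSum D) fun s' =>
      (s'.var 2 = 1 ∧ ∃ p, (graph D).IsMinCostResPath f p ∧ EncodesPath e p s' ∧
        (graph D).pathCost p = s'.var 13) ∨
      (s'.var 2 = 0 ∧ ¬ ∃ p, (graph D).IsResPath f p) := by
  have hm := le_domSum hD
  have hm' : 0 < domSum D := by omega
  refine Runs.mono (B₁ := 3 + (100 * domSum D + (100 * domSum D + (100 * domSum D +
    (1000 * domSum D + (100 * domSum D + 1010 * domSum D)))))) ?_ (by omega) fun _ _ h => h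
  refine (sizeProgram_runs hd).seq fun s₁ u₁ h₁ => ?_
  have hd₁ : EncodesDomains code e s₁ :=
    hd.congr (u₁.var 0 (by decide)) (u₁.arr 0 (by decide)) (u₁.arr 1 (by decide))
  have hf₁ : EncodesFlow e f s₁ :=
    hf.congr (u₁.arr 3 (by decide)) (u₁.arr 4 (by decide)) (u₁.arr 5 (by decide))
  refine (resetProgram_runs hm' hd₁ h₁).seq fun s₂ u₂ h₂ => ?_
  have hd₂ : EncodesDomains code e s₂ :=
    hd₁.congr (u₂.var 0 (by decide)) (u₂.arr 0 (by decide)) (u₂.arr 1 (by decide))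
  have hf₂ : EncodesFlow e f s₂ :=
    hf₁.congr (u₂.arr 3 (by decide)) (u₂.arr 4 (by decide)) (u₂.arr 5 (by decide))
  have h4₂ : s₂.var 4 = domSum D := (u₂.var 4 (by decide)).trans h₁
  refine (linkProgram_runs hb hD hn hd₂ hf₂ h4₂ fun v => (h₂ v).1).seq fun s₃ u₃ h₃ => ?_
  have hd₃ : EncodesDomains code e s₃ :=
    hd₂.congr (u₃.var 0 (by decide)) (u₃.arr 0 (by decide)) (u₃.arr 1 (by decide))
  have hf₃ : EncodesFlow e f s₃ :=
    hf₂.congr (u₃.arr 3 (by decide)) (u₃.arr 4 (by decide)) (u₃.arr 5 (by decide))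
  refine (enqueueProgram_runs hD hn hd₃ hf₃).seq fun s₄ u₄ h₄ => ?_
  have hd₄ : EncodesDomains code e s₄ :=
    hd₃.congr (u₄.var 0 (by decide)) (u₄.arr 0 (by decide)) (u₄.arr 1 (by decide))
  have hf₄ : EncodesFlow e f s₄ :=
    hf₃.congr (u₄.arr 3 (by decide)) (u₄.arr 4 (by decide)) (u₄.arr 5 (by decide))
  have hl₄ : Linked e code f (domSum D) s₄ := h₃.congr (u₄.arr 9 (by decide))
    (u₄.arr 10 (by decide)) (u₄.arr 11 (by decide)) (u₄.arr 16 (by decide))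
  have h14₄ : ∀ v, s₄.arr 14 (code v) = -1 := fun v => by
    rw [u₄.arr 14 (by decide), u₃.arr 14 (by decide), (h₂ v).2.2]
  refine (searchProgram_runs hD hn hb hd₄ hf₄ hl₄ h14₄ h₄).seq fun s₅ u₅ h₅ => ?_
  have hd₅ : EncodesDomains code e s₅ :=
    hd₄.congr (u₅.var 0 (by decide)) (u₅.arr 0 (by decide)) (u₅.arr 1 (by decide))
  have hf₅ : EncodesFlow e f s₅ :=
    hf₄.congr (u₅.arr 3 (by decide)) (u₅.arr 4 (by decide)) (u₅.arr 5 (by decide))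
  have h4₅ : s₅.var 4 = domSum D := by
    rw [u₅.var 4 (by decide), u₄.var 4 (by decide), u₃.var 4 (by decide), h4₂]
  have h12₅ : ∀ v, s₅.arr 12 (code v) = 0 := fun v => by
    rw [u₅.arr 12 (by decide), u₄.arr 12 (by decide), u₃.arr 12 (by decide), (h₂ v).2.1]
  refine (selectProgram_runs hm' hd₅ hf₅ h4₅ h12₅).seq fun s₆ u₆ h₆ => ?_
  refine reportProgram_runs hm' hb
    (hd₅.congr (u₆.var 0 (by decide)) (u₆.arr 0 (by decide)) (u₆.arr 1 (by decide)))
    (hf₅.congr (u₆.arr 3 (by decide)) (u₆.arr 4 (by decide)) (u₆.arr 5 (by decide)))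
    (hl₄.congr ?_ ?_ ?_ ?_) (h₅.congr (u₆.arr 13 (by decide)) (u₆.arr 14 (by decide))) h₆
  · rw [u₆.arr 9 (by decide), u₅.arr 9 (by decide)]
  · rw [u₆.arr 10 (by decide), u₅.arr 10 (by decide)]
  · rw [u₆.arr 11 (by decide), u₅.arr 11 (by decide)]
  · rw [u₆.arr 16 (by decide), u₅.arr 16 (by decide)]

end FindPath

end SoftAlldiff


namespace SoftAlldiff

open Program

/-! ## The whole algorithm and the consistency check -/

/-- Set `f = 0`, and the total cost kept in register `16` to `0`. -/
def startProgram : Program := .seq initProgram (.assign 16 (.const 0))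

/-- Add the cost of the path to the total, and augment. -/
def stepProgram : Program := .seq (.assign 16 (.add (.var 16) (.var 13))) augmentProgram

/-- Run the algorithm, and compare the cost of the flow with the largest element of `D_z`. -/
def checkProgram : Program :=
  .seq (sspProgram startProgram findPathProgram stepProgram)
    (.ite (.le (.var 16) (.arr 2 (.sub (.var 1) (.const 1)))) (.assign 2 (.const 1))
      (.assign 2 (.const 0)))

section Algorithm

variable {α : Type*} [DecidableEq α] {n : ℕ} {D : Fin n → Finset α}
variable {e : ∀ i, Fin (D i).card ≃ D i} {code : DX D ↪ ℤ} {s : Store} {f : Arc D → ℝ}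

theorem startProgram_runs (hn : 0 < n) (hD : ∀ i, (D i).Nonempty) (hd : EncodesDomains code e s) :
    Runs startProgram s (102 * domSum D) fun s' => EncodesFlow e 0 s' ∧ s'.var 16 = 0 := by
  have hm := le_domSum hD
  refine Runs.mono ((initProgram_runs hn hD hd).seq (R := fun s' => EncodesFlow e 0 s' ∧
    s'.var 16 = 0) fun s₁ _ h₁ => Runs.of_sem (c := .assign 16 (.const 0)) trivial ⟨?_, ?_⟩)
    ?_ fun _ _ h => h
  · exact h₁.congr rfl rfl rfl
  · simp [sem, Exp.eval]
  · simp only [Program.cost, Exp.time]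
    omega

theorem stepProgram_runs (hn : 0 < n) (hD : ∀ i, (D i).Nonempty) {p : List (ResArc (Arc D))}
    (hp : (graph D).IsResPath f p) (hf : EncodesFlow e f s) (hps : EncodesPath e p s) :
    Runs stepProgram s (404 * domSum D) fun s' => EncodesFlow e (f + chi p) s' ∧
      s'.var 16 = s.var 16 + s.var 13 := by
  have hm := le_domSum hD
  have h₁ : Runs (.assign 16 (.add (.var 16) (.var 13))) s 4
      fun s' => s' = s.setVar 16 (s.var 16 + s.var 13) := Runs.of_sem trivial rfl
  refine Runs.mono (B₁ := 4 + 400 * domSum D) (h₁.seq (R := fun s' => EncodesFlow e (f + chi p) s' ∧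
    s'.var 16 = s.var 16 + s.var 13) fun s₁ _ h => ?_) (by omega) fun _ _ h => h
  subst h
  have hps' : EncodesPath e p (s.setVar 16 (s.var 16 + s.var 13)) :=
    ⟨by simpa using hps.1, fun j => hps.2 j⟩
  have hf' : EncodesFlow e f (s.setVar 16 (s.var 16 + s.var 13)) := hf.congr rfl rfl rfl
  refine (augmentProgram_runs hD hn hp hf' hps').mono le_rfl
    fun s' u h => ⟨h, ?_⟩
  · rw [u.var 16 (by decide)]
    simp

theorem sspProgram_runs (hn : 0 < n) (hD : ∀ i, (D i).Nonempty) (hd : EncodesDomains code e s) :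
    Runs (sspProgram startProgram findPathProgram stepProgram) s (7000 * (n * domSum D)) fun s' =>
      ∃ l f, (graph D).SSPRun l f ∧ l.length = n ∧ EncodesFlow e f s' ∧
        (graph D).flowCost f = s'.var 16 := by
  have hm := le_domSum hD
  let Found (f : Arc D → ℝ) (s' : Store) : Prop :=
    EncodesDomains code e s' ∧ EncodesFlow e f s' ∧ (graph D).flowCost f = s'.var 16 ∧
      ((s'.var 2 = 1 ∧ ∃ p, (graph D).IsMinCostResPath f p ∧ EncodesPath e p s' ∧
        (graph D).pathCost p = s'.var 13) ∨
      (s'.var 2 = 0 ∧ ¬ ∃ p, (graph D).IsResPath f p))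
  have hfind : ∀ l f s', (graph D).SSPRun l f → EncodesDomains code e s' → EncodesFlow e f s' →
      (graph D).flowCost f = s'.var 16 →
      Runs findPathProgram s' (3000 * domSum D) (Found f) := by
    intro l f s' hr hd' hf hc
    obtain ⟨L, hb⟩ := sspRun_balanced hr
    refine (findPathProgram_runs hD hn hb hd' hf).mono le_rfl fun s'' u h => ⟨?_, ?_, ?_, h⟩
    · exact hd'.congr (u.var 0 (by decide)) (u.arr 0 (by decide)) (u.arr 1 (by decide))
    · exact hf.congr (u.arr 3 (by decide)) (u.arr 4 (by decide)) (u.arr 5 (by decide))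
    · rw [hc, u.var 16 (by decide)]
  -- The counter is the number of augmentations still to be made.
  let I (k : ℕ) (s' : Store) : Prop := ∃ l f, (graph D).SSPRun l f ∧ k + l.length = n ∧ Found f s'
  refine Runs.mono (B₁ := 102 * domSum D + (3000 * domSum D +
    ((3 + (404 * domSum D + 3000 * domSum D) + 1) * n + (3 + 1)))) ?_ ?_ fun _ _ h => h
  · refine (startProgram_runs hn hD hd).seq fun s₁ u₁ h₁ => ?_
    have hd₁ : EncodesDomains code e s₁ :=
      hd.congr (u₁.var 0 (by decide)) (u₁.arr 0 (by decide)) (u₁.arr 1 (by decide))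
    refine (hfind [] 0 s₁ .init hd₁ h₁.1 (by simp [Network.flowCost, h₁.2])).seq
      fun s₂ _ h₂ => ?_
    refine (Runs.loop (B := 404 * domSum D + 3000 * domSum D) I ?_ (k := n)
      ⟨[], 0, .init, rfl, h₂⟩).mono le_rfl ?_
    · rintro k s' - ⟨l, f, hr, hk, hd', hf, hc, hpath⟩ htest
      simp only [Test.eval, Exp.eval] at htest
      obtain ⟨-, p, hp, hps, hpc⟩ | ⟨h0, -⟩ := hpath
      swap
      · omega
      obtain ⟨L, hb⟩ := sspRun_balanced hr
      have hr' := hr.step hp ((hb.isMaxStep_iff hp.1 _).2 rfl)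
      rw [one_smul] at hr'
      have hlen := sspRun_length_le hr'
      rw [List.length_append, List.length_singleton] at hlen
      refine (stepProgram_runs hn hD hp.1 hf hps).seq fun s₃ u₃ h₃ => ?_
      refine (hfind _ _ s₃ hr' (hd'.congr (u₃.var 0 (by decide)) (u₃.arr 0 (by decide))
        (u₃.arr 1 (by decide))) h₃.1 ?_).mono le_rfl fun s₄ _ h₄ => ?_
      · rw [hp.1.flowCost, hc, hpc, h₃.2]
        push_cast
        rfl
      · refine ⟨k - 1, by omega, _, _, hr', ?_, h₄⟩
        rw [List.length_append, List.length_singleton]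
        omega
    · rintro s' - ⟨⟨k, l, f, hr, hk, -, hf, hc, hpath⟩, htest⟩
      simp only [Test.eval, Exp.eval] at htest
      refine ⟨l, f, hr, ?_, hf, hc⟩
      obtain ⟨h1, -⟩ | ⟨-, hno⟩ := hpath
      · exact absurd h1 htest
      -- With fewer than `n` augmentations a path would exist, contrary to the report that ended the
      -- loop.
      · by_contra hne
        obtain ⟨p, hp⟩ := sspRun_exists_path hD hr (by omega)
        exact hno ⟨p, hp.1⟩
  · have h1 : domSum D ≤ n * domSum D := Nat.le_mul_of_pos_left _ hn
    have h2 : (3 + (404 * domSum D + 3000 * domSum D) + 1) * n = 3404 * (n * domSum D) + 4 * n := by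
      ring
    omega

theorem checkProgram_runs (hn : 0 < n) (hD : ∀ i, (D i).Nonempty) (hd : EncodesDomains code e s)
    {Dz : Finset ℤ} (hz : Dz.Nonempty) (hdz : EncodesCostDomain Dz s) :
    Runs checkProgram s (7100 * (n * domSum D)) fun s' =>
      (s'.var 2 = 1 ∧ Consistent D Dz) ∨ (s'.var 2 = 0 ∧ ¬ Consistent D Dz) := by
  have hm : domSum D ≤ n * domSum D := Nat.le_mul_of_pos_left _ hn
  have hm' := le_domSum hD
  have hcard := hz.card_pos
  refine Runs.mono (B₁ := 7000 * (n * domSum D) + (6 + 1 + 2)) ?_ (by omega) fun _ _ h => h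
  refine (sspProgram_runs hn hD hd).seq ?_
  rintro s₁ u₁ ⟨l, f, hr, hl, -, hc⟩
  obtain ⟨L, hb⟩ := sspRun_balanced hr
  -- The list is increasing and indexed from 0, so its last entry is the maximum.
  have hmax : s₁.arr 2 (s₁.var 1 - 1) = Dz.max' hz := by
    rw [u₁.arr 2 (by decide), u₁.var 1 (by decide), hdz.1]
    have := hdz.2 ⟨Dz.card - 1, by omega⟩
    rw [Finset.orderEmbOfFin_last rfl hcard] at this
    rw [← this]
    push_cast [Nat.cast_sub (Nat.one_le_iff_ne_zero.2 hcard.ne')]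
    rfl
  have hiff : Consistent D Dz ↔ s₁.var 16 ≤ s₁.arr 2 (s₁.var 1 - 1) := by
    rw [hb.consistent_iff (sspRun_saturated hr hl) (Dz.max'_mem hz) fun z h => Dz.le_max' z h, hc,
      hmax, Int.cast_le]
  have hB : (Test.le (.var 16) (.arr 2 (.sub (.var 1) (.const 1)))).time = 6 := rfl
  rw [← hB]
  refine Runs.ite (fun h => ?_) (fun h => ?_)
  · exact Runs.of_sem (c := .assign 2 (.const 1)) trivial
      (Or.inl ⟨by simp [sem, Exp.eval], hiff.2 h⟩)
  · exact Runs.of_sem (c := .assign 2 (.const 0)) trivial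
      (Or.inr ⟨by simp [sem, Exp.eval], fun h' => h (hiff.1 h')⟩)

end Algorithm

end SoftAlldiff

theorem mainTheorem5 :
    -- every run of the algorithm on the graph
    (∀ (α : Type*) [DecidableEq α] (n : ℕ) (D : Fin n → Finset α), (∀ i, (D i).Nonempty) →
      ∀ (l : List (List (ResArc (Arc D)) × ℝ)) (f : Arc D → ℝ), (graph D).SSPRun l f →
        l.length ≤ n ∧
        (l.length < n → ∃ p, (graph D).IsMinCostResPath f p) ∧
        (∀ p, (graph D).IsMinCostResPath f p → (graph D).IsMaxStep f p 1) ∧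
        (l.length = n → (¬ ∃ p, (graph D).IsResPath f p) ∧ (graph D).IsMinCostFlow f) ∧
        ∀ q ∈ l, q.2 = 1 ∧
          (∃ i, q.1.filter (fun r => kind r.arc = 0) = [ResArc.fwd (srcArc i)]) ∧
          (∃ d k, q.1.filter (fun r => kind r.arc = 2) = [ResArc.fwd (snkArc d k)])) ∧
    -- the running times
    ∃ (init findPath augment check : Program) (C : ℕ),
      ∀ (α : Type*) [DecidableEq α] (n : ℕ) (D : Fin n → Finset α), 0 < n →
        (∀ i, (D i).Nonempty) →
      ∀ (code : DX D ↪ ℤ) (e : ∀ i, Fin (D i).card ≃ D i) (s : Store), EncodesDomains code e s →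
        -- the zero flow
        (∃ s' T, Exec init s s' T ∧ T ≤ C * domSum D ∧
          EncodesDomains code e s' ∧ EncodesFlow e 0 s') ∧
        -- one path, for every flow that occurs in the algorithm
        (∀ l f, (graph D).SSPRun l f → EncodesFlow e f s →
          ∃ s' T, Exec findPath s s' T ∧ T ≤ C * domSum D ∧
            EncodesDomains code e s' ∧ EncodesFlow e f s' ∧
            ((s'.var 2 = 1 ∧ ∃ p, (graph D).IsMinCostResPath f p ∧ EncodesPath e p s') ∨
              (s'.var 2 = 0 ∧ ¬ ∃ p, (graph D).IsResPath f p))) ∧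
        -- one augmentation
        (∀ l f p ε, (graph D).SSPRun l f → (graph D).IsMinCostResPath f p →
          (graph D).IsMaxStep f p ε → EncodesFlow e f s → EncodesPath e p s →
          ∃ s' T, Exec augment s s' T ∧ T ≤ C * domSum D ∧
            EncodesDomains code e s' ∧ EncodesFlow e (f + ε • chi p) s') ∧
        -- the whole algorithm
        (∃ s' T, Exec (sspProgram init findPath augment) s s' T ∧ T ≤ C * (n * domSum D) ∧
          ∃ l f, (graph D).SSPRun l f ∧ (¬ ∃ p, (graph D).IsResPath f p) ∧
            (graph D).IsMinCostFlow f ∧ EncodesFlow e f s') ∧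
        -- consistency
        (∀ Dz : Finset ℤ, Dz.Nonempty → EncodesCostDomain Dz s →
          ∃ s' T, Exec check s s' T ∧ T ≤ C * (n * domSum D) ∧
            ((s'.var 2 = 1 ∧ Consistent D Dz) ∨ (s'.var 2 = 0 ∧ ¬ Consistent D Dz))) := by
  refine ⟨fun α _ n D hD l f hr => ?_, startProgram, findPathProgram, stepProgram, checkProgram,
    7100, fun α _ n D hn hD code e s hd => ⟨?_, fun l f hr hf => ?_,
      fun l f p ε hr hp hε hf hps => ?_, ?_, fun Dz hz hdz => ?_⟩⟩
  · obtain ⟨L, hb⟩ := sspRun_balanced hr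
    refine ⟨sspRun_length_le hr, sspRun_exists_path hD hr,
      fun p hp => (hb.isMaxStep_iff hp.1 _).2 rfl, fun hl => ?_, sspRun_augmentations hr⟩
    exact ⟨not_exists_resPath (sspRun_saturated hr hl),
      hb.isMinCostFlow (sspRun_saturated hr hl)⟩
  · obtain ⟨s', T, he, hT, u, h⟩ := startProgram_runs hn hD hd
    exact ⟨s', T, he, hT.trans (Nat.mul_le_mul_right _ (by norm_num)),
      hd.congr (u.var 0 (by decide)) (u.arr 0 (by decide)) (u.arr 1 (by decide)), h.1⟩
  · obtain ⟨L, hb⟩ := sspRun_balanced hr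
    obtain ⟨s', T, he, hT, u, h⟩ := findPathProgram_runs hD hn hb hd hf
    refine ⟨s', T, he, hT.trans (Nat.mul_le_mul_right _ (by norm_num)),
      hd.congr (u.var 0 (by decide)) (u.arr 0 (by decide)) (u.arr 1 (by decide)),
      hf.congr (u.arr 3 (by decide)) (u.arr 4 (by decide)) (u.arr 5 (by decide)), ?_⟩
    exact h.imp_left fun ⟨h2, p, hp, hps, _⟩ => ⟨h2, p, hp, hps⟩
  · obtain ⟨L, hb⟩ := sspRun_balanced hr
    obtain rfl := (hb.isMaxStep_iff hp.1 _).1 hε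
    -- Registers `13` and `16` are arbitrary here; the running total is meaningful only inside the
    -- whole algorithm, and only the flow is used.
    obtain ⟨s', T, he, hT, u, h⟩ := stepProgram_runs hn hD hp.1 hf hps
    rw [one_smul]
    exact ⟨s', T, he, hT.trans (Nat.mul_le_mul_right _ (by norm_num)),
      hd.congr (u.var 0 (by decide)) (u.arr 0 (by decide)) (u.arr 1 (by decide)), h.1⟩
  · obtain ⟨s', T, he, hT, -, l, f, hr, hl, hf, -⟩ := sspProgram_runs hn hD hd
    obtain ⟨L, hb⟩ := sspRun_balanced hr
    exact ⟨s', T, he, hT.trans (Nat.mul_le_mul_right _ (by norm_num)), l, f, hr,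
      not_exists_resPath (sspRun_saturated hr hl), hb.isMinCostFlow (sspRun_saturated hr hl), hf⟩
  · obtain ⟨s', T, he, hT, -, h⟩ := checkProgram_runs hn hD hd hz hdz
    exact ⟨s', T, he, hT, h⟩
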